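/- **Theorem 3.11.** Let $\Omega\subset\mathbb R^2$ be a bounded open set with Lipschitz boundary, let $h:[0,1]\to\mathbb R$ be a bounded Borel function, and let $f(u,v)=h(|u\cdot v|)$ for $u,v\in S^1$. Let $\mathbb M^{2\times2}_{sym}$ be the space of symmetric $2\times2$ matrices with the Frobenius norm $|\cdot|$, and let $K=\{Q\in\mathbb M^{2\times 2}_{sym}: Q\ge 0,\ \mathrm{tr}\,Q=1\}$. For $\varepsilon>0$ let $\mathbb Z_\varepsilon(\Omega)=\{i\in\mathbb Z^2:\varepsilon i\in\Omega\}$ and $W=[-\frac12,\frac12)^2$. A function $Q\in L^\infty(\Omega;K)$ is said to interpolate a spin field $u:\mathbb Z_\varepsilon(\Omega)\to S^1$, $i\mapsto u_i$, if $Q=u_i\otimes u_i$ a.e. in $\Omega\cap\varepsilon(i+W)$ for every $i\in\mathbb Z_\varepsilon(\Omega)$. Define $F_\varepsilon:L^\infty(\Omega;\mathbb M^{2\times2}_{sym})\to\mathbb R\cup\{+\infty\}$ by $$F_\varepsilon(Q)=\begin{cases}\displaystyle\sum_{|i-j|=1}\varepsilon^2 f(u_i,u_j)&\text{if } Q\in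 L^\infty(\Omega;K)\text{ interpolates a spin field }u,\\ +\infty&\text{otherwise,}\end{cases}$$ where the sum runs over all ordered pairs $(i,j)$ of points of $\mathbb Z_\varepsilon(\Omega)$ with $|i-j|=1$ (the value does not depend on the choice of $u$). Then, as $\varepsilon\to0$, $F_\varepsilon$ $\Gamma$-converges with respect to the weak$^*$ topology of $L^\infty(\Omega;\mathbb M^{2\times2}_{sym})$ to $$F(Q)=\begin{cases}\displaystyle 4\int_\Omega h^{++}\bigl(\sqrt2\,|Q(x)-\tfrac12 I|\bigr)\,dx&\text{if }Q\in L^\infty(\Omega;K),\\ +\infty&\text{otherwise,}\end{cases}$$ where $h^{++}:[0,1]\to\mathbb R$ is the largest nondecreasing, convex, lower semicontinuous function on $[0,1]$ lying below $h$ at every point of $[0,1]$. Here $\Gamma$-convergence means: for every sequence $\varepsilon_n>0$ with $\varepsilon_n\to0$ and every $Q\in L^\infty(\Omega;\mathbb M^{2\times2}_{sym})$, one has $F(Q)\le\liminf_n F_{\varepsilon_n}(Q_n)$ whenever $Q_n\rightharpoonup Q$ weakly$^*$, and there is a sequence $Q_n\rightharpoonup Q$ weakly$^*$ with $\limsup_n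 F_{\varepsilon_n}(Q_n)\le F(Q)$. -/

import Mathlib

open MeasureTheory Filter Topology Set
open scoped ENNReal NNReal

attribute [local instance] Matrix.frobeniusNormedAddCommGroup Matrix.frobeniusNormedSpace

noncomputable section

namespace NematicLattice

/-! ### The plane, domains, matrices -/

/-- The Euclidean plane `ℝ²`. -/
abbrev Plane : Type := EuclideanSpace ℝ (Fin 2)

/-- The unit circle `S¹`. -/
abbrev Circ : Type := Metric.sphere (0 : Plane) 1

/-- `Ω` has Lipschitz boundary: near each boundary point and in suitable orthonormal coordinates,
`Ω` is the region strictly below the graph of a Lipschitz function. -/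
def HasLipschitzBoundary (Ω : Set Plane) : Prop :=
  ∀ x ∈ frontier Ω, ∃ (L : Plane ≃ₗᵢ[ℝ] Plane) (r : ℝ) (C : ℝ≥0) (g : ℝ → ℝ),
    0 < r ∧ LipschitzWith C g ∧ ∀ y ∈ Metric.ball x r, (y ∈ Ω ↔ (L y) 1 < g ((L y) 0))

/-- The space of symmetric `2 × 2` matrices. -/
def symMatrices : Submodule ℝ (Matrix (Fin 2) (Fin 2) ℝ) where
  carrier := {A | A.IsSymm}
  add_mem' := fun ha hb => Matrix.IsSymm.add ha hb
  zero_mem' := Matrix.isSymm_zero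
  smul_mem' := fun c _ hA => Matrix.IsSymm.smul hA c

/-- Symmetric `2 × 2` matrices, normed by the Frobenius norm. -/
abbrev SymMat : Type := symMatrices

/-- The scalar product `A : B = ∑ᵢⱼ Aᵢⱼ Bᵢⱼ` of matrices. -/
def frobInner (A B : SymMat) : ℝ := ∑ i, ∑ j, A.1 i j * B.1 i j

/-- `K`: the positive semidefinite symmetric matrices of trace one. -/
def tensorSet : Set SymMat := {Q | Q.1.PosSemidef ∧ Q.1.trace = 1}

/-- The tensor `Q(u) = u ⊗ u`. -/
def tensorOf (u : Circ) : SymMat :=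
  ⟨Matrix.vecMulVec (u : Plane) (u : Plane), by
    change (Matrix.vecMulVec (u : Plane) (u : Plane)).transpose = _
    exact Matrix.transpose_vecMulVec _ _⟩

/-! ### The space `L^∞(Ω; 𝕄²ˣ²_sym)` and its weak* topology -/

/-- `L^∞(Ω; 𝕄²ˣ²_sym)`. -/
abbrev LInf (Ω : Set Plane) : Type := Lp SymMat ∞ (volume.restrict Ω)

/-- The weak* topology of `L^∞(Ω; 𝕄²ˣ²_sym)`, seen as the dual of `L¹(Ω; 𝕄²ˣ²_sym)`: the coarsest
topology for which all maps `Q ↦ ∫_Ω φ : Q dx` with `φ ∈ L¹` are continuous. -/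
abbrev weakStarTopology (Ω : Set Plane) : TopologicalSpace (LInf Ω) :=
  ⨅ φ : Lp SymMat 1 (volume.restrict Ω),
    TopologicalSpace.induced (fun Q : LInf Ω => ∫ x in Ω, frobInner (φ x) (Q x))
      (inferInstance : TopologicalSpace ℝ)

/-! ### `Γ`-convergence -/

/-- The family `F ε`, `ε > 0`, of functionals on `X` `Γ`-converges to `F₀` as `ε → 0` with respect
to the topology `t`: along every sequence of positive numbers tending to zero, the liminf inequality
holds for all converging sequences, and every point has a recovery sequence. -/
def GammaConverges {X : Type*} (t : TopologicalSpace X) (F : ℝ → X → EReal) (F₀ : X → EReal) :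
    Prop :=
  ∀ ε : ℕ → ℝ, (∀ n, 0 < ε n) → Tendsto ε atTop (𝓝 0) → ∀ x : X,
    (∀ y : ℕ → X, Tendsto y atTop (@nhds X t x) →
      F₀ x ≤ liminf (fun n => F (ε n) (y n)) atTop) ∧
    (∃ y : ℕ → X, Tendsto y atTop (@nhds X t x) ∧
      limsup (fun n => F (ε n) (y n)) atTop ≤ F₀ x)

/-! ### The lattice energies -/

/-- The point `ε i` of the lattice `ε ℤ²`. -/
def latticePoint (ε : ℝ) (i : Fin 2 → ℤ) : Plane := WithLp.toLp 2 (fun k => ε * (i k : ℝ))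

/-- `ℤ_ε(Ω)`: the `i ∈ ℤ²` with `ε i ∈ Ω`. -/
def latticeIn (ε : ℝ) (Ω : Set Plane) : Set (Fin 2 → ℤ) := {i | latticePoint ε i ∈ Ω}

/-- The cell `ε (i + [-1/2, 1/2)²)`. -/
def cell (ε : ℝ) (i : Fin 2 → ℤ) : Set Plane :=
  {x | ∀ k, ε * ((i k : ℝ) - 1 / 2) ≤ x k ∧ x k < ε * ((i k : ℝ) + 1 / 2)}

/-- The ordered pairs of nearest neighbours `i, j ∈ ℤ_ε(Ω)`, `|i - j| = 1`. -/
def neighbourPairs (ε : ℝ) (Ω : Set Plane) : Set ((Fin 2 → ℤ) × (Fin 2 → ℤ)) :=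
  {p | p.1 ∈ latticeIn ε Ω ∧ p.2 ∈ latticeIn ε Ω ∧ ∑ k, (p.1 k - p.2 k) ^ 2 = 1}

/-- `E_ε(u) = ∑_{|i - j| = 1} ε² f(u_i, u_j)`, a finite sum when `Ω` is bounded and `ε > 0`. Only the
values `u_i` with `i ∈ ℤ_ε(Ω)` enter. -/
def latticeEnergy (f : Circ → Circ → ℝ) (Ω : Set Plane) (ε : ℝ) (u : (Fin 2 → ℤ) → Circ) : ℝ :=
  ∑ᶠ p ∈ neighbourPairs ε Ω, ε ^ 2 * f (u p.1) (u p.2)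

/-- `Q ∈ C_ε(Ω; K)` is a piecewise-constant interpolation of the spin field `u`: it is `K`-valued
and equals `u_i ⊗ u_i` in `Ω ∩ ε (i + [-1/2, 1/2)²)` for every `i ∈ ℤ_ε(Ω)`. -/
def IsInterpolation (Ω : Set Plane) (ε : ℝ) (u : (Fin 2 → ℤ) → Circ) (Q : LInf Ω) : Prop :=
  (∀ᵐ x ∂(volume.restrict Ω), Q x ∈ tensorSet) ∧
    ∀ i ∈ latticeIn ε Ω, ∀ᵐ x ∂(volume.restrict Ω), x ∈ cell ε i → Q x = tensorOf (u i)

/-- `F_ε(Q) = E_ε(u)` if `Q` interpolates a spin field `u`, and `F_ε(Q) = +∞` if there is no such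
`u`. For open `Ω`, `ε > 0` and `f` with `f(u,v) = f(-u,v) = f(u,-v)`, all spin fields `u`
interpolated by `Q` have the same energy, so the infimum is over at most one number. -/
def discreteFunctional (f : Circ → Circ → ℝ) (Ω : Set Plane) (ε : ℝ) (Q : LInf Ω) : EReal :=
  ⨅ (u : (Fin 2 → ℤ) → Circ) (_ : IsInterpolation Ω ε u Q), (latticeEnergy f Ω ε u : EReal)

/-! ### The limit functional -/

/-- The functions that are nondecreasing, convex and lower semicontinuous on `[0,1]`, and lie below
`h` at every point of `[0,1]`. -/
def monotoneMinorants (h : ℝ → ℝ) : Set (ℝ → ℝ) :=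
  {g | MonotoneOn g (Icc 0 1) ∧ ConvexOn ℝ (Icc 0 1) g ∧ LowerSemicontinuousOn g (Icc 0 1) ∧
    ∀ t ∈ Icc (0 : ℝ) 1, g t ≤ h t}

/-- The nondecreasing convex lower semicontinuous envelope `h⁺⁺` of `h` on `[0,1]`: the pointwise
supremum of all nondecreasing convex lower semicontinuous functions below `h`. Only its values on
`[0,1]` are meaningful. -/
def monotoneEnvelope (h : ℝ → ℝ) (t : ℝ) : ℝ := sSup ((fun g : ℝ → ℝ => g t) '' monotoneMinorants h)

/-- For `h` bounded below on `[0,1]`, `h⁺⁺` is the largest element of the class over which the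
supremum is taken. -/
theorem monotoneEnvelope_isLargest (h : ℝ → ℝ) (hb : ∃ c, ∀ t ∈ Icc (0 : ℝ) 1, c ≤ h t) :
    monotoneEnvelope h ∈ monotoneMinorants h ∧
      ∀ g ∈ monotoneMinorants h, ∀ t ∈ Icc (0 : ℝ) 1, g t ≤ monotoneEnvelope h t := by
  obtain ⟨c, hc⟩ := hb
  have hne : ∀ t, ((fun g : ℝ → ℝ => g t) '' monotoneMinorants h).Nonempty := fun t =>
    ⟨c, fun _ => c, ⟨monotoneOn_const, convexOn_const c (convex_Icc 0 1),
      lowerSemicontinuousOn_const, hc⟩, rfl⟩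
  have hbd : ∀ t ∈ Icc (0 : ℝ) 1, BddAbove ((fun g : ℝ → ℝ => g t) '' monotoneMinorants h) := by
    rintro t ht
    refine ⟨h t, ?_⟩
    rintro _ ⟨g, hg, rfl⟩
    exact hg.2.2.2 t ht
  have hle : ∀ g ∈ monotoneMinorants h, ∀ t ∈ Icc (0 : ℝ) 1, g t ≤ monotoneEnvelope h t :=
    fun g hg t ht => le_csSup (hbd t ht) ⟨g, hg, rfl⟩
  refine ⟨⟨?_, ⟨convex_Icc 0 1, ?_⟩, ?_, ?_⟩, hle⟩
  · intro s hs t ht hst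
    refine csSup_le (hne s) ?_
    rintro _ ⟨g, hg, rfl⟩
    exact (hg.1 hs ht hst).trans (hle g hg t ht)
  · intro s hs t ht a b ha hb hab
    refine csSup_le (hne _) ?_
    rintro _ ⟨g, hg, rfl⟩
    refine (hg.2.1.2 hs ht ha hb hab).trans ?_
    have h1 := hle g hg s hs
    have h2 := hle g hg t ht
    simp only [smul_eq_mul]
    gcongr
  · intro t ht y hy
    obtain ⟨_, ⟨g, hg, rfl⟩, hyg⟩ := exists_lt_of_lt_csSup (hne t) hy
    filter_upwards [hg.2.2.1 t ht y hyg, self_mem_nhdsWithin] with s hs hs'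
    exact hs.trans_le (hle g hg s hs')
  · intro t ht
    refine csSup_le (hne t) ?_
    rintro _ ⟨g, hg, rfl⟩
    exact hg.2.2.2 t ht

open Classical in
/-- `F(Q) = 4 ∫_Ω h⁺⁺(√2 |Q(x) - I/2|) dx` if `Q` is `K`-valued, and `+∞` otherwise; `|·|` is the
Frobenius norm. -/
def limitFunctional (h : ℝ → ℝ) (Ω : Set Plane) (Q : LInf Ω) : EReal :=
  if ∀ᵐ x ∂(volume.restrict Ω), Q x ∈ tensorSet then
    ((4 * ∫ x in Ω, monotoneEnvelope h
      (√2 * ‖(Q x : Matrix (Fin 2) (Fin 2) ℝ) - (1 / 2 : ℝ) • 1‖) : ℝ) : EReal)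
  else ⊤

end NematicLattice

end

noncomputable section

namespace NematicLattice

/-! ### Lipschitz boundaries are null sets -/

theorem volume_graph_eq_zero {g : ℝ → ℝ} (hg : Measurable g) :
    volume {y : Plane | y 1 = g (y 0)} = 0 := by
  have hgr : MeasurableSet {p : ℝ × ℝ | p.2 = g p.1} :=
    measurableSet_eq_fun measurable_snd (hg.comp measurable_fst)
  have h0 : volume {p : ℝ × ℝ | p.2 = g p.1} = 0 := by
    rw [Measure.volume_eq_prod, Measure.measure_prod_null hgr]
    filter_upwards with a
    have : Prod.mk a ⁻¹' {p : ℝ × ℝ | p.2 = g p.1} = {g a} := by ext; simp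
    rw [this]; simp
  have mp := (volume_preserving_finTwoArrow ℝ).comp (PiLp.volume_preserving_ofLp (Fin 2))
  rw [← mp.measure_preimage hgr.nullMeasurableSet] at h0
  exact h0

theorem volume_frontier_eq_zero {Ω : Set Plane} (hΩ : HasLipschitzBoundary Ω) :
    volume (frontier Ω) = 0 := by
  refine measure_null_of_locally_null _ fun x hx => ?_
  obtain ⟨L, r, C, g, hr, hg, hL⟩ := hΩ x hx
  refine ⟨frontier Ω ∩ Metric.ball x r,
    inter_mem_nhdsWithin _ (Metric.ball_mem_nhds x hr), ?_⟩
  have hsub : frontier Ω ∩ Metric.ball x r ⊆ L ⁻¹' {y : Plane | y 1 = g (y 0)} := by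
    rintro y ⟨hy, hyb⟩
    have hc1 : Continuous fun y => (L y) 1 := by fun_prop
    have hc2 : Continuous fun y => g ((L y) 0) := hg.continuous.comp (by fun_prop)
    have hball := Metric.isOpen_ball.mem_nhds hyb
    rcases lt_trichotomy ((L y) 1) (g ((L y) 0)) with hlt | heq | hgt
    · exfalso
      have : ∀ᶠ z in 𝓝 y, z ∈ Ω := by
        filter_upwards [hball, hc1.continuousAt.eventually_lt hc2.continuousAt hlt] with z hz h1
        exact (hL z hz).2 h1
      exact hy.2 (mem_interior_iff_mem_nhds.2 this)
    · exact heq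
    · exfalso
      have : ∀ᶠ z in 𝓝 y, z ∉ Ω := by
        filter_upwards [hball, hc2.continuousAt.eventually_lt hc1.continuousAt hgt] with z hz h1 h2
        exact absurd ((hL z hz).1 h2) (not_lt.2 h1.le)
      have hcl := mem_closure_iff_frequently.1 hy.1
      exact hcl this
  refine measure_mono_null hsub ?_
  rw [L.measurePreserving.measure_preimage]
  · exact volume_graph_eq_zero hg.continuous.measurable
  · exact (measurableSet_eq_fun (by fun_prop) (hg.continuous.measurable.comp
      (by fun_prop))).nullMeasurableSet

/-! ### Neighbourhoods of the boundary -/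

/-- The area of the `r`-neighbourhood of the boundary. -/
def tube (Ω : Set Plane) (r : ℝ) : ℝ := volume.real (Metric.cthickening r (frontier Ω))

theorem volume_cthickening_ne_top {Ω : Set Plane} (hb : Bornology.IsBounded Ω) (r : ℝ) :
    volume (Metric.cthickening r (frontier Ω)) ≠ ∞ :=
  ((hb.closure.subset frontier_subset_closure).cthickening).measure_lt_top.ne

theorem tendsto_tube {Ω : Set Plane} (hb : Bornology.IsBounded Ω) (hl : HasLipschitzBoundary Ω) :
    Tendsto (tube Ω) (𝓝 0) (𝓝 0) := by
  have h := tendsto_measure_cthickening_of_isClosed (μ := volume) (s := frontier Ω)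
    ⟨1, one_pos, volume_cthickening_ne_top hb 1⟩ isClosed_frontier
  rw [volume_frontier_eq_zero hl] at h
  exact (ENNReal.tendsto_toReal ENNReal.zero_ne_top).comp h

theorem measureReal_le_tube {Ω : Set Plane} (hb : Bornology.IsBounded Ω) {r : ℝ} {s : Set Plane}
    (hs : s ⊆ Metric.cthickening r (frontier Ω)) : volume.real s ≤ tube Ω r :=
  measureReal_mono hs (volume_cthickening_ne_top hb r)

theorem mem_cthickening_frontier {Ω : Set Plane} {x y : Plane} {r : ℝ} (hxy : dist x y ≤ r)
    (h : ¬ (x ∈ Ω ↔ y ∈ Ω)) : x ∈ Metric.cthickening r (frontier Ω) := by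
  have hpre : IsPreconnected (segment ℝ x y) := (convex_segment x y).isPreconnected
  have : (segment ℝ x y ∩ frontier Ω).Nonempty := by
    by_contra hcon
    have hno : ∀ z ∈ segment ℝ x y, z ∉ frontier Ω := fun z hz hzf => hcon ⟨z, hz, hzf⟩
    have hcase : ∀ z ∈ segment ℝ x y, z ∈ interior Ω ∨ z ∈ (closure Ω)ᶜ := fun z hz => by
      by_contra hc
      push Not at hc
      exact hno z hz ⟨not_notMem.1 hc.2, hc.1⟩
    have hint : ∀ z ∈ segment ℝ x y, z ∈ Ω → z ∈ interior Ω := fun z hz hzΩ =>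
      (hcase z hz).resolve_right fun h => h (subset_closure hzΩ)
    have hext : ∀ z ∈ segment ℝ x y, z ∉ Ω → z ∈ (closure Ω)ᶜ := fun z hz hzΩ =>
      (hcase z hz).resolve_left fun h => hzΩ (interior_subset h)
    have hxs := left_mem_segment ℝ x y
    have hys := right_mem_segment ℝ x y
    obtain ⟨z, -, hz1, hz2⟩ := hpre _ _ isOpen_interior isClosed_closure.isOpen_compl hcase
      (by
        by_cases hx : x ∈ Ω
        · exact ⟨x, hxs, hint x hxs hx⟩
        · exact ⟨y, hys, hint y hys (by tauto)⟩)
      (by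
        by_cases hx : x ∈ Ω
        · exact ⟨y, hys, hext y hys (by tauto)⟩
        · exact ⟨x, hxs, hext x hxs hx⟩)
    exact hz2 (interior_subset_closure hz1)
  obtain ⟨z, hz, hzf⟩ := this
  refine Metric.mem_cthickening_of_dist_le x z r _ hzf ?_
  have := mem_segment_iff_wbtw.1 hz
  have h2 := this.dist_add_dist
  linarith [dist_nonneg (x := z) (y := y)]

theorem abs_setIntegral_sub_le {w : Plane → ℝ} {C : ℝ} {A B T : Set Plane}
    (hA : MeasurableSet A) (hB : MeasurableSet B)
    (hwA : IntegrableOn w A) (hwB : IntegrableOn w B)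
    (hC : ∀ᵐ x, x ∈ A ∪ B → |w x| ≤ C) (hT : volume T ≠ ∞) (hC0 : 0 ≤ C)
    (h : ∀ x, ¬ (x ∈ A ↔ x ∈ B) → x ∈ T) :
    |(∫ x in A, w x) - ∫ x in B, w x| ≤ 2 * C * volume.real T := by
  have e1 := integral_inter_add_sdiff (s := A) (t := B) hB hwA
  have e2 := integral_inter_add_sdiff (s := B) (t := A) hA hwB
  rw [inter_comm] at e2
  have hs1 : A \ B ⊆ T := fun x hx => h x (by have := hx.1; have := hx.2; tauto)
  have hs2 : B \ A ⊆ T := fun x hx => h x (by have := hx.1; have := hx.2; tauto)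
  have b1 : ‖∫ x in A \ B, w x‖ ≤ C * volume.real (A \ B) := by
    refine norm_setIntegral_le_of_norm_le_const_ae' ((measure_mono hs1).trans_lt hT.lt_top) ?_
    filter_upwards [hC] with x hx h using hx (Or.inl h.1)
  have b2 : ‖∫ x in B \ A, w x‖ ≤ C * volume.real (B \ A) := by
    refine norm_setIntegral_le_of_norm_le_const_ae' ((measure_mono hs2).trans_lt hT.lt_top) ?_
    filter_upwards [hC] with x hx h using hx (Or.inr h.1)
  have m1 := mul_le_mul_of_nonneg_left (measureReal_mono hs1 hT) hC0
  have m2 := mul_le_mul_of_nonneg_left (measureReal_mono hs2 hT) hC0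
  rw [Real.norm_eq_abs, abs_le] at b1 b2
  rw [abs_le]
  constructor <;> linarith [b1.1, b1.2, b2.1, b2.2]

/-! ### Lattice cells -/

/-- The lattice site whose cell contains `x`. -/
def site (ε : ℝ) (x : Plane) : Fin 2 → ℤ := fun k => ⌊x k / ε + 1 / 2⌋

theorem measurable_site (ε : ℝ) : Measurable (site ε) := by
  refine measurable_pi_lambda _ fun k => ?_
  exact Int.measurable_floor.comp (by fun_prop)

theorem mem_cell_iff {ε : ℝ} (hε : 0 < ε) (i : Fin 2 → ℤ) (x : Plane) :
    x ∈ cell ε i ↔ site ε x = i := by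
  simp only [cell, mem_ofPred_eq, site, funext_iff, Int.floor_eq_iff]
  refine forall_congr' fun k => ?_
  have e : x k = ε * (x k / ε) := by field_simp
  constructor
  · rintro ⟨h1, h2⟩
    rw [e] at h1 h2
    have h1 := le_of_mul_le_mul_left h1 hε
    have h2 := lt_of_mul_lt_mul_left h2 hε.le
    constructor <;> linarith
  · rintro ⟨h1, h2⟩
    rw [e]
    constructor
    · exact mul_le_mul_of_nonneg_left (by linarith) hε.le
    · exact mul_lt_mul_of_pos_left (by linarith) hε

theorem volume_cell {ε : ℝ} (hε : 0 < ε) (i : Fin 2 → ℤ) :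
    volume (site ε ⁻¹' {i}) = ENNReal.ofReal (ε ^ 2) := by
  have h1 : site ε ⁻¹' {i} = (WithLp.ofLp : Plane → Fin 2 → ℝ) ⁻¹'
      (Set.pi univ fun k => Ico (ε * ((i k : ℝ) - 1 / 2)) (ε * ((i k : ℝ) + 1 / 2))) := by
    ext x
    simp only [mem_preimage, mem_singleton_iff, ← mem_cell_iff hε]
    simp [cell]
  rw [h1, (PiLp.volume_preserving_ofLp (Fin 2)).measure_preimage
    (MeasurableSet.univ_pi fun _ => measurableSet_Ico).nullMeasurableSet, Real.volume_pi_Ico]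
  simp only [Fin.prod_univ_two]
  rw [← ENNReal.ofReal_mul (by linarith)]
  ring_nf

theorem measurableSet_site (ε : ℝ) (s : Set (Fin 2 → ℤ)) : MeasurableSet (site ε ⁻¹' s) :=
  measurable_site ε (MeasurableSet.of_discrete)

theorem measurable_comp_site {β : Type*} [MeasurableSpace β] (ε : ℝ) (F : (Fin 2 → ℤ) → β) :
    Measurable fun x => F (site ε x) :=
  (Measurable.of_discrete (f := F)).comp (measurable_site ε)

theorem volume_site_finset {ε : ℝ} (hε : 0 < ε) (T : Finset (Fin 2 → ℤ)) :
    volume (site ε ⁻¹' T) = T.card * ENNReal.ofReal (ε ^ 2) := by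
  have : site ε ⁻¹' (T : Set (Fin 2 → ℤ)) = ⋃ i ∈ T, site ε ⁻¹' {i} := by ext; simp
  rw [this, measure_biUnion_finset]
  · simp [volume_cell hε]
  · intro i _ j _ hij
    exact Disjoint.preimage _ (by simpa using hij)
  · exact fun i _ => measurableSet_site ε _

theorem integrableOn_comp_site {ε : ℝ} {F : (Fin 2 → ℤ) → ℝ} {C : ℝ} (hC : ∀ i, |F i| ≤ C)
    {s : Set Plane} (hs : volume s ≠ ∞) : IntegrableOn (fun x => F (site ε x)) s :=
  Measure.integrableOn_of_bounded hs (measurable_comp_site ε F).aestronglyMeasurable (M := C)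
    (Eventually.of_forall fun x => by simpa using hC _)

theorem setIntegral_comp_site {ε : ℝ} (hε : 0 < ε) (T : Finset (Fin 2 → ℤ))
    (F : (Fin 2 → ℤ) → ℝ) :
    ∫ x in site ε ⁻¹' T, F (site ε x) = ε ^ 2 * ∑ i ∈ T, F i := by
  have hT : site ε ⁻¹' (T : Set (Fin 2 → ℤ)) = ⋃ i ∈ T, site ε ⁻¹' {i} := by ext; simp
  have hcst : ∀ i, EqOn (fun x => F (site ε x)) (fun _ => F i) (site ε ⁻¹' {i}) := by
    intro i x hx
    simp only [mem_preimage, mem_singleton_iff] at hx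
    simp [hx]
  rw [hT, integral_biUnion_finset, Finset.mul_sum]
  · refine Finset.sum_congr rfl fun i _ => ?_
    rw [setIntegral_congr_fun (measurableSet_site ε _) (hcst i)]
    simp [Measure.real, volume_cell hε, ENNReal.toReal_ofReal (sq_nonneg ε)]
  · exact fun i _ => measurableSet_site ε _
  · intro i _ j _ hij
    exact Disjoint.preimage _ (by simpa using hij)
  · intro i _
    refine (integrableOn_congr_fun (hcst i) (measurableSet_site ε _)).2 ?_
    exact integrableOn_const (by simp [volume_cell hε])

theorem dist_le_of_abs_sub_le {x y : Plane} {r : ℝ} (h : ∀ k, |x k - y k| ≤ r) :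
    dist x y ≤ 2 * r := by
  have hr : 0 ≤ r := (abs_nonneg _).trans (h 0)
  rw [EuclideanSpace.dist_eq]
  refine Real.sqrt_le_iff.2 ⟨by linarith, ?_⟩
  simp only [Fin.sum_univ_two, Real.dist_eq]
  nlinarith [sq_le_sq' (by linarith [abs_nonneg (x 0 - y 0)]) (h 0),
    sq_le_sq' (by linarith [abs_nonneg (x 1 - y 1)]) (h 1)]

theorem abs_sub_site_le {ε : ℝ} (hε : 0 < ε) (x : Plane) (k : Fin 2) :
    |x k - ε * site ε x k| ≤ ε := by
  have h := ((mem_cell_iff hε (site ε x) x).2 rfl) k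
  rw [abs_le]; constructor <;> nlinarith [h.1, h.2]

theorem dist_latticePoint_site_le {ε : ℝ} (hε : 0 < ε) (x : Plane) (e : Fin 2 → ℤ)
    (he : ∀ k, |e k| ≤ 1) : dist x (latticePoint ε (site ε x + e)) ≤ 4 * ε := by
  have : ∀ k, |x k - latticePoint ε (site ε x + e) k| ≤ 2 * ε := by
    intro k
    have h1 := abs_sub_site_le hε x k
    have h2 : |((e k : ℤ) : ℝ)| ≤ 1 := by exact_mod_cast he k
    have h3 : |ε * (e k : ℝ)| ≤ ε := by rw [abs_mul, abs_of_pos hε]; nlinarith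
    have h4 : x k - latticePoint ε (site ε x + e) k = (x k - ε * site ε x k) - ε * e k := by
      simp [latticePoint]; ring
    rw [h4]
    exact (abs_sub _ _).trans (by linarith)
  linarith [dist_le_of_abs_sub_le this]

theorem finite_latticeIn {ε : ℝ} (hε : 0 < ε) {Ω : Set Plane} (hb : Bornology.IsBounded Ω) :
    (latticeIn ε Ω).Finite := by
  obtain ⟨R, hR⟩ := hb.exists_norm_le
  refine (Set.finite_Icc (fun _ : Fin 2 => ⌊-(R / ε)⌋) (fun _ => ⌈R / ε⌉)).subset ?_
  intro i hi
  have h1 : ∀ k, |(i k : ℝ)| ≤ R / ε := by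
    intro k
    have := (PiLp.norm_apply_le (latticePoint ε i) k).trans (hR _ hi)
    rw [le_div_iff₀ hε]
    simpa [latticePoint, abs_mul, abs_of_pos hε, mul_comm] using this
  constructor <;> intro k
  · have := (abs_le.1 (h1 k)).1
    exact_mod_cast (Int.floor_le _).trans this
  · have := (abs_le.1 (h1 k)).2
    exact_mod_cast this.trans (Int.le_ceil _)

/-! ### The lattice energy as an integral -/

/-- The coordinate directions of `ℤ²`. -/
def unitDir (k : Fin 2) : Fin 2 → ℤ := Pi.single k 1

theorem abs_unitDir_le (k j : Fin 2) : |unitDir k j| ≤ 1 := by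
  fin_cases k <;> fin_cases j <;> simp [unitDir]

theorem sq_add_sq_eq_one {a b : ℤ} (h : a ^ 2 + b ^ 2 = 1) :
    (a = 1 ∧ b = 0) ∨ (a = 0 ∧ b = 1) ∨ (a = -1 ∧ b = 0) ∨ (a = 0 ∧ b = -1) := by
  have ha1 : a ≤ 1 := by nlinarith [sq_nonneg b]
  have ha2 : -1 ≤ a := by nlinarith [sq_nonneg b]
  have hb1 : b ≤ 1 := by nlinarith [sq_nonneg a]
  have hb2 : -1 ≤ b := by nlinarith [sq_nonneg a]
  interval_cases a <;> interval_cases b <;> simp_all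

/-- The sites `i` for which `i` and its neighbour in direction `k` lie in the domain. -/
def bondSites (ε : ℝ) (Ω : Set Plane) (k : Fin 2) : Set (Fin 2 → ℤ) :=
  {i | i ∈ latticeIn ε Ω ∧ i + unitDir k ∈ latticeIn ε Ω}

theorem neighbourPairs_eq (ε : ℝ) (Ω : Set Plane) :
    neighbourPairs ε Ω =
      (((fun i => (i, i + unitDir 0)) '' bondSites ε Ω 0) ∪
        ((fun i => (i, i + unitDir 1)) '' bondSites ε Ω 1)) ∪
      (((fun i => (i + unitDir 0, i)) '' bondSites ε Ω 0) ∪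
        ((fun i => (i + unitDir 1, i)) '' bondSites ε Ω 1)) := by
  ext ⟨i, j⟩
  simp only [neighbourPairs, bondSites, mem_union, mem_image, mem_ofPred_eq, Prod.mk.injEq,
    Fin.sum_univ_two]
  constructor
  · rintro ⟨hi, hj, h⟩
    rcases sq_add_sq_eq_one h with ⟨h0, h1⟩ | ⟨h0, h1⟩ | ⟨h0, h1⟩ | ⟨h0, h1⟩
    · have e : j + unitDir 0 = i := by
        ext k; fin_cases k <;> simp [unitDir] <;> linarith
      exact Or.inr (Or.inl ⟨j, ⟨hj, e ▸ hi⟩, e, rfl⟩)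
    · have e : j + unitDir 1 = i := by
        ext k; fin_cases k <;> simp [unitDir] <;> linarith
      exact Or.inr (Or.inr ⟨j, ⟨hj, e ▸ hi⟩, e, rfl⟩)
    · have e : i + unitDir 0 = j := by
        ext k; fin_cases k <;> simp [unitDir] <;> linarith
      exact Or.inl (Or.inl ⟨i, ⟨hi, e ▸ hj⟩, rfl, e⟩)
    · have e : i + unitDir 1 = j := by
        ext k; fin_cases k <;> simp [unitDir] <;> linarith
      exact Or.inl (Or.inr ⟨i, ⟨hi, e ▸ hj⟩, rfl, e⟩)
  · rintro ((⟨a, ⟨h1, h2⟩, rfl, rfl⟩ | ⟨a, ⟨h1, h2⟩, rfl, rfl⟩) |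
      (⟨a, ⟨h1, h2⟩, rfl, rfl⟩ | ⟨a, ⟨h1, h2⟩, rfl, rfl⟩)) <;>
    exact ⟨by assumption, by assumption, by simp [unitDir]⟩

theorem latticeEnergy_eq {f : Circ → Circ → ℝ} (hf : ∀ u v, f u v = f v u) {Ω : Set Plane}
    (hb : Bornology.IsBounded Ω) {ε : ℝ} (hε : 0 < ε) (u : (Fin 2 → ℤ) → Circ) :
    latticeEnergy f Ω ε u =
      2 * ∑ k, ∑ᶠ i ∈ bondSites ε Ω k, ε ^ 2 * f (u i) (u (i + unitDir k)) := by
  have hfin : ∀ k, (bondSites ε Ω k).Finite := fun k =>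
    (finite_latticeIn hε hb).subset fun i hi => hi.1
  have hne : unitDir 0 ≠ unitDir 1 := fun h => by
    have := congrFun h 0; simp [unitDir] at this
  have key : ∀ (k l : Fin 2) (i j : Fin 2 → ℤ), i = j + unitDir k → i + unitDir l = j → False := by
    intro k l i j h1 h2
    have e : unitDir k + unitDir l = 0 := by
      rw [h1] at h2
      have : j + (unitDir k + unitDir l) = j := by rw [← add_assoc]; exact h2
      simpa using this
    have h0 := congrFun e 0
    have h1 := congrFun e 1
    fin_cases k <;> fin_cases l <;> simp [unitDir] at h0 h1
  have inj1 : ∀ k, InjOn (fun i : Fin 2 → ℤ => (i, i + unitDir k)) (bondSites ε Ω k) :=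
    fun k i _ j _ h => (Prod.ext_iff.1 h).1
  have inj2 : ∀ k, InjOn (fun i : Fin 2 → ℤ => (i + unitDir k, i)) (bondSites ε Ω k) :=
    fun k i _ j _ h => (Prod.ext_iff.1 h).2
  have fi1 : ∀ k, ((fun i : Fin 2 → ℤ => (i, i + unitDir k)) '' bondSites ε Ω k).Finite :=
    fun k => (hfin k).image _
  have fi2 : ∀ k, ((fun i : Fin 2 → ℤ => (i + unitDir k, i)) '' bondSites ε Ω k).Finite :=
    fun k => (hfin k).image _
  rw [latticeEnergy, neighbourPairs_eq, finsum_mem_union, finsum_mem_union, finsum_mem_union,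
    finsum_mem_image (inj1 0), finsum_mem_image (inj1 1), finsum_mem_image (inj2 0),
    finsum_mem_image (inj2 1), Fin.sum_univ_two]
  · have e : ∀ k, (∑ᶠ i ∈ bondSites ε Ω k, ε ^ 2 * f (u (i + unitDir k)) (u i)) =
        ∑ᶠ i ∈ bondSites ε Ω k, ε ^ 2 * f (u i) (u (i + unitDir k)) := by
      intro k
      simp only [hf (u (_ + unitDir k))]
    simp only [e]
    ring
  · rw [Set.disjoint_left]
    rintro _ ⟨i, -, rfl⟩ ⟨j, -, h⟩
    simp only [Prod.mk.injEq] at h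
    rw [h.2] at h
    exact hne (add_left_cancel h.1).symm
  · exact fi2 0
  · exact fi2 1
  · rw [Set.disjoint_left]
    rintro _ ⟨i, -, rfl⟩ ⟨j, -, h⟩
    simp only [Prod.mk.injEq] at h
    rw [h.1] at h
    exact hne (add_left_cancel h.2).symm
  · exact fi1 0
  · exact fi1 1
  · rw [Set.disjoint_left]
    rintro _ (⟨i, -, rfl⟩ | ⟨i, -, rfl⟩) (⟨j, -, h⟩ | ⟨j, -, h⟩) <;>
    · simp only [Prod.mk.injEq] at h
      exact key _ _ _ _ h.1.symm h.2.symm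
  · exact (fi1 0).union (fi1 1)
  · exact (fi2 0).union (fi2 1)

/-- The energy of a spin field, with the sum over bonds replaced by an integral over the domain. -/
def integralEnergy (f : Circ → Circ → ℝ) (Ω : Set Plane) (ε : ℝ) (u : (Fin 2 → ℤ) → Circ) : ℝ :=
  2 * ∑ k, ∫ x in Ω, f (u (site ε x)) (u (site ε x + unitDir k))

theorem abs_latticeEnergy_sub_le {f : Circ → Circ → ℝ} (hf : ∀ u v, f u v = f v u) {C : ℝ}
    (hC : ∀ u v, |f u v| ≤ C) {Ω : Set Plane} (ho : IsOpen Ω)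
    (hb : Bornology.IsBounded Ω) {ε : ℝ} (hε : 0 < ε) (u : (Fin 2 → ℤ) → Circ) :
    |latticeEnergy f Ω ε u - integralEnergy f Ω ε u| ≤ 8 * C * tube Ω (4 * ε) := by
  have hC0 : 0 ≤ C := (abs_nonneg _).trans (hC (u 0) (u 0))
  have hfin : ∀ k, (bondSites ε Ω k).Finite := fun k =>
    (finite_latticeIn hε hb).subset fun i hi => hi.1
  have hk : ∀ k, |(∑ᶠ i ∈ bondSites ε Ω k, ε ^ 2 * f (u i) (u (i + unitDir k))) -
      ∫ x in Ω, f (u (site ε x)) (u (site ε x + unitDir k))| ≤ 2 * C * tube Ω (4 * ε) := by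
    intro k
    set F : (Fin 2 → ℤ) → ℝ := fun i => f (u i) (u (i + unitDir k)) with hF
    have e1 : (∑ᶠ i ∈ bondSites ε Ω k, ε ^ 2 * f (u i) (u (i + unitDir k))) =
        ∫ x in site ε ⁻¹' bondSites ε Ω k, F (site ε x) := by
      have := setIntegral_comp_site hε (hfin k).toFinset F
      rw [(hfin k).coe_toFinset] at this
      rw [this, finsum_mem_eq_finite_toFinset_sum _ (hfin k), Finset.mul_sum]
    rw [e1]
    have hvol : volume (site ε ⁻¹' bondSites ε Ω k) ≠ ∞ := by
      have := volume_site_finset hε (hfin k).toFinset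
      rw [(hfin k).coe_toFinset] at this
      rw [this]
      exact ENNReal.mul_ne_top (by simp) (by simp)
    refine abs_setIntegral_sub_le (measurableSet_site ε _) ho.measurableSet
      (integrableOn_comp_site (F := F) (fun i => hC _ _) hvol)
      (integrableOn_comp_site (F := F) (fun i => hC _ _) hb.measure_lt_top.ne)
      (Eventually.of_forall fun x _ => hC _ _) (volume_cthickening_ne_top hb _) hC0 ?_
    intro x hx
    have d0 := dist_latticePoint_site_le hε x 0 (by simp)
    have d1 := dist_latticePoint_site_le hε x (unitDir k) (abs_unitDir_le k)
    rw [add_zero] at d0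
    simp only [mem_preimage, bondSites, mem_ofPred_eq, latticeIn] at hx
    by_cases h0 : x ∈ Ω ↔ latticePoint ε (site ε x) ∈ Ω
    · by_cases h1 : x ∈ Ω ↔ latticePoint ε (site ε x + unitDir k) ∈ Ω
      · tauto
      · exact mem_cthickening_frontier d1 h1
    · exact mem_cthickening_frontier d0 h0
  rw [latticeEnergy_eq hf hb hε, integralEnergy, ← mul_sub, ← Finset.sum_sub_distrib, abs_mul,
    Fin.sum_univ_two]
  have := abs_add_le ((∑ᶠ i ∈ bondSites ε Ω 0, ε ^ 2 * f (u i) (u (i + unitDir 0))) -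
      ∫ x in Ω, f (u (site ε x)) (u (site ε x + unitDir 0)))
    ((∑ᶠ i ∈ bondSites ε Ω 1, ε ^ 2 * f (u i) (u (i + unitDir 1))) -
      ∫ x in Ω, f (u (site ε x)) (u (site ε x + unitDir 1)))
  rw [abs_two]
  linarith [hk 0, hk 1]

/-! ### Mesoscopic squares -/

/-- The sites of the mesoscopic `N × N` square with index `J`. -/
def block (N : ℕ) (J : Fin 2 → ℤ) : Finset (Fin 2 → ℤ) :=
  Fintype.piFinset fun k => Finset.Ico (N * J k) (N * J k + N)

theorem mem_block {N : ℕ} (hN : 0 < N) {J i : Fin 2 → ℤ} :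
    i ∈ block N J ↔ (fun k => i k / N) = J := by
  have hN' : (0 : ℤ) < N := by exact_mod_cast hN
  simp only [block, Fintype.mem_piFinset, Finset.mem_Ico, funext_iff]
  refine forall_congr' fun k => ?_
  rw [Int.ediv_eq_iff_of_pos hN']
  constructor <;> rintro ⟨h1, h2⟩ <;> constructor <;> nlinarith

theorem card_block (N : ℕ) (J : Fin 2 → ℤ) : (block N J).card = N ^ 2 := by
  simp [block, Fintype.card_piFinset, sq]

theorem volume_block {ε : ℝ} (hε : 0 < ε) (N : ℕ) (J : Fin 2 → ℤ) :
    volume (site ε ⁻¹' block N J) = ENNReal.ofReal (N ^ 2 * ε ^ 2) := by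
  rw [volume_site_finset hε, card_block, ENNReal.ofReal_mul (by positivity)]
  congr 1
  rw [← Nat.cast_pow, ENNReal.ofReal_natCast]

theorem abs_sub_le_of_mem_block {ε : ℝ} (hε : 0 < ε) {N : ℕ} (hN : 0 < N) {J : Fin 2 → ℤ}
    {x y : Plane} (hx : site ε x ∈ block N J) (hy : site ε y ∈ block N J) :
    dist x y ≤ 4 * (N * ε) := by
  have hN1 : (1 : ℝ) ≤ N := by exact_mod_cast hN
  have : ∀ k, |x k - y k| ≤ 2 * (N * ε) := by
    intro k
    simp only [block, Fintype.mem_piFinset, Finset.mem_Ico] at hx hy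
    have hx1 : (N * J k : ℝ) ≤ site ε x k := by exact_mod_cast (hx k).1
    have hx2 : (site ε x k : ℝ) + 1 ≤ N * J k + N := by exact_mod_cast (hx k).2
    have hy1 : (N * J k : ℝ) ≤ site ε y k := by exact_mod_cast (hy k).1
    have hy2 : (site ε y k : ℝ) + 1 ≤ N * J k + N := by exact_mod_cast (hy k).2
    have cx := ((mem_cell_iff hε (site ε x) x).2 rfl) k
    have cy := ((mem_cell_iff hε (site ε y) y).2 rfl) k
    have d1 : ε * ((site ε x k : ℝ) - site ε y k) ≤ ε * (N - 1) :=
      mul_le_mul_of_nonneg_left (by linarith) hε.le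
    have d2 : ε * ((site ε y k : ℝ) - site ε x k) ≤ ε * (N - 1) :=
      mul_le_mul_of_nonneg_left (by linarith) hε.le
    have d3 : ε * 1 ≤ ε * N := mul_le_mul_of_nonneg_left hN1 hε.le
    rw [abs_le]
    constructor <;> nlinarith [cx.1, cx.2, cy.1, cy.2]
  linarith [dist_le_of_abs_sub_le this]

theorem setIntegral_le_of_partition {ι : Type*} [Countable ι] {S : ι → Set Plane} {r : ℝ}
    (hSm : ∀ J, MeasurableSet (S J)) (hdisj : ∀ x J K, x ∈ S J → x ∈ S K → J = K)
    (hcov : ∀ x, ∃ J, x ∈ S J) (hdist : ∀ J x y, x ∈ S J → y ∈ S J → dist x y ≤ r)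
    {Ω : Set Plane} (ho : IsOpen Ω) (hb : Bornology.IsBounded Ω) {w : Plane → ℝ} {C : ℝ}
    (hw : IntegrableOn w Ω) (hC : ∀ᵐ x, x ∈ Ω → |w x| ≤ C) (hC0 : 0 ≤ C)
    (h : ∀ J, S J ⊆ Ω → ∫ x in S J, w x ≤ 0) :
    ∫ x in Ω, w x ≤ 2 * C * tube Ω r := by
  have hUΩ : (⋃ J : {J // S J ⊆ Ω}, S J) ⊆ Ω := iUnion_subset fun J => J.2
  have hUm : MeasurableSet (⋃ J : {J // S J ⊆ Ω}, S J) := MeasurableSet.iUnion fun J => hSm _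
  have hs := hasSum_integral_iUnion (μ := volume) (f := w)
    (s := fun J : {J // S J ⊆ Ω} => S J) (fun J => hSm _) (fun J K hJK => by
      rw [Function.onFun, Set.disjoint_left]
      intro x hx hy
      exact hJK (Subtype.ext (hdisj _ _ _ hx hy)))
    (hw.mono_set hUΩ)
  have hneg : ∫ x in (⋃ J : {J // S J ⊆ Ω}, S J), w x ≤ 0 :=
    hs.tsum_eq ▸ tsum_nonpos fun J => h J.1 J.2
  have h2 := abs_setIntegral_sub_le ho.measurableSet hUm hw (hw.mono_set hUΩ)
    (T := Metric.cthickening r (frontier Ω)) (C := C)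
    (by
      filter_upwards [hC] with x hx h
      exact hx (h.elim id fun h => hUΩ h)) (volume_cthickening_ne_top hb _) hC0 (by
    intro x hx
    have hxΩ : x ∈ Ω := by
      by_contra hn
      exact hx ⟨fun h => absurd h hn, fun h => hUΩ h⟩
    have hxU : x ∉ ⋃ J : {J // S J ⊆ Ω}, S J := fun h => hx ⟨fun _ => h, fun _ => hxΩ⟩
    obtain ⟨J, hxJ⟩ := hcov x
    have hnot : ¬ S J ⊆ Ω :=
      fun hsub => hxU (mem_iUnion.2 ⟨⟨_, hsub⟩, hxJ⟩)
    obtain ⟨y, hy, hyΩ⟩ := Set.not_subset.1 hnot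
    exact mem_cthickening_frontier (hdist _ _ _ hxJ hy) (by tauto))
  have h3 := (abs_le.1 h2).2
  unfold tube
  linarith

/-- A function whose integrals over all mesoscopic squares inside the domain are nonpositive has
integral bounded by a boundary term. -/
theorem setIntegral_le_of_block {ε : ℝ} (hε : 0 < ε) {N : ℕ} (hN : 0 < N) {Ω : Set Plane}
    (ho : IsOpen Ω) (hb : Bornology.IsBounded Ω) {w : Plane → ℝ} {C : ℝ}
    (hw : IntegrableOn w Ω) (hC : ∀ᵐ x, x ∈ Ω → |w x| ≤ C) (hC0 : 0 ≤ C)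
    (h : ∀ J, site ε ⁻¹' (block N J : Set (Fin 2 → ℤ)) ⊆ Ω →
      ∫ x in site ε ⁻¹' block N J, w x ≤ 0) :
    ∫ x in Ω, w x ≤ 2 * C * tube Ω (4 * (N * ε)) := by
  refine setIntegral_le_of_partition (S := fun J => site ε ⁻¹' (block N J : Set (Fin 2 → ℤ)))
    (fun J => measurableSet_site ε _) (fun x J K hx hy => ?_) (fun x => ?_)
    (fun J x y hx hy => ?_) ho hb hw hC hC0 h
  · exact ((mem_block hN).1 (Finset.mem_coe.1 hx)).symm.trans
      ((mem_block hN).1 (Finset.mem_coe.1 hy))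
  · exact ⟨_, Finset.mem_coe.2 ((mem_block hN).2 rfl)⟩
  · exact abs_sub_le_of_mem_block hε hN (Finset.mem_coe.1 hx) (Finset.mem_coe.1 hy)

/-! ### One-dimensional profiles realising the envelope -/

/-- The cost of a profile `τ` on `{0, …, N-1}`: the values of `h` plus a penalty `B` for jumps. -/
def profileCost (h : ℝ → ℝ) (B : ℝ) (N : ℕ) (τ : ℕ → ℝ) : ℝ :=
  ∑ r ∈ Finset.range N, (h |τ r| + if τ r = τ (r + 1) then 0 else B)

/-- Some profile of length `N` has mean `s` and mean cost at most `e`, up to `δ`. -/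
def Realizes (h : ℝ → ℝ) (B : ℝ) (N : ℕ) (δ s e : ℝ) : Prop :=
  ∃ τ : ℕ → ℝ, (∀ r, |τ r| ≤ 1) ∧ |∑ r ∈ Finset.range N, τ r - N * s| ≤ N * δ ∧
    profileCost h B N τ ≤ N * (e + δ)

/-- Pairs of mean and mean cost that are asymptotically realised by profiles. -/
def achievable (h : ℝ → ℝ) (B : ℝ) : Set (ℝ × ℝ) :=
  {p | ∀ δ > 0, ∀ᶠ N in atTop, Realizes h B N δ p.1 p.2}

theorem Realizes.mono {h : ℝ → ℝ} {B : ℝ} {N : ℕ} {δ δ' s s' e e' : ℝ}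
    (H : Realizes h B N δ s e) (hs : δ + |s - s'| ≤ δ') (he : e + δ ≤ e' + δ') :
    Realizes h B N δ' s' e' := by
  obtain ⟨τ, h1, h2, h3⟩ := H
  have hN : (0 : ℝ) ≤ N := N.cast_nonneg
  refine ⟨τ, h1, ?_, h3.trans (by gcongr)⟩
  have e1 : ∑ r ∈ Finset.range N, τ r - N * s' =
      (∑ r ∈ Finset.range N, τ r - N * s) + N * (s - s') := by ring
  rw [e1]
  refine (abs_add_le _ _).trans ?_
  rw [abs_mul, Nat.abs_cast]
  nlinarith

theorem Realizes.neg {h : ℝ → ℝ} {B : ℝ} {N : ℕ} {δ s e : ℝ}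
    (H : Realizes h B N δ s e) : Realizes h B N δ (-s) e := by
  obtain ⟨τ, h1, h2, h3⟩ := H
  refine ⟨fun r => -τ r, by simpa using h1, ?_, by simpa [profileCost] using h3⟩
  rw [Finset.sum_neg_distrib, ← abs_neg]
  convert h2 using 2
  ring

theorem achievable_of_approx {h : ℝ → ℝ} {B s e : ℝ}
    (H : ∀ δ > 0, ∃ p ∈ achievable h B, |p.1 - s| ≤ δ ∧ p.2 ≤ e + δ) :
    (s, e) ∈ achievable h B := by
  intro δ hδ
  obtain ⟨p, hp, h1, h2⟩ := H (δ / 2) (by linarith)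
  filter_upwards [hp (δ / 2) (by linarith)] with N hN
  exact hN.mono (by linarith) (by linarith)

theorem achievable_neg {h : ℝ → ℝ} {B s e : ℝ} (H : (s, e) ∈ achievable h B) :
    (-s, e) ∈ achievable h B := fun δ hδ => by
  filter_upwards [H δ hδ] with N hN using hN.neg

theorem achievable_self {h : ℝ → ℝ} {B t : ℝ} (ht : |t| ≤ 1) : (t, h |t|) ∈ achievable h B := by
  intro δ hδ
  filter_upwards with N
  refine ⟨fun _ => t, fun _ => ht, ?_, ?_⟩
  · simp only [Finset.sum_const, Finset.card_range, nsmul_eq_mul, sub_self, abs_zero]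
    positivity
  · simp only [profileCost, if_true, add_zero, Finset.sum_const, Finset.card_range, nsmul_eq_mul]
    have : (0 : ℝ) ≤ N := N.cast_nonneg
    nlinarith

theorem le_of_achievable {h : ℝ → ℝ} {B C : ℝ} (hB : 0 ≤ B) (hC : ∀ t ∈ Icc (0 : ℝ) 1, |h t| ≤ C)
    {s e : ℝ} (H : (s, e) ∈ achievable h B) : -C ≤ e := by
  refine le_of_forall_pos_le_add fun δ hδ => ?_
  obtain ⟨N, ⟨τ, h1, -, h3⟩, hN⟩ := ((H δ hδ).and (eventually_gt_atTop 0)).exists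
  have hN' : (0 : ℝ) < N := by exact_mod_cast hN
  have : ∑ r ∈ Finset.range N, (-C) ≤ profileCost h B N τ := by
    refine Finset.sum_le_sum fun r _ => ?_
    have := (abs_le.1 (hC |τ r| ⟨abs_nonneg _, h1 r⟩)).1
    split_ifs <;> linarith
  rw [Finset.sum_const, Finset.card_range, nsmul_eq_mul] at this
  exact le_of_mul_le_mul_left (this.trans h3) hN'

theorem profileCost_concat_le {h : ℝ → ℝ} {B : ℝ} (hB : 0 ≤ B) (M K : ℕ) (τ τ' : ℕ → ℝ) :
    profileCost h B (M + K) (fun r => if r < M then τ r else τ' (r - M)) ≤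
      profileCost h B M τ + B + profileCost h B K τ' := by
  unfold profileCost
  rw [Finset.sum_range_add]
  refine add_le_add ?_ (le_of_eq ?_)
  · have h1 : ∑ r ∈ Finset.range M, (if r + 1 = M then B else 0) ≤ B := by
      rcases M with _ | M
      · simpa using hB
      · simp
    refine le_trans ?_ (add_le_add_right h1 _)
    rw [← Finset.sum_add_distrib]
    refine Finset.sum_le_sum fun r hr => ?_
    have hr := Finset.mem_range.1 hr
    by_cases hr1 : r + 1 = M
    · simp only [hr, if_true, hr1]
      split_ifs <;> linarith
    · have : r + 1 < M := by omega
      simp [hr, this, hr1]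
  · refine Finset.sum_congr rfl fun r _ => ?_
    have e : M + r + 1 - M = r + 1 := by omega
    have e' : ¬ (M + r + 1 < M) := by omega
    simp [e, e']

theorem convex_achievable {h : ℝ → ℝ} {B : ℝ} (hB : 0 ≤ B) : Convex ℝ (achievable h B) := by
  rw [convex_iff_forall_pos]
  rintro ⟨s, e⟩ hp ⟨s', e'⟩ hp' a b ha hb hab δ hδ
  have hδ2 : 0 < δ / 2 := by linarith
  have ha1 : a ≤ 1 := by linarith
  have hfl : ∀ N : ℕ, ⌊a * N⌋₊ ≤ N := fun N => by
    refine Nat.floor_le_of_le ?_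
    have : (0 : ℝ) ≤ N := N.cast_nonneg
    nlinarith
  have hN1 : Tendsto (fun N : ℕ => ⌊a * N⌋₊) atTop atTop :=
    tendsto_nat_floor_atTop.comp (tendsto_natCast_atTop_atTop.const_mul_atTop ha)
  have hN2 : Tendsto (fun N : ℕ => N - ⌊a * N⌋₊) atTop atTop := by
    refine tendsto_atTop_mono (fun N => ?_)
      (tendsto_nat_floor_atTop.comp (tendsto_natCast_atTop_atTop.const_mul_atTop hb))
    refine Nat.floor_le_of_le ?_
    rw [Nat.cast_sub (hfl N)]
    have := Nat.floor_le (a := a * N) (by positivity)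
    have : b * (N : ℝ) = N - a * N := by linear_combination (N : ℝ) * hab
    linarith
  have hbig : ∀ᶠ N : ℕ in atTop, |s - s'| + |e - e'| + B ≤ (N : ℝ) * (δ / 2) :=
    (tendsto_natCast_atTop_atTop.atTop_mul_const hδ2).eventually_ge_atTop _
  filter_upwards [hN1.eventually (hp _ hδ2), hN2.eventually (hp' _ hδ2), hbig] with N h1 h2 h3
  obtain ⟨τ, t1, t2, t3⟩ := h1
  obtain ⟨τ', t1', t2', t3'⟩ := h2
  set M := ⌊a * N⌋₊
  set K := N - M
  have hMK : M + K = N := by have := hfl N; omega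
  have hMKr : (M : ℝ) + K = N := by exact_mod_cast hMK
  have hθ0 : (M : ℝ) ≤ a * N := Nat.floor_le (by positivity)
  have hθ1 : a * N < (M : ℝ) + 1 := Nat.lt_floor_add_one _
  set θ := a * N - M with hθ
  have hM : (M : ℝ) = a * N - θ := by ring
  have hK : (K : ℝ) = b * N + θ := by
    have : b * (N : ℝ) = N - a * N := by linear_combination (N : ℝ) * hab
    linarith
  have habs : ∀ x y : ℝ, |θ * (x - y)| ≤ |x - y| := fun x y => by
    rw [abs_mul, abs_of_nonneg (by linarith)]
    nlinarith [abs_nonneg (x - y)]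
  refine ⟨fun r => if r < M then τ r else τ' (r - M), fun r => ?_, ?_, ?_⟩
  · dsimp only
    split_ifs
    exacts [t1 r, t1' _]
  · have e1 : ∑ r ∈ Finset.range N, (if r < M then τ r else τ' (r - M)) =
        ∑ r ∈ Finset.range M, τ r + ∑ r ∈ Finset.range K, τ' r := by
      rw [← hMK, Finset.sum_range_add]
      congr 1
      · exact Finset.sum_congr rfl fun r hr => if_pos (Finset.mem_range.1 hr)
      · exact Finset.sum_congr rfl fun r _ => by simp
    have e2 : ∑ r ∈ Finset.range N, (if r < M then τ r else τ' (r - M)) -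
        N * (a • (s, e) + b • (s', e')).1 =
        (∑ r ∈ Finset.range M, τ r - M * s) + (∑ r ∈ Finset.range K, τ' r - K * s') -
          θ * (s - s') := by
      rw [e1]
      simp only [Prod.fst_add, Prod.smul_fst, smul_eq_mul]
      rw [hM, hK]
      ring
    rw [e2]
    have := habs s s'
    rw [abs_le] at this t2 t2' ⊢
    have := abs_nonneg (e - e')
    have : (M : ℝ) * (δ / 2) + K * (δ / 2) = N * (δ / 2) := by rw [← add_mul, hMKr]
    constructor <;> linarith
  · have h4 := profileCost_concat_le (h := h) hB M K τ τ'
    rw [hMK] at h4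
    refine h4.trans ?_
    have e2 : (N : ℝ) * ((a • (s, e) + b • (s', e')).2 + δ) =
        M * (e + δ / 2) + K * (e' + δ / 2) + θ * (e - e') + N * (δ / 2) := by
      simp only [Prod.snd_add, Prod.smul_snd, smul_eq_mul]
      have : (N : ℝ) * δ = (M + K) * (δ / 2) + N * (δ / 2) := by rw [hMKr]; ring
      rw [mul_add, this, hM, hK]
      ring
    rw [e2]
    have := abs_le.1 (habs e e')
    have := abs_nonneg (s - s')
    linarith

/-- The least mean cost achievable with mean `s`. -/
def leastCost (h : ℝ → ℝ) (B s : ℝ) : ℝ := sInf {e | (s, e) ∈ achievable h B}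

section LeastCost

variable {h : ℝ → ℝ} {B C : ℝ}

theorem bddBelow_achievable (hB : 0 ≤ B) (hC : ∀ t ∈ Icc (0 : ℝ) 1, |h t| ≤ C) (s : ℝ) :
    BddBelow {e | (s, e) ∈ achievable h B} :=
  ⟨-C, fun _ he => le_of_achievable hB hC he⟩

theorem leastCost_le (hB : 0 ≤ B) (hC : ∀ t ∈ Icc (0 : ℝ) 1, |h t| ≤ C) {s e : ℝ}
    (H : (s, e) ∈ achievable h B) : leastCost h B s ≤ e :=
  csInf_le (bddBelow_achievable hB hC s) H

theorem leastCost_achievable {s : ℝ} (hs : |s| ≤ 1) : (s, leastCost h B s) ∈ achievable h B := by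
  refine achievable_of_approx fun δ hδ => ?_
  obtain ⟨e, he, hlt⟩ := exists_lt_of_csInf_lt (s := {e | (s, e) ∈ achievable h B})
    ⟨_, achievable_self hs⟩ (lt_add_of_pos_right (leastCost h B s) hδ)
  exact ⟨(s, e), he, by simpa using hδ.le, hlt.le⟩

theorem leastCost_mem_monotoneMinorants (hB : 0 ≤ B) (hC : ∀ t ∈ Icc (0 : ℝ) 1, |h t| ≤ C) :
    leastCost h B ∈ monotoneMinorants h := by
  have habs : ∀ s ∈ Icc (0 : ℝ) 1, |s| ≤ 1 := fun s hs => by rw [abs_of_nonneg hs.1]; exact hs.2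
  refine ⟨?_, ⟨convex_Icc 0 1, ?_⟩, ?_, ?_⟩
  · intro s hs t ht hst
    rcases hs.1.eq_or_lt with h0 | h0
    · have h1 := leastCost_achievable (h := h) (B := B) (habs t ht)
      have h2 := convex_achievable hB h1 (achievable_neg h1) (a := 1 / 2) (b := 1 / 2)
        (by norm_num) (by norm_num) (by norm_num)
      refine leastCost_le hB hC ?_
      convert h2 using 1
      rw [← h0]
      ext
      · simp
      · simp only [Prod.snd_add, Prod.smul_snd, smul_eq_mul]
        ring
    · have ht0 : 0 < t := h0.trans_le hst
      have hq : s / t ≤ 1 := (div_le_one ht0).2 hst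
      have hq0 : 0 ≤ s / t := by positivity
      have h1 := leastCost_achievable (h := h) (B := B) (habs t ht)
      have h2 := convex_achievable hB h1 (achievable_neg h1) (a := (1 + s / t) / 2)
        (b := (1 - s / t) / 2) (by linarith) (by linarith) (by ring)
      refine leastCost_le hB hC ?_
      convert h2 using 1
      ext
      · simp only [Prod.fst_add, Prod.smul_fst, smul_eq_mul]
        field_simp
        ring
      · simp only [Prod.snd_add, Prod.smul_snd, smul_eq_mul]
        ring
  · intro s hs t ht a b ha hb hab
    refine leastCost_le hB hC ?_
    exact convex_achievable hB (leastCost_achievable (habs s hs)) (leastCost_achievable (habs t ht))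
      ha hb hab
  · intro s hs y hy
    by_contra hcon
    rw [not_eventually] at hcon
    refine absurd (leastCost_le hB hC (achievable_of_approx fun δ hδ => ?_)) (not_le.2 hy)
    have hnear : ∀ᶠ x in 𝓝[Icc 0 1] s, |x - s| ≤ δ ∧ x ∈ Icc (0 : ℝ) 1 := by
      refine Eventually.and ?_ self_mem_nhdsWithin
      refine nhdsWithin_le_nhds ?_
      filter_upwards [Metric.closedBall_mem_nhds s hδ] with x hx
      exact hx
    obtain ⟨x, hx, hx1, hx2⟩ := (hcon.and_eventually hnear).exists
    exact ⟨_, leastCost_achievable (habs x hx2), hx1, by linarith [not_lt.1 hx]⟩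
  · intro t ht
    refine leastCost_le hB hC ?_
    have := achievable_self (h := h) (B := B) (habs t ht)
    rwa [abs_of_nonneg ht.1] at this

end LeastCost

theorem exists_realizes {h : ℝ → ℝ} {B C : ℝ} (hB : 0 ≤ B)
    (hC : ∀ t ∈ Icc (0 : ℝ) 1, |h t| ≤ C) {g : ℝ → ℝ} (hg : LowerSemicontinuousOn g (Icc 0 1))
    (hle : ∀ φ ∈ monotoneMinorants h, ∀ t ∈ Icc (0 : ℝ) 1, φ t ≤ g t)
    (hgC : ∀ t ∈ Icc (0 : ℝ) 1, |g t| ≤ C) :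
    ∃ δ : ℕ → ℝ, Tendsto δ atTop (𝓝 0) ∧ ∀ N, 0 ≤ δ N ∧
      ∀ s ∈ Icc (0 : ℝ) 1, Realizes h B N (δ N) s (g s) := by
  have hmem : ∀ s ∈ Icc (0 : ℝ) 1, (s, g s) ∈ achievable h B := fun s hs =>
    achievable_of_approx fun δ hδ => ⟨_, leastCost_achievable (by
      rw [abs_of_nonneg hs.1]; exact hs.2), by simpa using hδ.le,
      (hle _ (leastCost_mem_monotoneMinorants hB hC) s hs).trans (by linarith)⟩
  have hunif : ∀ δ > 0, ∀ᶠ N in atTop, ∀ s ∈ Icc (0 : ℝ) 1, Realizes h B N δ s (g s) := by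
    intro δ hδ
    refine isCompact_Icc.induction_on (p := fun S => ∀ᶠ N in atTop, ∀ s ∈ S,
      Realizes h B N δ s (g s)) (by simp) ?_ ?_ ?_
    · intro S T hST hT
      filter_upwards [hT] with N hN s hs using hN s (hST hs)
    · intro S T hS hT
      filter_upwards [hS, hT] with N h1 h2 s hs using hs.elim (h1 s) (h2 s)
    · intro s hs
      refine ⟨{x | g s - δ / 2 < g x ∧ |s - x| ≤ δ / 2}, ?_, ?_⟩
      · refine Eventually.and (hg s hs _ (by linarith)) (nhdsWithin_le_nhds ?_)
        filter_upwards [Metric.closedBall_mem_nhds s (half_pos hδ)] with x hx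
        rw [abs_sub_comm]
        exact hx
      · filter_upwards [hmem s hs (δ / 2) (by linarith)] with N hN x hx
        exact hN.mono (by linarith [hx.2]) (by linarith [hx.1])
  have hC0 : 0 ≤ C := (abs_nonneg _).trans (hC 0 ⟨le_rfl, zero_le_one⟩)
  set A : ℕ → Set ℝ := fun N =>
    {δ | 0 ≤ δ ∧ ∀ s ∈ Icc (0 : ℝ) 1, Realizes h B N δ s (g s)} with hA
  have hbdd : ∀ N, BddBelow (A N) := fun N => ⟨0, fun δ hδ => hδ.1⟩
  have hne : ∀ N, (A N).Nonempty := fun N => by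
    refine ⟨1 + 2 * C, by positivity, fun s hs => ⟨fun _ => 0, by simp, ?_, ?_⟩⟩
    · have : (0 : ℝ) ≤ N := N.cast_nonneg
      simp only [Finset.sum_const_zero, zero_sub, abs_neg, abs_mul, Nat.abs_cast,
        abs_of_nonneg hs.1]
      exact mul_le_mul_of_nonneg_left (by linarith [hs.2]) this
    · simp only [profileCost, if_true, add_zero, Finset.sum_const, Finset.card_range, abs_zero,
        nsmul_eq_mul]
      have := (abs_le.1 (hC 0 ⟨le_rfl, zero_le_one⟩)).2
      have := (abs_le.1 (hgC s hs)).1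
      exact mul_le_mul_of_nonneg_left (by linarith) N.cast_nonneg
  have hpos : ∀ N : ℕ, (0 : ℝ) < 1 / ((N : ℝ) + 1) := fun N => Nat.one_div_pos_of_nat
  have hnn : ∀ N, 0 ≤ sInf (A N) := fun N => Real.sInf_nonneg fun δ hδ => hδ.1
  refine ⟨fun N => sInf (A N) + 1 / ((N : ℝ) + 1), ?_, fun N => ⟨?_, fun s hs => ?_⟩⟩
  · rw [← add_zero (0 : ℝ)]
    refine Tendsto.add ?_ tendsto_one_div_add_atTop_nhds_zero_nat
    refine Metric.tendsto_atTop'.2 fun η hη => ?_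
    obtain ⟨n, hn⟩ := eventually_atTop.1 (hunif (η / 2) (by linarith))
    refine ⟨n, fun m hm => ?_⟩
    rw [Real.dist_eq, sub_zero, abs_of_nonneg (hnn m)]
    have : sInf (A m) ≤ η / 2 := csInf_le (hbdd m) ⟨by linarith, hn m (le_of_lt hm)⟩
    linarith
  · have := hnn N
    have := hpos N
    positivity
  · obtain ⟨δ, hδ, hlt⟩ := exists_lt_of_csInf_lt (hne N) (lt_add_of_pos_right (sInf (A N)) (hpos N))
    exact (hδ.2 s hs).mono (by simpa using hlt.le) (by linarith)

/-! ### Regularity of monotone convex functions on the unit interval -/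

theorem continuousOn_of_monotone_convex {g : ℝ → ℝ} (hm : MonotoneOn g (Icc 0 1))
    (hc : ConvexOn ℝ (Icc 0 1) g) (hl : LowerSemicontinuousOn g (Icc 0 1)) :
    ContinuousOn g (Icc 0 1) := by
  refine continuousOn_iff_lower_upperSemicontinuousOn.2 ⟨hl, fun s hs y hy => ?_⟩
  rcases hs.2.eq_or_lt with h1 | h1
  · filter_upwards [self_mem_nhdsWithin] with x hx
    refine (hm hx hs ?_).trans_lt hy
    rw [h1]; exact hx.2
  · have h10 : 0 < 1 - s := by linarith
    have hcont : ContinuousAt (fun x => ((1 - x) / (1 - s)) * g s + ((x - s) / (1 - s)) * g 1) s := by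
      fun_prop
    have hval : ((1 - s) / (1 - s)) * g s + ((s - s) / (1 - s)) * g 1 < y := by
      rw [div_self h10.ne']; simpa using hy
    filter_upwards [self_mem_nhdsWithin,
      nhdsWithin_le_nhds (hcont.eventually_lt continuousAt_const hval)] with x hx hx2
    rcases le_total x s with hxs | hxs
    · exact (hm hx hs hxs).trans_lt hy
    · refine lt_of_le_of_lt ?_ hx2
      have h3 := hc.2 hs (right_mem_Icc.2 (zero_le_one (α := ℝ)))
        (show 0 ≤ (1 - x) / (1 - s) from div_nonneg (by linarith [hx.2]) h10.le)
        (show 0 ≤ (x - s) / (1 - s) from div_nonneg (by linarith) h10.le) (by field_simp; ring)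
      simp only [smul_eq_mul] at h3
      convert h3 using 2
      field_simp
      ring

/-- A convex nondecreasing function on `[0,1]` is approximated from below by affine minorants with
uniformly bounded coefficients that are selected measurably. -/
theorem exists_affine_minorants {g : ℝ → ℝ} (hm : MonotoneOn g (Icc 0 1))
    (hc : ConvexOn ℝ (Icc 0 1) g) (hcont : ContinuousOn g (Icc 0 1)) {δ : ℝ} (hδ : 0 < δ) :
    ∃ (p q : ℝ → ℝ) (M : ℝ), Measurable p ∧ Measurable q ∧ (∀ s, 0 ≤ p s ∧ p s ≤ M) ∧
      (∀ s, |q s| ≤ M) ∧ (∀ s, ∀ t ∈ Icc (0 : ℝ) 1, q s + p s * t ≤ g t) ∧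
      ∀ s ∈ Icc (0 : ℝ) 1, g s - δ ≤ q s + p s * s := by
  have huc := isCompact_Icc.uniformContinuousOn_of_continuous hcont
  obtain ⟨η, hη, hη'⟩ := Metric.uniformContinuousOn_iff.1 huc (δ / 2) (by linarith)
  obtain ⟨m, hmη⟩ := exists_nat_one_div_lt hη
  set k : ℝ := (m : ℝ) + 1 with hk
  have hk0 : 0 < k := by positivity
  set a : ℕ → ℝ := fun j => (j : ℝ) / k with ha
  have hstep : ∀ j, a (j + 1) = a j + 1 / k := fun j => by simp only [ha]; push_cast; ring
  have hamem : ∀ j ≤ m + 1, a j ∈ Icc (0 : ℝ) 1 := fun j hj => by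
    refine ⟨by positivity, (div_le_one hk0).2 ?_⟩
    rw [hk]; exact_mod_cast hj
  set P : ℕ → ℝ := fun j => k * (g (a (j + 1)) - g (a j)) with hP
  set Q : ℕ → ℝ := fun j => g (a j) - P j * a (j + 1) with hQ
  set J : ℝ → ℕ := fun s => min ⌊k * s⌋₊ m with hJ
  have hJm : Measurable J := (Nat.measurable_floor.comp (by fun_prop)).min measurable_const
  have hJle : ∀ s, J s ≤ m := fun s => min_le_right _ _
  have hP0 : ∀ j ≤ m, 0 ≤ P j := fun j hj => by
    refine mul_nonneg hk0.le (sub_nonneg.2 (hm (hamem j (by omega)) (hamem _ (by omega)) ?_))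
    rw [hstep]; linarith [one_div_pos.2 hk0]
  obtain ⟨M, hM⟩ : ∃ M, ∀ j ≤ m, P j ≤ M ∧ |Q j| ≤ M := by
    refine ⟨∑ i ∈ Finset.range (m + 1), (|P i| + |Q i|), fun j hj => ?_⟩
    have h1 : |P j| + |Q j| ≤ ∑ i ∈ Finset.range (m + 1), (|P i| + |Q i|) :=
      Finset.single_le_sum (f := fun i => |P i| + |Q i|) (fun i _ => by positivity)
        (Finset.mem_range.2 (by omega))
    constructor
    · linarith [le_abs_self (P j), abs_nonneg (Q j)]
    · linarith [abs_nonneg (P j)]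
  have hslope : ∀ j, P j = (g (a (j + 1)) - g (a j)) / (a (j + 1) - a j) := fun j => by
    have : a (j + 1) - a j = 1 / k := by rw [hstep, add_sub_cancel_left]
    rw [this, div_div_eq_mul_div, div_one, mul_comm]
  refine ⟨P ∘ J, Q ∘ J, M, (measurable_of_countable P).comp hJm,
    (measurable_of_countable Q).comp hJm, fun s => ⟨hP0 _ (hJle s), (hM _ (hJle s)).1⟩,
    fun s => (hM _ (hJle s)).2, fun s t ht => ?_, fun s hs => ?_⟩
  · simp only [Function.comp]
    generalize hj : J s = j
    have hjm : j ≤ m := hj ▸ hJle s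
    have hp := hP0 j hjm
    have hlt : a j < a (j + 1) := by rw [hstep]; linarith [one_div_pos.2 hk0]
    have m1 := hamem j (by omega)
    have m2 := hamem (j + 1) (by omega)
    have e : Q j + P j * t = g (a j) + P j * (t - a (j + 1)) := by simp only [hQ]; ring
    rw [e]
    rcases lt_trichotomy t (a j) with h1 | h1 | h1
    · have h2 := hc.slope_mono_adjacent ht m2 h1 hlt
      rw [← hslope, div_le_iff₀ (by linarith)] at h2
      nlinarith
    · rw [h1]; nlinarith
    · rcases le_or_gt t (a (j + 1)) with h2 | h2
      · have := hm m1 ht h1.le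
        nlinarith
      · have h3 := hc.slope_mono_adjacent m1 ht hlt h2
        rw [← hslope, le_div_iff₀ (by linarith)] at h3
        have := hm m1 m2 hlt.le
        nlinarith
  · simp only [Function.comp]
    have hks : 0 ≤ k * s := mul_nonneg hk0.le hs.1
    have hl1 : a (J s) ≤ s := by
      rw [ha, div_le_iff₀ hk0]
      calc ((J s : ℕ) : ℝ) ≤ (⌊k * s⌋₊ : ℝ) := by exact_mod_cast min_le_left _ _
        _ ≤ k * s := Nat.floor_le hks
        _ = s * k := mul_comm _ _
    have hl2 : s ≤ a (J s + 1) := by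
      rw [ha, le_div_iff₀ hk0]
      rcases le_total ⌊k * s⌋₊ m with h1 | h1
      · have : J s = ⌊k * s⌋₊ := min_eq_left h1
        rw [this]
        push_cast
        linarith [Nat.lt_floor_add_one (k * s)]
      · have : J s = m := min_eq_right h1
        rw [this]
        push_cast
        nlinarith [hs.2]
    generalize hj : J s = j at hl1 hl2
    have hjm : j ≤ m := hj ▸ hJle s
    have hp := hP0 j hjm
    have m1 := hamem j (by omega)
    have m2 := hamem (j + 1) (by omega)
    have e : Q j + P j * s = g (a j) + P j * (s - a (j + 1)) := by simp only [hQ]; ring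
    rw [e]
    have h1 := hm hs m2 hl2
    have h2 := hη' _ m2 _ m1 (by
      rw [Real.dist_eq, hstep, add_sub_cancel_left, abs_of_pos (one_div_pos.2 hk0)]; exact hmη)
    rw [Real.dist_eq] at h2
    have h3 := (abs_lt.1 h2).2
    have h4 : P j * (a (j + 1) - s) ≤ P j * (1 / k) :=
      mul_le_mul_of_nonneg_left (by rw [hstep]; linarith) hp
    have h5 : P j * (1 / k) = g (a (j + 1)) - g (a j) := by simp only [hP]; field_simp
    linarith

/-! ### The set `K` -/

/-- First coordinate of the traceless part of `2Q`. -/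
def zx (Q : SymMat) : ℝ := 2 * Q.1 0 0 - 1

/-- Second coordinate of the traceless part of `2Q`. -/
def zy (Q : SymMat) : ℝ := 2 * Q.1 0 1

/-- The degree of orientation `√2 |Q - I/2|`. -/
def modulus (Q : SymMat) : ℝ := √2 * ‖(Q : Matrix (Fin 2) (Fin 2) ℝ) - (1 / 2 : ℝ) • 1‖

theorem SymMat.symm (Q : SymMat) : Q.1 1 0 = Q.1 0 1 := Matrix.IsSymm.apply Q.2 0 1

theorem mem_tensorSet_iff (Q : SymMat) :
    Q ∈ tensorSet ↔ Q.1 0 0 + Q.1 1 1 = 1 ∧ zx Q ^ 2 + zy Q ^ 2 ≤ 1 := by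
  have hs := Q.symm
  simp only [tensorSet, mem_ofPred_eq, Matrix.trace_fin_two, zx, zy]
  constructor
  · rintro ⟨h1, h2⟩
    have hd := h1.det_nonneg
    rw [Matrix.det_fin_two, hs] at hd
    refine ⟨h2, ?_⟩
    have : Q.1 1 1 = 1 - Q.1 0 0 := by linarith
    rw [this] at hd
    nlinarith
  · rintro ⟨h1, h2⟩
    refine ⟨?_, h1⟩
    refine Matrix.PosSemidef.of_dotProduct_mulVec_nonneg ?_ fun v => ?_
    · rw [Matrix.IsHermitian, Matrix.conjTranspose_eq_transpose_of_trivial]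
      exact Q.2
    · simp only [dotProduct, Matrix.mulVec, Fin.sum_univ_two, star_trivial, hs]
      have : Q.1 1 1 = 1 - Q.1 0 0 := by linarith
      rw [this]
      generalize Q.1 0 0 = a at *
      generalize Q.1 0 1 = b at *
      have hd : b ^ 2 ≤ a * (1 - a) := by nlinarith
      have ha : 0 ≤ a := by nlinarith [sq_nonneg b, sq_nonneg (2 * a - 1)]
      have ha1 : a ≤ 1 := by nlinarith [sq_nonneg b, sq_nonneg (2 * a - 1)]
      have k1 : 0 ≤ (a * v 0 + b * v 1) ^ 2 + (a * (1 - a) - b ^ 2) * v 1 ^ 2 := by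
        have := mul_nonneg (sub_nonneg.2 hd) (sq_nonneg (v 1))
        positivity
      have k2 : 0 ≤ ((1 - a) * v 1 + b * v 0) ^ 2 + (a * (1 - a) - b ^ 2) * v 0 ^ 2 := by
        have := mul_nonneg (sub_nonneg.2 hd) (sq_nonneg (v 0))
        positivity
      nlinarith

theorem modulus_nonneg (Q : SymMat) : 0 ≤ modulus Q := by unfold modulus; positivity

theorem modulus_sq {Q : SymMat} (h : Q.1 0 0 + Q.1 1 1 = 1) :
    modulus Q ^ 2 = zx Q ^ 2 + zy Q ^ 2 := by
  have hs := Q.symm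
  have h1 : Q.1 1 1 = 1 - Q.1 0 0 := by linarith
  rw [modulus, mul_pow, Real.sq_sqrt (by norm_num), Matrix.frobenius_norm_def, ← Real.rpow_natCast,
    ← Real.rpow_mul (by positivity)]
  simp only [Fin.sum_univ_two, Real.rpow_ofNat, Real.norm_eq_abs, sq_abs, Matrix.sub_apply,
    Matrix.smul_apply, Matrix.one_apply, hs, h1, zx, zy]
  norm_num
  ring

theorem modulus_eq_sqrt {Q : SymMat} (h : Q.1 0 0 + Q.1 1 1 = 1) :
    modulus Q = √(zx Q ^ 2 + zy Q ^ 2) := by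
  rw [← modulus_sq h, Real.sqrt_sq (modulus_nonneg Q)]

theorem modulus_mem_Icc {Q : SymMat} (h : Q ∈ tensorSet) : modulus Q ∈ Icc (0 : ℝ) 1 := by
  refine ⟨modulus_nonneg Q, ?_⟩
  rw [mem_tensorSet_iff] at h
  rw [modulus_eq_sqrt h.1]
  exact Real.sqrt_le_one.2 h.2

section NormTopology

/-- The topology of the Frobenius norm on symmetric matrices. -/
abbrev symMatTopology : TopologicalSpace SymMat :=
  (inferInstance : PseudoMetricSpace SymMat).toUniformSpace.toTopologicalSpace

attribute [local instance] symMatTopology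

theorem continuous_entry (k l : Fin 2) : Continuous fun Q : SymMat => Q.1 k l :=
  (continuous_apply_apply k l).comp continuous_subtype_val

theorem aestronglyMeasurable_entry {Ω : Set Plane} (Q : LInf Ω) (k l : Fin 2) :
    AEStronglyMeasurable (fun x => (Q x).1 k l) (volume.restrict Ω) :=
  (continuous_entry k l).comp_aestronglyMeasurable (Lp.aestronglyMeasurable Q)

theorem aestronglyMeasurable_entry' {Ω : Set Plane} (Q : Lp SymMat 1 (volume.restrict Ω))
    (k l : Fin 2) : AEStronglyMeasurable (fun x => (Q x).1 k l) (volume.restrict Ω) :=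
  (continuous_entry k l).comp_aestronglyMeasurable (Lp.aestronglyMeasurable Q)

theorem norm_eq_sqrt (Q : SymMat) : ‖Q‖ = √(∑ i, ∑ j, ‖Q.1 i j‖ ^ 2) := by
  change ‖Q.1‖ = _
  rw [Matrix.frobenius_norm_def, ← Real.sqrt_eq_rpow]
  simp only [Real.rpow_ofNat]

theorem abs_entry_le_norm (Q : SymMat) (k l : Fin 2) : |Q.1 k l| ≤ ‖Q‖ := by
  rw [norm_eq_sqrt]
  refine Real.le_sqrt_of_sq_le ?_
  have h1 := Finset.single_le_sum (f := fun j => ‖Q.1 k j‖ ^ 2) (fun j _ => by positivity)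
    (Finset.mem_univ l)
  have h2 := Finset.single_le_sum (f := fun i => ∑ j, ‖Q.1 i j‖ ^ 2) (fun j _ => by positivity)
    (Finset.mem_univ k)
  exact h1.trans h2

theorem integrable_entry {Ω : Set Plane} (Q : Lp SymMat 1 (volume.restrict Ω)) (k l : Fin 2) :
    IntegrableOn (fun x => (Q x).1 k l) Ω := by
  have h : Integrable (fun x => ‖Q x‖) (volume.restrict Ω) := (L1.integrable_coeFn Q).norm
  exact h.mono' (aestronglyMeasurable_entry' Q k l)
    (Eventually.of_forall fun x => abs_entry_le_norm _ _ _)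

/-- The symmetric matrix with given entries. -/
def symMk (a b c : ℝ) : SymMat :=
  ⟨!![a, b; b, c], by ext i j; fin_cases i <;> fin_cases j <;> rfl⟩

theorem frobInner_eq (A B : SymMat) : frobInner A B =
    A.1 0 0 * B.1 0 0 + 2 * (A.1 0 1 * B.1 0 1) + A.1 1 1 * B.1 1 1 := by
  simp only [frobInner, Fin.sum_univ_two, A.symm, B.symm]
  ring

theorem exists_testFunction {Ω : Set Plane} {a b c : Plane → ℝ} (ha : IntegrableOn a Ω)
    (hb : IntegrableOn b Ω) (hc : IntegrableOn c Ω) :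
    ∃ φ : Lp SymMat 1 (volume.restrict Ω),
      ∀ᵐ x ∂(volume.restrict Ω), ∀ Q : SymMat, frobInner (φ x) Q =
        a x * Q.1 0 0 + 2 * (b x * Q.1 0 1) + c x * Q.1 1 1 := by
  have e : (fun x => symMk (a x) (b x) (c x)) =
      fun x => a x • symMk 1 0 0 + b x • symMk 0 1 0 + c x • symMk 0 0 1 := by
    funext x
    refine Subtype.ext ?_
    ext i j
    fin_cases i <;> fin_cases j <;> simp [symMk]
  have hi : Integrable (fun x => symMk (a x) (b x) (c x)) (volume.restrict Ω) := by
    have h : ∀ i j, IntegrableOn (fun x => (symMk (a x) (b x) (c x)).1 i j) Ω := by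
      intro i j
      fin_cases i <;> fin_cases j <;> simpa [symMk]
    refine ⟨?_, ?_⟩
    · rw [e]
      exact ((ha.aestronglyMeasurable.smul_const _).add (hb.aestronglyMeasurable.smul_const _)).add
        (hc.aestronglyMeasurable.smul_const _)
    · have hsum : Integrable (fun x => ∑ i, ∑ j, |(symMk (a x) (b x) (c x)).1 i j|)
          (volume.restrict Ω) :=
        integrable_finsetSum _ fun i _ => integrable_finsetSum _ fun j _ => (h i j).abs
      refine hsum.hasFiniteIntegral.mono' (Eventually.of_forall fun x => ?_)
      rw [norm_eq_sqrt]
      refine Real.sqrt_le_iff.2 ⟨by positivity, ?_⟩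
      simp only [Fin.sum_univ_two, Real.norm_eq_abs]
      have n := fun i j => abs_nonneg ((symMk (a x) (b x) (c x)).1 i j)
      have key : ∀ p q r s : ℝ, 0 ≤ p → 0 ≤ q → 0 ≤ r → 0 ≤ s →
          p ^ 2 + q ^ 2 + (r ^ 2 + s ^ 2) ≤ (p + q + (r + s)) ^ 2 := fun p q r s hp hq hr hs => by
        have : 0 ≤ p * q + p * r + p * s + q * r + q * s + r * s := by positivity
        linarith [this, show (p + q + (r + s)) ^ 2 = p ^ 2 + q ^ 2 + (r ^ 2 + s ^ 2) +
          2 * (p * q + p * r + p * s + q * r + q * s + r * s) by ring]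
      exact key _ _ _ _ (n 0 0) (n 0 1) (n 1 0) (n 1 1)
  refine ⟨hi.toL1, ?_⟩
  filter_upwards [hi.coeFn_toL1] with x hx Q
  rw [hx, frobInner_eq]
  simp [symMk]

theorem abs_entry_le {Q : SymMat} (h : Q ∈ tensorSet) (k l : Fin 2) : |Q.1 k l| ≤ 1 := by
  rw [mem_tensorSet_iff] at h
  have hs := Q.symm
  simp only [zx, zy] at h
  have h0 : (2 * Q.1 0 0 - 1) ^ 2 ≤ 1 := by nlinarith [sq_nonneg (Q.1 0 1)]
  have h1 : (2 * Q.1 0 1) ^ 2 ≤ 1 := by nlinarith [sq_nonneg (2 * Q.1 0 0 - 1)]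
  have h0 := abs_le.1 ((sq_le_one_iff_abs_le_one _).1 h0)
  have h1 := abs_le.1 ((sq_le_one_iff_abs_le_one _).1 h1)
  rw [abs_le]
  fin_cases k <;> fin_cases l <;> simp only [Fin.zero_eta, Fin.mk_one, hs] <;>
    constructor <;> linarith

theorem entry_eq {Q : SymMat} (h : Q ∈ tensorSet) :
    Q.1 0 0 = (1 + zx Q) / 2 ∧ Q.1 0 1 = zy Q / 2 ∧ Q.1 1 0 = zy Q / 2 ∧
      Q.1 1 1 = (1 - zx Q) / 2 := by
  have := ((mem_tensorSet_iff Q).1 h).1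
  have hs := Q.symm
  simp only [zx, zy]
  refine ⟨by ring, by ring, by rw [hs]; ring, by linarith⟩

/-! ### Spins -/

theorem Circ.sq_add_sq (u : Circ) : (u : Plane) 0 ^ 2 + (u : Plane) 1 ^ 2 = 1 := by
  have h : ‖(u : Plane)‖ = 1 := by simp
  rw [EuclideanSpace.norm_eq] at h
  have h2 := (Real.sqrt_eq_one).1 h
  simpa [Fin.sum_univ_two] using h2

/-- The spin with given coordinates. -/
def mkCirc (a b : ℝ) (h : a ^ 2 + b ^ 2 = 1) : Circ :=
  ⟨!₂[a, b], by
    rw [mem_sphere_zero_iff_norm, EuclideanSpace.norm_eq, Real.sqrt_eq_one]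
    simpa [Fin.sum_univ_two] using h⟩

@[simp] theorem mkCirc_zero (a b : ℝ) (h : a ^ 2 + b ^ 2 = 1) : (mkCirc a b h : Plane) 0 = a := rfl

@[simp] theorem mkCirc_one (a b : ℝ) (h : a ^ 2 + b ^ 2 = 1) : (mkCirc a b h : Plane) 1 = b := rfl

theorem inner_circ (u v : Circ) : inner ℝ (u : Plane) (v : Plane) =
    (u : Plane) 0 * (v : Plane) 0 + (u : Plane) 1 * (v : Plane) 1 := by
  simp [PiLp.inner_apply, Fin.sum_univ_two, mul_comm]

theorem zx_tensorOf (u : Circ) : zx (tensorOf u) = (u : Plane) 0 ^ 2 - (u : Plane) 1 ^ 2 := by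
  simp only [zx, tensorOf, Matrix.vecMulVec_apply]
  linarith [u.sq_add_sq]

theorem zy_tensorOf (u : Circ) : zy (tensorOf u) = 2 * ((u : Plane) 0 * (u : Plane) 1) := by
  simp only [zy, tensorOf, Matrix.vecMulVec_apply]

theorem zx_sq_add_zy_sq (u : Circ) : zx (tensorOf u) ^ 2 + zy (tensorOf u) ^ 2 = 1 := by
  rw [zx_tensorOf, zy_tensorOf]
  have := u.sq_add_sq
  calc _ = ((u : Plane) 0 ^ 2 + (u : Plane) 1 ^ 2) ^ 2 := by ring
    _ = 1 := by rw [this]; norm_num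

theorem tensorOf_mem (u : Circ) : tensorOf u ∈ tensorSet := by
  rw [mem_tensorSet_iff]
  refine ⟨?_, (zx_sq_add_zy_sq u).le⟩
  simp only [tensorOf, Matrix.vecMulVec_apply]
  linarith [u.sq_add_sq]

theorem abs_inner_mem_Icc (u v : Circ) : |inner ℝ (u : Plane) (v : Plane)| ∈ Icc (0 : ℝ) 1 := by
  refine ⟨abs_nonneg _, (abs_real_inner_le_norm _ _).trans (by simp)⟩

/-- A spin field defines an element of `L^∞`. -/
theorem exists_interpolation (Ω : Set Plane) (ε : ℝ) (u : (Fin 2 → ℤ) → Circ) :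
    ∃ Q : LInf Ω, ∀ᵐ x ∂(volume.restrict Ω), Q x = tensorOf (u (site ε x)) := by
  have hm : AEStronglyMeasurable (fun x => tensorOf (u (site ε x))) (volume.restrict Ω) :=
    (StronglyMeasurable.of_discrete (f := fun i => tensorOf (u i))).comp_measurable
      (measurable_site ε) |>.aestronglyMeasurable
  have hb : ∀ Q ∈ tensorSet, ‖Q‖ ≤ 2 := by
    intro Q hQ
    rw [norm_eq_sqrt]
    refine Real.sqrt_le_iff.2 ⟨by norm_num, ?_⟩
    have h : ∀ i j, ‖Q.1 i j‖ ^ 2 ≤ 1 := fun i j =>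
      pow_le_one₀ (norm_nonneg _) (abs_entry_le hQ i j)
    simp only [Fin.sum_univ_two]
    linarith [h 0 0, h 0 1, h 1 0, h 1 1]
  have hp : MemLp (fun x => tensorOf (u (site ε x))) ∞ (volume.restrict Ω) :=
    memLp_top_of_bound hm 2 (Eventually.of_forall fun x => hb _ (tensorOf_mem _))
  exact ⟨hp.toLp _, hp.coeFn_toLp⟩

end NormTopology

theorem four_mul_inner_sq (u v : Circ) : 4 * (inner ℝ (u : Plane) (v : Plane)) ^ 2 =
    (zx (tensorOf u) + zx (tensorOf v)) ^ 2 + (zy (tensorOf u) + zy (tensorOf v)) ^ 2 := by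
  have hu := zx_sq_add_zy_sq u
  have hv := zx_sq_add_zy_sq v
  have hu1 := u.sq_add_sq
  have hv1 := v.sq_add_sq
  have : (zx (tensorOf u) + zx (tensorOf v)) ^ 2 + (zy (tensorOf u) + zy (tensorOf v)) ^ 2 =
      2 + 2 * (zx (tensorOf u) * zx (tensorOf v) + zy (tensorOf u) * zy (tensorOf v)) := by
    linear_combination hu + hv
  rw [this, inner_circ, zx_tensorOf, zx_tensorOf, zy_tensorOf, zy_tensorOf]
  have hp : ((u : Plane) 0 ^ 2 + (u : Plane) 1 ^ 2) * ((v : Plane) 0 ^ 2 + (v : Plane) 1 ^ 2) = 1 :=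
    by rw [hu1, hv1, one_mul]
  linear_combination 2 * hp

/-- The averaged order parameter of two spins is dominated, in every direction, by the modulus of
their scalar product. -/
theorem average_le_abs_inner (u v : Circ) {a b : ℝ} (h : a ^ 2 + b ^ 2 ≤ 1) :
    a * ((zx (tensorOf u) + zx (tensorOf v)) / 2) + b * ((zy (tensorOf u) + zy (tensorOf v)) / 2) ≤
      |inner ℝ (u : Plane) (v : Plane)| := by
  have e := four_mul_inner_sq u v
  refine abs_le_of_sq_le_sq' ?_ (abs_nonneg _) |>.2
  rw [sq_abs]
  generalize zx (tensorOf u) + zx (tensorOf v) = X at *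
  generalize zy (tensorOf u) + zy (tensorOf v) = Y at *
  have h1 : (a * (X / 2) + b * (Y / 2)) ^ 2 ≤ (a ^ 2 + b ^ 2) * ((X / 2) ^ 2 + (Y / 2) ^ 2) := by
    nlinarith [sq_nonneg (a * (Y / 2) - b * (X / 2))]
  have h2 : (a ^ 2 + b ^ 2) * ((X / 2) ^ 2 + (Y / 2) ^ 2) ≤ 1 * ((X / 2) ^ 2 + (Y / 2) ^ 2) :=
    mul_le_mul_of_nonneg_right h (by positivity)
  nlinarith

/-- Two spins whose mean tensor has director `n` and signed modulus `t`. -/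
theorem exists_spin_pair (n : Circ) {t : ℝ} (ht : |t| ≤ 1) : ∃ v w : Circ,
    zx (tensorOf v) + zx (tensorOf w) = 2 * (t * zx (tensorOf n)) ∧
    zy (tensorOf v) + zy (tensorOf w) = 2 * (t * zy (tensorOf n)) ∧
    |inner ℝ (v : Plane) (w : Plane)| = |t| := by
  have ht' := abs_le.1 ht
  set c := √((1 + t) / 2) with hc
  set d := √((1 - t) / 2) with hd
  have hc2 : c ^ 2 = (1 + t) / 2 := Real.sq_sqrt (by linarith)
  have hd2 : d ^ 2 = (1 - t) / 2 := Real.sq_sqrt (by linarith)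
  have hn := n.sq_add_sq
  set a := (n : Plane) 0
  set b := (n : Plane) 1
  have hcd : (c ^ 2 + d ^ 2) * (a ^ 2 + b ^ 2) = 1 := by rw [hn, hc2, hd2]; ring
  have hcd' : c ^ 2 - d ^ 2 = t := by rw [hc2, hd2]; ring
  refine ⟨mkCirc (c * a - d * b) (c * b + d * a) (by linear_combination hcd),
    mkCirc (c * a + d * b) (c * b - d * a) (by linear_combination hcd), ?_, ?_, ?_⟩
  · simp only [zx_tensorOf, mkCirc_zero, mkCirc_one]
    linear_combination 2 * (a ^ 2 - b ^ 2) * hcd'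
  · simp only [zy_tensorOf, mkCirc_zero, mkCirc_one]
    linear_combination 4 * a * b * hcd'
  · rw [inner_circ]
    simp only [mkCirc_zero, mkCirc_one]
    congr 1
    linear_combination (a ^ 2 + b ^ 2) * hcd' + t * hn

/-! ### Weak* convergence -/

theorem tendsto_weakStar_iff {Ω : Set Plane} {ι : Type*} {l : Filter ι} (y : ι → LInf Ω)
    (Q : LInf Ω) : Tendsto y l (@nhds _ (weakStarTopology Ω) Q) ↔
      ∀ φ : Lp SymMat 1 (volume.restrict Ω),
        Tendsto (fun n => ∫ x in Ω, frobInner (φ x) (y n x)) l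
          (𝓝 (∫ x in Ω, frobInner (φ x) (Q x))) := by
  rw [weakStarTopology, nhds_iInf, tendsto_iInf]
  refine forall_congr' fun φ => ?_
  rw [nhds_induced, tendsto_comap_iff]
  rfl

theorem tendsto_integral_entries {Ω : Set Plane} {y : ℕ → LInf Ω} {Q : LInf Ω}
    (hy : Tendsto y atTop (@nhds _ (weakStarTopology Ω) Q)) {a b c : Plane → ℝ}
    (ha : IntegrableOn a Ω) (hb : IntegrableOn b Ω) (hc : IntegrableOn c Ω) :
    Tendsto (fun n => ∫ x in Ω,
        (a x * (y n x).1 0 0 + 2 * (b x * (y n x).1 0 1) + c x * (y n x).1 1 1)) atTop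
      (𝓝 (∫ x in Ω, (a x * (Q x).1 0 0 + 2 * (b x * (Q x).1 0 1) + c x * (Q x).1 1 1))) := by
  obtain ⟨φ, hφ⟩ := exists_testFunction ha hb hc
  have h := (tendsto_weakStar_iff y Q).1 hy φ
  have e : ∀ P : LInf Ω, ∫ x in Ω, frobInner (φ x) (P x) =
      ∫ x in Ω, (a x * (P x).1 0 0 + 2 * (b x * (P x).1 0 1) + c x * (P x).1 1 1) := fun P =>
    integral_congr_ae (by filter_upwards [hφ] with x hx using hx (P x))
  simpa only [e] using h

theorem exists_bound_entry {Ω : Set Plane} (Q : LInf Ω) :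
    ∃ M : ℝ, ∀ᵐ x ∂(volume.restrict Ω), ∀ k l, |(Q x).1 k l| ≤ M := by
  refine ⟨(eLpNormEssSup Q (volume.restrict Ω)).toReal, ?_⟩
  have hfin : eLpNormEssSup Q (volume.restrict Ω) ≠ ∞ := by
    rw [← eLpNorm_exponent_top]
    exact (Lp.eLpNorm_lt_top Q).ne
  filter_upwards [enorm_ae_le_eLpNormEssSup Q (volume.restrict Ω)] with x hx k l
  refine (abs_entry_le_norm _ k l).trans ?_
  rw [← toReal_enorm]
  exact ENNReal.toReal_mono hfin hx

theorem integrableOn_mul_entry {Ω : Set Plane} (Q : LInf Ω) {a : Plane → ℝ}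
    (ha : IntegrableOn a Ω) (k l : Fin 2) : IntegrableOn (fun x => a x * (Q x).1 k l) Ω := by
  obtain ⟨M, hM⟩ := exists_bound_entry Q
  have := Integrable.bdd_mul (c := M) ha (aestronglyMeasurable_entry Q k l) (by
    filter_upwards [hM] with x hx using hx k l)
  exact this.congr (Eventually.of_forall fun x => mul_comm _ _)

theorem integrableOn_entry {Ω : Set Plane} (hb : Bornology.IsBounded Ω) (Q : LInf Ω)
    (k l : Fin 2) : IntegrableOn (fun x => (Q x).1 k l) Ω := by
  have h1 : IntegrableOn (fun _ => (1 : ℝ)) Ω := integrableOn_const hb.measure_lt_top.ne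
  simpa using integrableOn_mul_entry Q h1 k l

theorem ae_le_of_frequently_ae_le {Ω : Set Plane} (hb : Bornology.IsBounded Ω)
    {y : ℕ → LInf Ω} {Q : LInf Ω} (hy : Tendsto y atTop (@nhds _ (weakStarTopology Ω) Q))
    (a b c κ : ℝ)
    (hK : ∃ᶠ n in atTop, ∀ᵐ x ∂(volume.restrict Ω),
      a * (y n x).1 0 0 + 2 * (b * (y n x).1 0 1) + c * (y n x).1 1 1 ≤ κ) :
    ∀ᵐ x ∂(volume.restrict Ω), a * (Q x).1 0 0 + 2 * (b * (Q x).1 0 1) + c * (Q x).1 1 1 ≤ κ := by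
  have hint : ∀ P : LInf Ω, IntegrableOn
      (fun x => a * (P x).1 0 0 + 2 * (b * (P x).1 0 1) + c * (P x).1 1 1) Ω := fun P =>
    (((integrableOn_entry hb P 0 0).const_mul a).add
      (((integrableOn_entry hb P 0 1).const_mul b).const_mul 2)).add
      ((integrableOn_entry hb P 1 1).const_mul c)
  have hfin : IsFiniteMeasure (volume.restrict Ω) := ⟨by simpa using hb.measure_lt_top⟩
  refine ae_le_of_forall_setIntegral_le (hint Q) (integrable_const κ) fun E hE _ => ?_
  have hind : ∀ t : ℝ, IntegrableOn (E.indicator fun _ => t) Ω := fun t =>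
    (integrable_const t).indicator hE
  have ht := tendsto_integral_entries hy (hind a) (hind b) (hind c)
  have e : ∀ P : LInf Ω, ∫ x in Ω, (E.indicator (fun _ => a) x * (P x).1 0 0 +
      2 * (E.indicator (fun _ => b) x * (P x).1 0 1) + E.indicator (fun _ => c) x * (P x).1 1 1) =
      ∫ x in E, (a * (P x).1 0 0 + 2 * (b * (P x).1 0 1) + c * (P x).1 1 1)
        ∂(volume.restrict Ω) := fun P => by
    rw [← integral_indicator hE]
    refine integral_congr_ae (Eventually.of_forall fun x => ?_)
    by_cases hx : x ∈ E <;> simp [hx]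
  simp only [e] at ht
  refine le_of_tendsto_of_frequently ht (hK.mono fun n hn => ?_)
  exact setIntegral_mono_ae (hint (y n)).integrableOn (integrable_const κ).integrableOn hn

theorem ae_mem_tensorSet_of_frequently {Ω : Set Plane}
    (hb : Bornology.IsBounded Ω)
    {y : ℕ → LInf Ω} {Q : LInf Ω} (hy : Tendsto y atTop (@nhds _ (weakStarTopology Ω) Q))
    (hK : ∃ᶠ n in atTop, ∀ᵐ x ∂(volume.restrict Ω), y n x ∈ tensorSet) :
    ∀ᵐ x ∂(volume.restrict Ω), Q x ∈ tensorSet := by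
  have hpq : ∀ r : ℚ × ℚ, ∀ᵐ x ∂(volume.restrict Ω),
      (2 * (r.1 : ℝ)) * (Q x).1 0 0 + 2 * ((r.2 : ℝ) * (Q x).1 0 1) + 0 * (Q x).1 1 1 ≤
        √((r.1 : ℝ) ^ 2 + (r.2 : ℝ) ^ 2) + r.1 := by
    intro r
    refine ae_le_of_frequently_ae_le hb hy _ _ _ _ (hK.mono fun n hn => ?_)
    filter_upwards [hn] with x hx
    have h2 := ((mem_tensorSet_iff _).1 hx).2
    have h3 : (r.1 : ℝ) * zx (y n x) + r.2 * zy (y n x) ≤ √((r.1 : ℝ) ^ 2 + (r.2 : ℝ) ^ 2) := by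
      refine Real.le_sqrt_of_sq_le ?_
      have := mul_le_mul_of_nonneg_left h2
        (by positivity : 0 ≤ (r.1 : ℝ) ^ 2 + (r.2 : ℝ) ^ 2)
      nlinarith [sq_nonneg ((r.1 : ℝ) * zy (y n x) - r.2 * zx (y n x))]
    simp only [zx, zy] at h3
    linarith
  have htr1 := ae_le_of_frequently_ae_le hb hy 1 0 1 1 (hK.mono fun n hn => by
    filter_upwards [hn] with x hx
    have := ((mem_tensorSet_iff _).1 hx).1
    linarith)
  have htr2 := ae_le_of_frequently_ae_le hb hy (-1) 0 (-1) (-1) (hK.mono fun n hn => by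
    filter_upwards [hn] with x hx
    have := ((mem_tensorSet_iff _).1 hx).1
    linarith)
  filter_upwards [ae_all_iff.2 hpq, htr1, htr2] with x h1 h2 h3
  rw [mem_tensorSet_iff]
  refine ⟨by linarith, ?_⟩
  have hall : ∀ v : ℝ × ℝ, v.1 * zx (Q x) + v.2 * zy (Q x) ≤ √(v.1 ^ 2 + v.2 ^ 2) := by
    have hd : DenseRange (Prod.map ((↑) : ℚ → ℝ) ((↑) : ℚ → ℝ)) :=
      Rat.denseRange_cast.prodMap Rat.denseRange_cast
    intro v
    refine hd.induction_on (p := fun v : ℝ × ℝ =>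
      v.1 * zx (Q x) + v.2 * zy (Q x) ≤ √(v.1 ^ 2 + v.2 ^ 2)) v
      (isClosed_le (by fun_prop) (by fun_prop)) fun r => ?_
    have := h1 r
    simp only [Prod.map, zx, zy]
    linarith
  have h4 := hall (zx (Q x), zy (Q x))
  dsimp only at h4
  have h5 : (0 : ℝ) ≤ zx (Q x) ^ 2 + zy (Q x) ^ 2 := by positivity
  have h6 := Real.sq_sqrt h5
  nlinarith [Real.sqrt_nonneg (zx (Q x) ^ 2 + zy (Q x) ^ 2)]

/-! ### Continuity of translations -/

theorem tendsto_integral_abs_translate {ψ : Plane → ℝ} (hψ : Integrable ψ) :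
    Tendsto (fun v : Plane => ∫ x, |ψ (x - v) - ψ x|) (𝓝 0) (𝓝 0) := by
  set F : Lp ℝ 1 (volume : Measure Plane) := hψ.toL1 ψ with hF
  have hc : Continuous fun v : Plane => (DomAddAct.mk (-v)) +ᵥ F := by
    have hp : Fact ((1 : ℝ≥0∞) ≠ ∞) := ⟨ENNReal.one_ne_top⟩
    have h1 : Continuous fun v : Plane => DomAddAct.mk (-v) :=
      DomAddAct.continuous_mk.comp continuous_neg
    exact h1.vadd continuous_const
  have h0 : (DomAddAct.mk (-(0 : Plane))) +ᵥ F = F := by simp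
  have ht : Tendsto (fun v : Plane => ‖(DomAddAct.mk (-v) +ᵥ F) - F‖) (𝓝 0) (𝓝 0) := by
    have := ((hc.sub (continuous_const (y := F))).norm.tendsto 0)
    simp only [Pi.sub_apply] at this
    rw [h0, sub_self, norm_zero] at this
    exact this
  refine ht.congr fun v => ?_
  rw [L1.norm_eq_integral_norm]
  refine integral_congr_ae ?_
  have hsub := Lp.coeFn_sub (DomAddAct.mk (-v) +ᵥ F) F
  have e1 := hψ.coeFn_toL1
  have e2 : DomAddAct.mk (-v) +ᵥ F = _ := DomAddAct.mk_vadd_toLp (-v) (memLp_one_iff_integrable.2 hψ)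
  have e3 := MemLp.coeFn_toLp ((memLp_one_iff_integrable.2 hψ).comp_measurePreserving
    (measurePreserving_vadd (-v) (volume : Measure Plane)))
  rw [e2] at hsub ⊢
  filter_upwards [hsub, e1, e3] with x h1 h2 h3
  have h3' : (MemLp.toLp (fun x => ψ (-v +ᵥ x)) ((memLp_one_iff_integrable.2 hψ).comp_measurePreserving
    (measurePreserving_vadd (-v) (volume : Measure Plane))) : Plane → ℝ) x = ψ (-v +ᵥ x) := h3
  rw [h1, Pi.sub_apply, h3', hF, h2]
  simp [sub_eq_neg_add]

/-! ### The lower bound -/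

/-- The `L¹` distance between a function and its translate. -/
def shiftError (ψ : Plane → ℝ) (v : Plane) : ℝ := ∫ x, |ψ (x - v) - ψ x|

theorem abs_integral_shift_sub_le {ψ X : Plane → ℝ} (hψ : Integrable ψ) (hX : Measurable X)
    (hX1 : ∀ x, |X x| ≤ 1) (v : Plane) :
    |(∫ x, ψ x * X (x + v)) - ∫ x, ψ x * X x| ≤ shiftError ψ v := by
  have hψv : Integrable fun x => ψ (x - v) := hψ.comp_sub_right v
  have hi : ∀ {φ : Plane → ℝ}, Integrable φ → Integrable fun x => φ x * X x := fun hφ =>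
    (Integrable.bdd_mul (c := 1) hφ hX.aestronglyMeasurable
      (Eventually.of_forall hX1)).congr (Eventually.of_forall fun x => mul_comm _ _)
  have e : ∫ x, ψ x * X (x + v) = ∫ x, ψ (x - v) * X x := by
    rw [← integral_add_right_eq_self (fun x => ψ (x - v) * X x) v]
    simp
  rw [e, ← integral_sub (hi hψv) (hi hψ), ← Real.norm_eq_abs]
  refine norm_integral_le_of_norm_le (hψv.sub hψ).abs (Eventually.of_forall fun x => ?_)
  rw [← sub_mul, norm_mul]
  exact mul_le_of_le_one_right (norm_nonneg _) (hX1 x)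

theorem site_add_latticePoint {ε : ℝ} (hε : 0 < ε) (x : Plane) (e : Fin 2 → ℤ) :
    site ε (x + latticePoint ε e) = site ε x + e := by
  funext k
  simp only [site, latticePoint, PiLp.add_apply, Pi.add_apply]
  rw [← Int.floor_add_intCast]
  congr 1
  field_simp
  ring

theorem ae_eq_tensorOf {Ω : Set Plane} {ε : ℝ} (hε : 0 < ε) {u : (Fin 2 → ℤ) → Circ} {P : LInf Ω}
    (hP : IsInterpolation Ω ε u P) :
    ∀ᵐ x ∂(volume.restrict Ω), site ε x ∈ latticeIn ε Ω → P x = tensorOf (u (site ε x)) := by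
  have h : ∀ i : Fin 2 → ℤ, ∀ᵐ x ∂(volume.restrict Ω),
      i ∈ latticeIn ε Ω → x ∈ cell ε i → P x = tensorOf (u i) := fun i => by
    by_cases hi : i ∈ latticeIn ε Ω
    · filter_upwards [hP.2 i hi] with x hx _ using hx
    · exact Eventually.of_forall fun x h => absurd h hi
  filter_upwards [ae_all_iff.2 h] with x hx hs
  exact hx _ hs ((mem_cell_iff hε _ _).2 rfl)

/-- Replacing the values of an interpolation by the spin field itself only costs a boundary
term. -/
theorem abs_setIntegral_interpolation_sub_le {Ω : Set Plane} (ho : IsOpen Ω)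
    (hb : Bornology.IsBounded Ω) {ε : ℝ} (hε : 0 < ε) {u : (Fin 2 → ℤ) → Circ} {P : LInf Ω}
    (hP : IsInterpolation Ω ε u P) {z : SymMat → ℝ} (hz : ∀ Q ∈ tensorSet, |z Q| ≤ 1)
    (hzP : AEStronglyMeasurable (fun x => z (P x)) (volume.restrict Ω))
    {ψ : Plane → ℝ} (hψ : Integrable ψ) {M : ℝ} (hM : ∀ x, |ψ x| ≤ M) :
    |(∫ x, Ω.indicator ψ x * z (tensorOf (u (site ε x)))) - ∫ x in Ω, ψ x * z (P x)| ≤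
      2 * M * tube Ω (4 * ε) := by
  have hM0 : 0 ≤ M := (abs_nonneg _).trans (hM 0)
  set T := Metric.cthickening (4 * ε) (frontier Ω)
  have hT : MeasurableSet T := Metric.isClosed_cthickening.measurableSet
  have e : ∫ x, Ω.indicator ψ x * z (tensorOf (u (site ε x))) =
      ∫ x in Ω, ψ x * z (tensorOf (u (site ε x))) := by
    rw [← integral_indicator ho.measurableSet]
    congr 1
    funext x
    by_cases hx : x ∈ Ω <;> simp [hx]
  have hi1 : IntegrableOn (fun x => ψ x * z (tensorOf (u (site ε x)))) Ω :=
    (Integrable.bdd_mul (c := 1) hψ.integrableOn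
      (measurable_comp_site ε fun i => z (tensorOf (u i))).aestronglyMeasurable
      (Eventually.of_forall fun x => hz _ (tensorOf_mem _))).congr
      (Eventually.of_forall fun x => mul_comm _ _)
  have hi2 : IntegrableOn (fun x => ψ x * z (P x)) Ω :=
    (Integrable.bdd_mul (c := 1) hψ.integrableOn hzP (by
      filter_upwards [hP.1] with x hx using hz _ hx)).congr
      (Eventually.of_forall fun x => mul_comm _ _)
  have hfin : IsFiniteMeasure (volume.restrict Ω) := ⟨by simpa using hb.measure_lt_top⟩
  rw [e, ← integral_sub hi1 hi2, ← Real.norm_eq_abs]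
  have hbd : Integrable (T.indicator fun _ => 2 * M) (volume.restrict Ω) :=
    (integrable_const _).indicator hT
  refine (norm_integral_le_of_norm_le hbd ?_).trans ?_
  · filter_upwards [ae_eq_tensorOf hε hP, hP.1, ae_restrict_mem ho.measurableSet] with x h1 h2 h3
    by_cases hx : x ∈ T
    · rw [indicator_of_mem hx, ← mul_sub, norm_mul, Real.norm_eq_abs, Real.norm_eq_abs]
      have a1 := hz _ (tensorOf_mem (u (site ε x)))
      have a2 := hz _ h2
      have := abs_sub (z (tensorOf (u (site ε x)))) (z (P x))
      calc _ ≤ M * 2 := mul_le_mul (hM x) (by linarith) (abs_nonneg _) hM0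
        _ = _ := by ring
    · rw [indicator_of_notMem hx]
      have hs : site ε x ∈ latticeIn ε Ω := by
        by_contra hs
        have d0 := dist_latticePoint_site_le hε x 0 (by simp)
        rw [add_zero] at d0
        exact hx (mem_cthickening_frontier d0 fun hh => hs (hh.1 h3))
      rw [h1 hs, sub_self, norm_zero]
  · rw [integral_indicator hT, setIntegral_const, smul_eq_mul, mul_comm]
    refine mul_le_mul_of_nonneg_left ?_ (by positivity)
    rw [measureReal_restrict_apply hT]
    exact measureReal_le_tube hb inter_subset_left

theorem abs_zx_le {Q : SymMat} (h : Q ∈ tensorSet) : |zx Q| ≤ 1 := by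
  have := ((mem_tensorSet_iff Q).1 h).2
  exact (sq_le_one_iff_abs_le_one _).1 (by nlinarith [sq_nonneg (zy Q)])

theorem abs_zy_le {Q : SymMat} (h : Q ∈ tensorSet) : |zy Q| ≤ 1 := by
  have := ((mem_tensorSet_iff Q).1 h).2
  exact (sq_le_one_iff_abs_le_one _).1 (by nlinarith [sq_nonneg (zx Q)])

theorem aestronglyMeasurable_zx {Ω : Set Plane} (P : LInf Ω) :
    AEStronglyMeasurable (fun x => zx (P x)) (volume.restrict Ω) :=
  ((aestronglyMeasurable_entry P 0 0).const_mul 2).sub aestronglyMeasurable_const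

theorem aestronglyMeasurable_zy {Ω : Set Plane} (P : LInf Ω) :
    AEStronglyMeasurable (fun x => zy (P x)) (volume.restrict Ω) :=
  (aestronglyMeasurable_entry P 0 1).const_mul 2

theorem le_latticeEnergy {f : Circ → Circ → ℝ} {C : ℝ} (hsymm : ∀ u v, f u v = f v u)
    (hfC : ∀ u v, |f u v| ≤ C) {Ω : Set Plane} (ho : IsOpen Ω)
    (hb : Bornology.IsBounded Ω) {ε : ℝ} (hε : 0 < ε) {u : (Fin 2 → ℤ) → Circ} {P : LInf Ω}
    (hP : IsInterpolation Ω ε u P) {ψ₀ ψ₁ ψ₂ : Plane → ℝ} {M : ℝ} (h₀ : IntegrableOn ψ₀ Ω)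
    (h₁ : Integrable ψ₁) (h₂ : Integrable ψ₂) (hM₁ : ∀ x, |ψ₁ x| ≤ M) (hM₂ : ∀ x, |ψ₂ x| ≤ M)
    (hmin : ∀ᵐ x ∂(volume.restrict Ω), ∀ v w : Circ,
      ψ₀ x + (ψ₁ x * ((zx (tensorOf v) + zx (tensorOf w)) / 2) +
        ψ₂ x * ((zy (tensorOf v) + zy (tensorOf w)) / 2)) ≤ f v w) :
    4 * (∫ x in Ω, ψ₀ x) + 4 * ((∫ x in Ω, ψ₁ x * zx (P x)) + ∫ x in Ω, ψ₂ x * zy (P x)) -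
        (8 * C + 16 * M) * tube Ω (4 * ε) -
        ∑ k, (shiftError (Ω.indicator ψ₁) (latticePoint ε (unitDir k)) +
          shiftError (Ω.indicator ψ₂) (latticePoint ε (unitDir k))) ≤
      latticeEnergy f Ω ε u := by
  set X : Plane → ℝ := fun x => zx (tensorOf (u (site ε x))) with hX
  set Y : Plane → ℝ := fun x => zy (tensorOf (u (site ε x))) with hY
  have hXm : Measurable X := measurable_comp_site ε fun i => zx (tensorOf (u i))
  have hYm : Measurable Y := measurable_comp_site ε fun i => zy (tensorOf (u i))
  have hX1 : ∀ x, |X x| ≤ 1 := fun x => abs_zx_le (tensorOf_mem _)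
  have hY1 : ∀ x, |Y x| ≤ 1 := fun x => abs_zy_le (tensorOf_mem _)
  have hA1 := abs_setIntegral_interpolation_sub_le ho hb hε hP (fun Q => abs_zx_le)
    (aestronglyMeasurable_zx P) h₁ hM₁
  have hA2 := abs_setIntegral_interpolation_sub_le ho hb hε hP (fun Q => abs_zy_le)
    (aestronglyMeasurable_zy P) h₂ hM₂
  have hi₁ := h₁.indicator ho.measurableSet
  have hi₂ := h₂.indicator ho.measurableSet
  set φ₁ := Ω.indicator ψ₁
  set φ₂ := Ω.indicator ψ₂
  have hmul : ∀ {φ Z : Plane → ℝ}, Integrable φ → Measurable Z → (∀ x, |Z x| ≤ 1) →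
      Integrable fun x => φ x * Z x := fun hφ hZ hZ1 =>
    (Integrable.bdd_mul (c := 1) hφ hZ.aestronglyMeasurable
      (Eventually.of_forall hZ1)).congr (Eventually.of_forall fun x => mul_comm _ _)
  have hk : ∀ k, (∫ x in Ω, ψ₀ x) + ((∫ x, φ₁ x * X x) + ∫ x, φ₂ x * Y x) -
      (shiftError φ₁ (latticePoint ε (unitDir k)) +
        shiftError φ₂ (latticePoint ε (unitDir k))) / 2 ≤
      ∫ x in Ω, f (u (site ε x)) (u (site ε x + unitDir k)) := by
    intro k
    set v := latticePoint ε (unitDir k)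
    have s1 := abs_le.1 (abs_integral_shift_sub_le hi₁ hXm hX1 v)
    have s2 := abs_le.1 (abs_integral_shift_sub_le hi₂ hYm hY1 v)
    have hv : Measurable fun x : Plane => x + v := measurable_add_const v
    have j1 := hmul hi₁ hXm hX1
    have j2 := hmul hi₂ hYm hY1
    have j3 := hmul hi₁ (hXm.comp hv) (fun x => hX1 _)
    have j4 := hmul hi₂ (hYm.comp hv) (fun x => hY1 _)
    simp only [Function.comp_def] at j3 j4
    have j13 : Integrable fun x => φ₁ x * X x + φ₁ x * X (x + v) := j1.add j3
    have j24 : Integrable fun x => φ₂ x * Y x + φ₂ x * Y (x + v) := j2.add j4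
    have j : Integrable fun x => ((φ₁ x * X x + φ₁ x * X (x + v)) +
      (φ₂ x * Y x + φ₂ x * Y (x + v))) / 2 := (j13.add j24).div_const 2
    have hsum : (∫ x in Ω, ψ₀ x) + ((∫ x, φ₁ x * X x) + (∫ x, φ₁ x * X (x + v)) +
        ((∫ x, φ₂ x * Y x) + ∫ x, φ₂ x * Y (x + v))) / 2 =
        ∫ x, (Ω.indicator ψ₀ x + ((φ₁ x * X x + φ₁ x * X (x + v)) +
          (φ₂ x * Y x + φ₂ x * Y (x + v))) / 2) := by
      rw [integral_add (h₀.integrable_indicator ho.measurableSet) j, integral_div,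
        integral_add j13 j24, integral_add j1 j3, integral_add j2 j4,
        integral_indicator ho.measurableSet]
    have hle : ∫ x, (Ω.indicator ψ₀ x + ((φ₁ x * X x + φ₁ x * X (x + v)) +
          (φ₂ x * Y x + φ₂ x * Y (x + v))) / 2) ≤
        ∫ x in Ω, f (u (site ε x)) (u (site ε x + unitDir k)) := by
      have hfi : IntegrableOn (fun x => f (u (site ε x)) (u (site ε x + unitDir k))) Ω :=
        integrableOn_comp_site (F := fun i => f (u i) (u (i + unitDir k)))
          (fun i => hfC _ _) hb.measure_lt_top.ne
      rw [← integral_indicator ho.measurableSet]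
      refine integral_mono_ae ((h₀.integrable_indicator ho.measurableSet).add
        j) (hfi.integrable_indicator ho.measurableSet) ?_
      filter_upwards [(ae_restrict_iff' ho.measurableSet).1 hmin] with x hx
      by_cases hxΩ : x ∈ Ω
      · have := hx hxΩ (u (site ε x)) (u (site ε x + unitDir k))
        simp only [φ₁, φ₂, indicator_of_mem hxΩ, hX, hY]
        rw [site_add_latticePoint hε]
        linarith
      · simp [φ₁, φ₂, hxΩ]
    linarith [s1.1, s2.1]
  have hE := (abs_le.1 (abs_latticeEnergy_sub_le hsymm hfC ho hb hε u)).1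
  have k0 := hk 0
  have k1 := hk 1
  simp only [integralEnergy, Fin.sum_univ_two] at hE ⊢
  have a1 := (abs_le.1 hA1).1
  have a2 := (abs_le.1 hA2).1
  linarith

/-- The lower bound: asymptotically, the energies of fields whose interpolations converge weakly*
are at least the limit energy. -/
theorem eventually_le_latticeEnergy {f : Circ → Circ → ℝ} {h g : ℝ → ℝ} {C : ℝ}
    (hf : ∀ u v : Circ, f u v = h |inner ℝ (u : Plane) (v : Plane)|)
    (hC : ∀ t ∈ Icc (0 : ℝ) 1, |h t| ≤ C) (hgc : Continuous g) (hgm : MonotoneOn g (Icc 0 1))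
    (hgx : ConvexOn ℝ (Icc 0 1) g) (hgh : ∀ t ∈ Icc (0 : ℝ) 1, g t ≤ h t)
    {Ω : Set Plane} (ho : IsOpen Ω) (hb : Bornology.IsBounded Ω) (hl : HasLipschitzBoundary Ω)
    {ε : ℕ → ℝ} (hε : ∀ n, 0 < ε n) (hε0 : Tendsto ε atTop (𝓝 0))
    {y : ℕ → LInf Ω} {Q : LInf Ω} (hy : Tendsto y atTop (@nhds _ (weakStarTopology Ω) Q))
    (hQ : ∀ᵐ x ∂(volume.restrict Ω), Q x ∈ tensorSet) {η : ℝ} (hη : 0 < η) :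
    ∀ᶠ n in atTop, ∀ u, IsInterpolation Ω (ε n) u (y n) →
      4 * (∫ x in Ω, g (modulus (Q x))) - η ≤ latticeEnergy f Ω (ε n) u := by
  have hfC : ∀ u v, |f u v| ≤ C := fun u v => by
    rw [hf]; exact hC _ (abs_inner_mem_Icc u v)
  have hsymm : ∀ u v, f u v = f v u := fun u v => by rw [hf, hf, real_inner_comm]
  have hfin : IsFiniteMeasure (volume.restrict Ω) := ⟨by simpa using hb.measure_lt_top⟩
  set V := volume.real Ω
  have hV : 0 ≤ V := measureReal_nonneg
  have hδ : 0 < η / (8 * (V + 1)) := by positivity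
  obtain ⟨p, q, M, hpm, hqm, hp, hq, hmin, happ⟩ :=
    exists_affine_minorants hgm hgx hgc.continuousOn hδ
  have hM0 : 0 ≤ M := (hp 0).1.trans (hp 0).2
  set S : Plane → ℝ := fun x => √(zx (Q x) ^ 2 + zy (Q x) ^ 2) with hS
  have hXm := (aestronglyMeasurable_zx Q).aemeasurable
  have hYm := (aestronglyMeasurable_zy Q).aemeasurable
  have hSm : AEMeasurable S (volume.restrict Ω) :=
    ((hXm.pow_const 2).add (hYm.pow_const 2)).sqrt
  have hunit : ∀ a b : ℝ, (a / √(a ^ 2 + b ^ 2)) ^ 2 + (b / √(a ^ 2 + b ^ 2)) ^ 2 ≤ 1 := by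
    intro a b
    rw [div_pow, div_pow, Real.sq_sqrt (by positivity), ← add_div]
    exact div_self_le_one _
  have hunit1 : ∀ a b : ℝ, |a / √(a ^ 2 + b ^ 2)| ≤ 1 := fun a b =>
    (sq_le_one_iff_abs_le_one _).1 (by
      have := hunit a b
      nlinarith [sq_nonneg (b / √(a ^ 2 + b ^ 2))])
  have hunit2 : ∀ a b : ℝ, |b / √(a ^ 2 + b ^ 2)| ≤ 1 := fun a b => by
    rw [add_comm]; exact hunit1 b a
  set ψ₁ : Plane → ℝ := Ω.indicator fun x => p (S x) * (zx (Q x) / S x) with hψ₁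
  set ψ₂ : Plane → ℝ := Ω.indicator fun x => p (S x) * (zy (Q x) / S x) with hψ₂
  have hb1 : ∀ x, |p (S x) * (zx (Q x) / S x)| ≤ M := fun x => by
    rw [abs_mul, abs_of_nonneg (hp _).1]
    exact (mul_le_of_le_one_right (hp _).1 (hunit1 _ _)).trans (hp _).2
  have hb2 : ∀ x, |p (S x) * (zy (Q x) / S x)| ≤ M := fun x => by
    rw [abs_mul, abs_of_nonneg (hp _).1]
    exact (mul_le_of_le_one_right (hp _).1 (hunit2 _ _)).trans (hp _).2
  have hM₁ : ∀ x, |ψ₁ x| ≤ M := fun x => by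
    by_cases hx : x ∈ Ω
    · rw [hψ₁, indicator_of_mem hx]; exact hb1 x
    · rw [hψ₁, indicator_of_notMem hx, abs_zero]; exact hM0
  have hM₂ : ∀ x, |ψ₂ x| ≤ M := fun x => by
    by_cases hx : x ∈ Ω
    · rw [hψ₂, indicator_of_mem hx]; exact hb2 x
    · rw [hψ₂, indicator_of_notMem hx, abs_zero]; exact hM0
  have hpS := hpm.comp_aemeasurable hSm
  have h₁ : Integrable ψ₁ := IntegrableOn.integrable_indicator (Integrable.of_bound
    (hpS.mul (hXm.div hSm)).aestronglyMeasurable M (Eventually.of_forall hb1)) ho.measurableSet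
  have h₂ : Integrable ψ₂ := IntegrableOn.integrable_indicator (Integrable.of_bound
    (hpS.mul (hYm.div hSm)).aestronglyMeasurable M (Eventually.of_forall hb2)) ho.measurableSet
  have h₀ : IntegrableOn (fun x => q (S x)) Ω := Integrable.of_bound
    (hqm.comp_aemeasurable hSm).aestronglyMeasurable M (Eventually.of_forall fun x => hq _)
  have hminx : ∀ᵐ x ∂(volume.restrict Ω), ∀ v w : Circ,
      q (S x) + (ψ₁ x * ((zx (tensorOf v) + zx (tensorOf w)) / 2) +
        ψ₂ x * ((zy (tensorOf v) + zy (tensorOf w)) / 2)) ≤ f v w := by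
    filter_upwards [ae_restrict_mem ho.measurableSet] with x hx v w
    rw [hψ₁, hψ₂, indicator_of_mem hx, indicator_of_mem hx, hf]
    have a1 := average_le_abs_inner v w (hunit (zx (Q x)) (zy (Q x)))
    have a2 := mul_le_mul_of_nonneg_left a1 (hp (S x)).1
    have a3 := hmin (S x) _ (abs_inner_mem_Icc v w)
    have a4 := hgh _ (abs_inner_mem_Icc v w)
    have e : ∀ a b c d e : ℝ, a * b * c + a * d * e = a * (b * c + d * e) := by intros; ring
    rw [e]
    linarith
  have hconv : Tendsto (fun n => (∫ x in Ω, ψ₁ x * zx (y n x)) + ∫ x in Ω, ψ₂ x * zy (y n x)) atTop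
      (𝓝 ((∫ x in Ω, ψ₁ x * zx (Q x)) + ∫ x in Ω, ψ₂ x * zy (Q x))) := by
    have ht := tendsto_integral_entries hy (a := fun x => 2 * ψ₁ x) (b := ψ₂)
      (c := fun _ => 0) ((h₁.const_mul 2).integrableOn) h₂.integrableOn integrableOn_zero
    have e : ∀ P : LInf Ω, (∫ x in Ω, ψ₁ x * zx (P x)) + ∫ x in Ω, ψ₂ x * zy (P x) =
        (∫ x in Ω, (2 * ψ₁ x * (P x).1 0 0 + 2 * (ψ₂ x * (P x).1 0 1) + 0 * (P x).1 1 1)) -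
          ∫ x in Ω, ψ₁ x := by
      intro P
      have i1 := integrableOn_mul_entry P (h₁.integrableOn (s := Ω)) 0 0
      have i2 := integrableOn_mul_entry P (h₂.integrableOn (s := Ω)) 0 1
      have i3 : IntegrableOn (fun x => ψ₁ x * zx (P x)) Ω :=
        ((i1.const_mul 2).sub h₁.integrableOn).congr
          (Eventually.of_forall fun x => by simp only [zx, Pi.sub_apply]; ring)
      have i4 : IntegrableOn (fun x => ψ₂ x * zy (P x)) Ω :=
        (i2.const_mul 2).congr (Eventually.of_forall fun x => by simp only [zy]; ring)
      have i5 : IntegrableOn (fun x => 2 * ψ₁ x * (P x).1 0 0 + 2 * (ψ₂ x * (P x).1 0 1) +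
          0 * (P x).1 1 1) Ω :=
        ((i1.const_mul 2).add (i2.const_mul 2)).congr
          (Eventually.of_forall fun x => by simp only [Pi.add_apply]; ring)
      rw [← integral_add i3 i4, ← integral_sub i5 h₁.integrableOn]
      refine integral_congr_ae (Eventually.of_forall fun x => ?_)
      simp only [zx, zy]
      ring
    simp only [e]
    exact ht.sub_const _
  have hlim : 4 * (∫ x in Ω, g (modulus (Q x))) - η / 2 ≤ 4 * (∫ x in Ω, q (S x)) +
      4 * ((∫ x in Ω, ψ₁ x * zx (Q x)) + ∫ x in Ω, ψ₂ x * zy (Q x)) := by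
    have i3 : IntegrableOn (fun x => ψ₁ x * zx (Q x)) Ω :=
      Integrable.of_bound (h₁.aestronglyMeasurable.restrict.mul (aestronglyMeasurable_zx Q)) M (by
        filter_upwards [hQ] with x hx
        rw [norm_mul]
        exact (mul_le_mul (hM₁ x) (abs_zx_le hx) (abs_nonneg _) hM0).trans (mul_one M).le)
    have i4 : IntegrableOn (fun x => ψ₂ x * zy (Q x)) Ω :=
      Integrable.of_bound (h₂.aestronglyMeasurable.restrict.mul (aestronglyMeasurable_zy Q)) M (by
        filter_upwards [hQ] with x hx
        rw [norm_mul]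
        exact (mul_le_mul (hM₂ x) (abs_zy_le hx) (abs_nonneg _) hM0).trans (mul_one M).le)
    obtain ⟨G, hG⟩ := isCompact_Icc.exists_bound_of_continuousOn (hgc.continuousOn (s := Icc 0 1))
    have hSQ : ∀ᵐ x ∂(volume.restrict Ω), modulus (Q x) = S x := by
      filter_upwards [hQ] with x hx using modulus_eq_sqrt ((mem_tensorSet_iff _).1 hx).1
    have i0 : IntegrableOn (fun x => g (S x)) Ω := Integrable.of_bound
      (hgc.measurable.comp_aemeasurable hSm).aestronglyMeasurable G (by
        filter_upwards [hQ, hSQ] with x hx hxs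
        exact hG _ (hxs ▸ modulus_mem_Icc hx))
    have i34 : Integrable (fun x => ψ₁ x * zx (Q x) + ψ₂ x * zy (Q x)) (volume.restrict Ω) :=
      i3.add i4
    have hle : ∫ x in Ω, (g (S x) - η / (8 * (V + 1))) ≤
        ∫ x in Ω, (q (S x) + (ψ₁ x * zx (Q x) + ψ₂ x * zy (Q x))) := by
      refine integral_mono_ae (i0.sub (integrable_const _)) (h₀.add i34) ?_
      filter_upwards [hQ, hSQ, ae_restrict_mem ho.measurableSet] with x hx hxs hxΩ
      have hmem : S x ∈ Icc (0 : ℝ) 1 := hxs ▸ modulus_mem_Icc hx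
      have e : ψ₁ x * zx (Q x) + ψ₂ x * zy (Q x) = p (S x) * S x := by
        rw [hψ₁, hψ₂, indicator_of_mem hxΩ, indicator_of_mem hxΩ]
        have hsq : S x ^ 2 = zx (Q x) ^ 2 + zy (Q x) ^ 2 := Real.sq_sqrt (by positivity)
        by_cases h0 : S x = 0
        · simp [h0]
        · field_simp
          linear_combination -(p (S x)) * hsq
      simp only [e]
      exact happ _ hmem
    rw [integral_sub i0 (integrable_const _), integral_add h₀ i34, integral_add i3 i4,
      setIntegral_const, smul_eq_mul] at hle
    have hVV : volume.real Ω * (η / (8 * (V + 1))) ≤ η / 8 := by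
      rw [← mul_div_assoc, div_le_div_iff₀ (by positivity) (by positivity)]
      change V * η * 8 ≤ _
      nlinarith
    rw [integral_congr_ae (g := fun x => g (S x)) (by
      filter_upwards [hSQ] with x hx
      rw [hx])]
    linarith
  have htube : Tendsto (fun n => (8 * C + 16 * M) * tube Ω (4 * ε n)) atTop (𝓝 0) := by
    have h4 : Tendsto (fun n => 4 * ε n) atTop (𝓝 0) := by simpa using hε0.const_mul 4
    simpa using ((tendsto_tube hb hl).comp h4).const_mul (8 * C + 16 * M)
  have hlp : ∀ k, Tendsto (fun n => latticePoint (ε n) (unitDir k)) atTop (𝓝 0) := by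
    intro k
    have e : ∀ t : ℝ, latticePoint t (unitDir k) = t • latticePoint 1 (unitDir k) := fun t => by
      ext j; simp [latticePoint]
    have ht := hε0.smul_const (latticePoint 1 (unitDir k))
    rw [zero_smul] at ht
    exact ht.congr fun n => (e _).symm
  have hsh : Tendsto (fun n => ∑ k, (shiftError (Ω.indicator ψ₁) (latticePoint (ε n) (unitDir k)) +
      shiftError (Ω.indicator ψ₂) (latticePoint (ε n) (unitDir k)))) atTop (𝓝 0) := by
    rw [show (0 : ℝ) = ∑ k : Fin 2, (0 + 0) by simp]
    refine tendsto_finsetSum _ fun k _ => Tendsto.add ?_ ?_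
    · exact (tendsto_integral_abs_translate (h₁.indicator ho.measurableSet)).comp (hlp k)
    · exact (tendsto_integral_abs_translate (h₂.indicator ho.measurableSet)).comp (hlp k)
  have htot := (((hconv.const_mul 4).const_add (4 * ∫ x in Ω, q (S x))).sub htube).sub hsh
  rw [sub_zero, sub_zero] at htot
  have hlt : 4 * (∫ x in Ω, g (modulus (Q x))) - η < 4 * (∫ x in Ω, q (S x)) +
      4 * ((∫ x in Ω, ψ₁ x * zx (Q x)) + ∫ x in Ω, ψ₂ x * zy (Q x)) := by linarith
  filter_upwards [htot.eventually (lt_mem_nhds hlt)] with n hn u hu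
  exact hn.le.trans (le_latticeEnergy hsymm hfC ho hb (hε n) hu h₀ h₁ h₂ hM₁ hM₂ hminx)

/-! ### Checkerboard patterns on mesoscopic squares -/

theorem sum_block {β : Type*} [AddCommMonoid β] (N : ℕ) (J : Fin 2 → ℤ) (F : (Fin 2 → ℤ) → β) :
    ∑ i ∈ block N J, F i = ∑ a ∈ Finset.range N, ∑ b ∈ Finset.range N,
      F ![N * J 0 + a, N * J 1 + b] := by
  rw [← Finset.sum_product' (Finset.range N) (Finset.range N)
    (fun a b : ℕ => F ![N * J 0 + a, N * J 1 + b])]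
  symm
  refine Finset.sum_bij' (fun p _ => ![N * J 0 + (p.1 : ℤ), N * J 1 + (p.2 : ℤ)])
    (fun i _ => ((i 0 - N * J 0).toNat, (i 1 - N * J 1).toNat)) ?_ ?_ ?_ ?_ ?_
  · rintro ⟨a, b⟩ h
    simp only [Finset.mem_product, Finset.mem_range] at h
    simp only [block, Fintype.mem_piFinset, Finset.mem_Ico, Fin.forall_fin_two]
    simp only [Matrix.cons_val_zero, Matrix.cons_val_one]
    omega
  · intro i h
    simp only [block, Fintype.mem_piFinset, Finset.mem_Ico, Fin.forall_fin_two] at h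
    simp only [Finset.mem_product, Finset.mem_range]
    omega
  · rintro ⟨a, b⟩ _
    simp
  · intro i h
    simp only [block, Fintype.mem_piFinset, Finset.mem_Ico, Fin.forall_fin_two] at h
    funext k
    fin_cases k
    · simp only [Fin.zero_eta, Matrix.cons_val_zero]
      omega
    · simp only [Fin.mk_one, Matrix.cons_val_one, Matrix.cons_val_zero]
      omega
  · intros
    rfl

theorem sum_range_even (c : ℤ) (m : ℕ) (A B : ℝ) :
    ∑ b ∈ Finset.range (2 * m), (if Even (c + (b : ℤ)) then A else B) = m * (A + B) := by
  induction m with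
  | zero => simp
  | succ m ih =>
    rw [show 2 * (m + 1) = 2 * m + 1 + 1 by ring, Finset.sum_range_succ, Finset.sum_range_succ, ih]
    push_cast
    by_cases h : Even c
    · have h1 : Even (c + 2 * (m : ℤ)) := h.add (even_two_mul _)
      have h2 : ¬ Even (c + (2 * (m : ℤ) + 1)) := by
        rw [← add_assoc, Int.not_even_iff_odd]; exact h1.add_one
      rw [if_pos h1, if_neg h2]
      ring
    · rw [Int.not_even_iff_odd] at h
      have h1 : Odd (c + 2 * (m : ℤ)) := h.add_even (even_two_mul _)
      have h2 : Even (c + (2 * (m : ℤ) + 1)) := by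
        rw [← add_assoc]; exact h1.add_one
      rw [if_neg (Int.not_even_iff_odd.2 h1), if_pos h2]
      ring

theorem sum_range_ite_last (N : ℕ) (hN : 0 < N) (c : ℝ) :
    ∑ b ∈ Finset.range N, (if b + 1 = N then c else 0) = c := by
  obtain ⟨M, rfl⟩ := Nat.exists_eq_succ_of_ne_zero hN.ne'
  simp

/-- A profile and a director give a pattern on a square with prescribed mean tensor, whose energy
is controlled by the cost of the profile. -/
theorem exists_pattern {f : Circ → Circ → ℝ} {h : ℝ → ℝ} {C : ℝ}
    (hf : ∀ u v : Circ, f u v = h |inner ℝ (u : Plane) (v : Plane)|)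
    (hC : ∀ t ∈ Icc (0 : ℝ) 1, |h t| ≤ C) {m : ℕ} (hm : 0 < m) (J : Fin 2 → ℤ)
    {τ : ℕ → ℝ} (hτ : ∀ r, |τ r| ≤ 1) (n : Circ) :
    ∃ U : (Fin 2 → ℤ) → Circ, ∀ u : (Fin 2 → ℤ) → Circ, (∀ i ∈ block (2 * m) J, u i = U i) →
      (∑ i ∈ block (2 * m) J, zx (tensorOf (u i)) =
        2 * m * (∑ r ∈ Finset.range (2 * m), τ r) * zx (tensorOf n)) ∧
      (∑ i ∈ block (2 * m) J, zy (tensorOf (u i)) =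
        2 * m * (∑ r ∈ Finset.range (2 * m), τ r) * zy (tensorOf n)) ∧
      ∀ k, ∑ i ∈ block (2 * m) J, f (u i) (u (i + unitDir k)) ≤
        2 * m * profileCost h (2 * C) (2 * m) τ + 2 * m * (2 * C) := by
  have hpair := fun t : {t : ℝ // |t| ≤ 1} => exists_spin_pair n t.2
  choose V W hx hy hi using hpair
  set σ : ℕ → {t : ℝ // |t| ≤ 1} := fun r => ⟨τ r, hτ r⟩ with hσ
  set N := 2 * m with hN
  have hN0 : 0 < N := by omega
  have hNr : (N : ℝ) = 2 * m := by rw [hN]; push_cast; ring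
  have hC0 : 0 ≤ C := (abs_nonneg _).trans (hC 0 ⟨le_rfl, zero_le_one⟩)
  have hhτ : ∀ r, |h (|τ r|)| ≤ C := fun r => hC _ ⟨abs_nonneg _, hτ r⟩
  have hfC : ∀ u v, f u v ≤ C := fun u v => by
    rw [hf]; exact (abs_le.1 (hC _ (abs_inner_mem_Icc u v))).2
  set r : (Fin 2 → ℤ) → ℕ := fun i => (i 0 - N * J 0).toNat with hr
  refine ⟨fun i => if Even (i 0 + i 1) then V (σ (r i)) else W (σ (r i)), fun u hu => ?_⟩
  set c : ℕ → ℤ := fun a => N * J 0 + a + N * J 1 with hc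
  have hval : ∀ a < N, ∀ b < N, u ![N * J 0 + a, N * J 1 + b] =
      if Even (c a + b) then V (σ a) else W (σ a) := by
    intro a ha b hb
    rw [hu]
    · simp only [Matrix.cons_val_zero, Matrix.cons_val_one, hr, hc, ← add_assoc]
      simp
    · simp only [block, Fintype.mem_piFinset, Finset.mem_Ico, Fin.forall_fin_two]
      simp only [Matrix.cons_val_zero, Matrix.cons_val_one]
      omega
  have hsumz : ∀ z : SymMat → ℝ, (∀ t, z (tensorOf (V t)) + z (tensorOf (W t)) =
      2 * ((t : ℝ) * z (tensorOf n))) → ∑ i ∈ block N J, z (tensorOf (u i)) =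
      2 * m * (∑ r ∈ Finset.range N, τ r) * z (tensorOf n) := by
    intro z hz
    rw [sum_block, Finset.mul_sum, Finset.sum_mul]
    refine Finset.sum_congr rfl fun a ha => ?_
    have h1 : ∀ b ∈ Finset.range N, z (tensorOf (u ![N * J 0 + a, N * J 1 + b])) =
        if Even (c a + (b : ℤ)) then z (tensorOf (V (σ a))) else z (tensorOf (W (σ a))) := by
      intro b hb
      rw [hval a (Finset.mem_range.1 ha) b (Finset.mem_range.1 hb)]
      split_ifs <;> rfl
    rw [Finset.sum_congr rfl h1, hN, sum_range_even, hz]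
    ring
  have hopp : ∀ (a b : ℕ), Even (c a + ((b + 1 : ℕ) : ℤ)) ↔ ¬ Even (c a + (b : ℤ)) := by
    intro a b
    push_cast
    rw [← add_assoc, Int.even_add_one]
  have hcsucc : ∀ (a b : ℕ), Even (c (a + 1) + (b : ℤ)) ↔ ¬ Even (c a + (b : ℤ)) := by
    intro a b
    have : c (a + 1) + (b : ℤ) = c a + b + 1 := by simp only [hc]; push_cast; ring
    rw [this, Int.even_add_one]
  have hinner : ∀ a, f (V (σ a)) (W (σ a)) = h |τ a| ∧ f (W (σ a)) (V (σ a)) = h |τ a| := by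
    intro a
    have := hi (σ a)
    exact ⟨by rw [hf, this], by rw [hf, real_inner_comm, this]⟩
  refine ⟨hsumz zx hx, hsumz zy hy, ?_⟩
  have hcost : 2 * m * profileCost h (2 * C) N τ + 2 * m * (2 * C) =
      ∑ a ∈ Finset.range N, ∑ b ∈ Finset.range N,
        ((h |τ a| + if τ a = τ (a + 1) then 0 else 2 * C) + if b + 1 = N then 2 * C else 0) := by
    simp only [Finset.sum_add_distrib, sum_range_ite_last N hN0, Finset.sum_const,
      Finset.card_range, nsmul_eq_mul, profileCost, ← hNr, mul_add, Finset.mul_sum]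
  have hcost' : 2 * m * profileCost h (2 * C) N τ + 2 * m * (2 * C) =
      ∑ a ∈ Finset.range N, ∑ b ∈ Finset.range N,
        ((h |τ a| + if τ a = τ (a + 1) then 0 else 2 * C) + if a + 1 = N then 2 * C else 0) := by
    rw [hcost]
    simp only [Finset.sum_add_distrib]
    congr 1
    exact Finset.sum_comm
  have hdir : ∀ k : Fin 2, k = 0 ∨ k = 1 := by decide
  intro k
  rcases hdir k with rfl | rfl
  · rw [hcost', sum_block]
    refine Finset.sum_le_sum fun a ha => Finset.sum_le_sum fun b hb => ?_
    have ha := Finset.mem_range.1 ha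
    have hb := Finset.mem_range.1 hb
    have hC1 := (abs_le.1 (hhτ a)).1
    by_cases hlast : a + 1 = N
    · rw [if_pos hlast]
      have := hfC (u ![N * J 0 + a, N * J 1 + b]) (u (![N * J 0 + a, N * J 1 + b] + unitDir 0))
      split_ifs <;> linarith
    · rw [if_neg hlast, add_zero]
      by_cases ht : τ a = τ (a + 1)
      · have e : ![(N : ℤ) * J 0 + a, N * J 1 + b] + unitDir 0 =
            ![(N : ℤ) * J 0 + ((a + 1 : ℕ) : ℤ), N * J 1 + b] := by
          ext j; fin_cases j <;> simp [unitDir, add_assoc]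
        have hs : σ (a + 1) = σ a := Subtype.ext ht.symm
        rw [e, hval a ha b hb, hval (a + 1) (by omega) b hb, if_pos ht, add_zero, hs]
        by_cases hp : Even (c a + (b : ℤ))
        · rw [if_pos hp, if_neg (by rw [hcsucc]; exact not_not.2 hp)]
          exact (hinner a).1.le
        · rw [if_neg hp, if_pos ((hcsucc a b).2 hp)]
          exact (hinner a).2.le
      · rw [if_neg ht]
        have := hfC (u ![N * J 0 + a, N * J 1 + b]) (u (![N * J 0 + a, N * J 1 + b] + unitDir 0))
        linarith
  · rw [hcost, sum_block]
    refine Finset.sum_le_sum fun a ha => Finset.sum_le_sum fun b hb => ?_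
    have ha := Finset.mem_range.1 ha
    have hb := Finset.mem_range.1 hb
    have hC1 := (abs_le.1 (hhτ a)).1
    have hnn : (0 : ℝ) ≤ if τ a = τ (a + 1) then 0 else 2 * C := by split_ifs <;> linarith
    by_cases hlast : b + 1 = N
    · rw [if_pos hlast]
      have := hfC (u ![N * J 0 + a, N * J 1 + b]) (u (![N * J 0 + a, N * J 1 + b] + unitDir 1))
      linarith
    · have e : ![(N : ℤ) * J 0 + a, N * J 1 + b] + unitDir 1 =
          ![(N : ℤ) * J 0 + a, N * J 1 + ((b + 1 : ℕ) : ℤ)] := by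
        ext j; fin_cases j <;> simp [unitDir, add_assoc]
      rw [e, hval a ha b hb, hval a ha (b + 1) (by omega), if_neg hlast, add_zero]
      refine le_trans (le_of_eq ?_) (le_add_of_nonneg_right hnn)
      by_cases hp : Even (c a + (b : ℤ))
      · rw [if_pos hp, if_neg (by rw [hopp]; exact not_not.2 hp)]
        exact (hinner a).1
      · rw [if_neg hp, if_pos ((hopp a b).2 hp)]
        exact (hinner a).2

theorem exists_director_of_real (a b : ℝ) :
    ∃ n : Circ, a = √(a ^ 2 + b ^ 2) * zx (tensorOf n) ∧ b = √(a ^ 2 + b ^ 2) * zy (tensorOf n) := by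
  set w : ℂ := ⟨a, b⟩ with hw
  have hn : ‖w‖ = √(a ^ 2 + b ^ 2) := Complex.norm_eq_sqrt_sq_add_sq w
  refine ⟨mkCirc (Real.cos (w.arg / 2)) (Real.sin (w.arg / 2)) (Real.cos_sq_add_sin_sq _), ?_, ?_⟩
  · rw [zx_tensorOf, mkCirc_zero, mkCirc_one, ← hn, ← Real.cos_two_mul',
      mul_div_cancel₀ _ two_ne_zero, Complex.norm_mul_cos_arg]
  · rw [zy_tensorOf, mkCirc_zero, mkCirc_one, ← hn, mul_comm (Real.cos _), ← mul_assoc 2,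
      ← Real.sin_two_mul, mul_div_cancel₀ _ two_ne_zero, Complex.norm_mul_sin_arg]

/-- Jensen's inequality for the limit density. -/
theorem average_density_le {g : ℝ → ℝ} (hgc : Continuous g) (hgm : MonotoneOn g (Icc 0 1))
    (hgx : ConvexOn ℝ (Icc 0 1) g) {D : Set Plane} (hfin : volume D ≠ ∞)
    {X Y : Plane → ℝ} (hX : IntegrableOn X D) (hY : IntegrableOn Y D)
    (hXY : ∀ᵐ x ∂(volume.restrict D), X x ^ 2 + Y x ^ 2 ≤ 1) {s : ℝ} (hs : 0 ≤ s) {n : Circ}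
    (hsX : ∫ x in D, X x = volume.real D * (s * zx (tensorOf n)))
    (hsY : ∫ x in D, Y x = volume.real D * (s * zy (tensorOf n))) (hD : 0 < volume.real D) :
    s ≤ 1 ∧ volume.real D * g s ≤ ∫ x in D, g √(X x ^ 2 + Y x ^ 2) := by
  have hn := zx_sq_add_zy_sq n
  set α := zx (tensorOf n)
  set β := zy (tensorOf n)
  have hF : IsFiniteMeasure (volume.restrict D) := ⟨by simpa using hfin.lt_top⟩
  have hdot : ∫ x in D, (α * X x + β * Y x) = volume.real D * s := by
    rw [integral_add (hX.const_mul α) (hY.const_mul β), integral_const_mul, integral_const_mul,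
      hsX, hsY]
    linear_combination volume.real D * s * hn
  have hcs : ∀ a b : ℝ, α * a + β * b ≤ √(a ^ 2 + b ^ 2) := fun a b => by
    refine Real.le_sqrt_of_sq_le ?_
    nlinarith [sq_nonneg (α * b - β * a)]
  have hidot : IntegrableOn (fun x => α * X x + β * Y x) D :=
    (hX.const_mul α).add (hY.const_mul β)
  have hs1 : s ≤ 1 := by
    have : ∫ x in D, (α * X x + β * Y x) ≤ ∫ x in D, (1 : ℝ) := by
      refine integral_mono_ae hidot (integrable_const _) ?_
      filter_upwards [hXY] with x hx
      exact (hcs _ _).trans (Real.sqrt_le_one.2 hx)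
    rw [hdot, setIntegral_const, smul_eq_mul, mul_one] at this
    exact le_of_mul_le_mul_left (by linarith) hD
  refine ⟨hs1, ?_⟩
  obtain ⟨G, hG⟩ := isCompact_Icc.exists_bound_of_continuousOn (hgc.continuousOn (s := Icc 0 1))
  have hmem : ∀ᵐ x ∂(volume.restrict D), √(X x ^ 2 + Y x ^ 2) ∈ Icc (0 : ℝ) 1 := by
    filter_upwards [hXY] with x hx using ⟨Real.sqrt_nonneg _, Real.sqrt_le_one.2 hx⟩
  have hig : IntegrableOn (fun x => g √(X x ^ 2 + Y x ^ 2)) D := Integrable.of_bound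
    (hgc.measurable.comp_aemeasurable ((hX.aemeasurable.pow_const 2).add
      (hY.aemeasurable.pow_const 2)).sqrt).aestronglyMeasurable G (by
      filter_upwards [hmem] with x hx using hG _ hx)
  refine le_of_forall_pos_le_add fun η hη => ?_
  obtain ⟨p, q, M, -, -, hp, -, hmin, happ⟩ := exists_affine_minorants hgm hgx hgc.continuousOn
    (show 0 < η / volume.real D by positivity)
  have h1 : ∫ x in D, (q s + p s * (α * X x + β * Y x)) ≤
      ∫ x in D, g √(X x ^ 2 + Y x ^ 2) := by
    refine integral_mono_ae ((integrable_const _).add (hidot.const_mul _)) hig ?_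
    filter_upwards [hmem] with x hx
    have := mul_le_mul_of_nonneg_left (hcs (X x) (Y x)) (hp s).1
    have := hmin s _ hx
    linarith
  rw [integral_add (integrable_const _) (hidot.const_mul _), integral_const_mul, hdot,
    setIntegral_const, smul_eq_mul] at h1
  have h2 := mul_le_mul_of_nonneg_left (happ s ⟨hs, hs1⟩) hD.le
  have h3 : volume.real D * (η / volume.real D) = η := mul_div_cancel₀ _ hD.ne'
  rw [mul_sub, h3] at h2
  linarith

/-! ### Recovery sequences -/

theorem volumeReal_block {ε : ℝ} (hε : 0 < ε) (N : ℕ) (J : Fin 2 → ℤ) :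
    volume.real (site ε ⁻¹' (block N J : Set (Fin 2 → ℤ))) = N ^ 2 * ε ^ 2 := by
  rw [Measure.real, volume_block hε, ENNReal.toReal_ofReal (by positivity)]

theorem integrableOn_zx {Ω : Set Plane} (hb : Bornology.IsBounded Ω) (P : LInf Ω) :
    IntegrableOn (fun x => zx (P x)) Ω :=
  ((integrableOn_entry hb P 0 0).const_mul 2).sub (integrableOn_const hb.measure_lt_top.ne)

theorem integrableOn_zy {Ω : Set Plane} (hb : Bornology.IsBounded Ω) (P : LInf Ω) :
    IntegrableOn (fun x => zy (P x)) Ω :=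
  (integrableOn_entry hb P 0 1).const_mul 2

theorem abs_setIntegral_pattern_sub_le {ε : ℝ} (hε : 0 < ε) {m : ℕ} {J : Fin 2 → ℤ} {Z : Plane → ℝ}
    (hZ : IntegrableOn Z (site ε ⁻¹' block (2 * m) J)) {F : (Fin 2 → ℤ) → ℝ} (hF : ∀ i, |F i| ≤ 1)
    {s t ζ δ : ℝ} (hζ : |ζ| ≤ 1) (hF' : ∑ i ∈ block (2 * m) J, F i = 2 * m * t * ζ)
    (hZ' : ∫ x in site ε ⁻¹' block (2 * m) J, Z x =
      (((2 * m : ℕ) : ℝ) ^ 2 * ε ^ 2) * (s * ζ))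
    (ht : |t - (2 * m : ℕ) * s| ≤ (2 * m : ℕ) * δ) :
    |∫ x in site ε ⁻¹' block (2 * m) J, (F (site ε x) - Z x)| ≤
      δ * (((2 * m : ℕ) : ℝ) ^ 2 * ε ^ 2) := by
  have hfin : volume (site ε ⁻¹' (block (2 * m) J : Set (Fin 2 → ℤ))) ≠ ∞ := by
    rw [volume_block hε]; exact ENNReal.ofReal_ne_top
  rw [integral_sub (integrableOn_comp_site hF hfin) hZ, setIntegral_comp_site hε, hF', hZ']
  have e : ε ^ 2 * (2 * m * t * ζ) - (((2 * m : ℕ) : ℝ) ^ 2 * ε ^ 2) * (s * ζ) =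
      (ε ^ 2 * (2 * m : ℕ)) * ((t - (2 * m : ℕ) * s) * ζ) := by push_cast; ring
  rw [e, abs_mul, abs_of_nonneg (by positivity), abs_mul]
  calc _ ≤ (ε ^ 2 * (2 * m : ℕ)) * ((2 * m : ℕ) * δ * 1) := by
        refine mul_le_mul_of_nonneg_left ?_ (by positivity)
        exact mul_le_mul ht hζ (abs_nonneg _) ((abs_nonneg _).trans ht)
    _ = _ := by ring

/-- A spin field on the square `S` matches `Q` on average, with almost optimal energy. -/
def IsRecoveryOn (f : Circ → Circ → ℝ) (g : ℝ → ℝ) {Ω : Set Plane} (Q : LInf Ω) (ε δ κ V : ℝ)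
    (S : Set Plane) (u : (Fin 2 → ℤ) → Circ) : Prop :=
  |∫ x in S, (zx (tensorOf (u (site ε x))) - zx (Q x))| ≤ δ * V ∧
  |∫ x in S, (zy (tensorOf (u (site ε x))) - zy (Q x))| ≤ δ * V ∧
  2 * ∑ k, ∫ x in S, f (u (site ε x)) (u (site ε x + unitDir k)) ≤
    4 * (∫ x in S, g √(zx (Q x) ^ 2 + zy (Q x) ^ 2)) + κ * V

/-- A spin pattern on one mesoscopic square, with its estimates. -/
theorem exists_isRecoveryOn_block
    {f : Circ → Circ → ℝ} {h g : ℝ → ℝ} {C : ℝ}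
    (hf : ∀ u v : Circ, f u v = h |inner ℝ (u : Plane) (v : Plane)|)
    (hC : ∀ t ∈ Icc (0 : ℝ) 1, |h t| ≤ C) (hgc : Continuous g) (hgm : MonotoneOn g (Icc 0 1))
    (hgx : ConvexOn ℝ (Icc 0 1) g) {Ω : Set Plane} (hb : Bornology.IsBounded Ω)
    {ε : ℝ} (hε : 0 < ε) {m : ℕ} (hm : 0 < m) {δ : ℝ}
    (hreal : ∀ s ∈ Icc (0 : ℝ) 1, Realizes h (2 * C) (2 * m) δ s (g s)) {Q : LInf Ω}
    (hQ : ∀ᵐ x ∂(volume.restrict Ω), Q x ∈ tensorSet)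
    {J : Fin 2 → ℤ} (hJ : site ε ⁻¹' (block (2 * m) J : Set (Fin 2 → ℤ)) ⊆ Ω) :
    ∃ U : (Fin 2 → ℤ) → Circ, ∀ u : (Fin 2 → ℤ) → Circ, (∀ i ∈ block (2 * m) J, u i = U i) →
      IsRecoveryOn f g Q ε δ (4 * δ + 4 * C / m) (((2 * m : ℕ) : ℝ) ^ 2 * ε ^ 2)
        (site ε ⁻¹' (block (2 * m) J : Set (Fin 2 → ℤ))) u := by
  have hvol := volumeReal_block hε (2 * m) J
  have hVpos : (0 : ℝ) < ((2 * m : ℕ) : ℝ) ^ 2 * ε ^ 2 := by positivity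
  have hfin : volume (site ε ⁻¹' (block (2 * m) J : Set (Fin 2 → ℤ))) ≠ ∞ := by
    rw [volume_block hε]; exact ENNReal.ofReal_ne_top
  set V := ((2 * m : ℕ) : ℝ) ^ 2 * ε ^ 2 with hV
  have hiX := (integrableOn_zx hb Q).mono_set hJ
  have hiY := (integrableOn_zy hb Q).mono_set hJ
  obtain ⟨n, hnx, hny⟩ := exists_director_of_real
    ((∫ x in site ε ⁻¹' block (2 * m) J, zx (Q x)) / V)
    ((∫ x in site ε ⁻¹' block (2 * m) J, zy (Q x)) / V)
  set s := √(((∫ x in site ε ⁻¹' block (2 * m) J, zx (Q x)) / V) ^ 2 +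
    ((∫ x in site ε ⁻¹' block (2 * m) J, zy (Q x)) / V) ^ 2) with hs
  have hs0 : 0 ≤ s := Real.sqrt_nonneg _
  clear_value s
  rw [div_eq_iff hVpos.ne', mul_comm _ V] at hnx hny
  obtain ⟨hs1, hjen⟩ := average_density_le hgc hgm hgx hfin hiX hiY (by
    filter_upwards [ae_restrict_of_ae_restrict_of_subset hJ hQ] with x hx
      using ((mem_tensorSet_iff _).1 hx).2) hs0 (n := n) (by rw [hvol, hnx])
      (by rw [hvol, hny]) (by rw [hvol]; exact hVpos)
  rw [hvol] at hjen
  obtain ⟨τ, hτ, hτs, hτc⟩ := hreal s ⟨hs0, hs1⟩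
  obtain ⟨U, hU⟩ := exists_pattern hf hC hm J hτ n
  refine ⟨U, fun u hu => ?_⟩
  obtain ⟨h1, h2, h3⟩ := hU u hu
  refine ⟨?_, ?_, ?_⟩
  · exact abs_setIntegral_pattern_sub_le hε hiX (F := fun i => zx (tensorOf (u i)))
      (fun i => abs_zx_le (tensorOf_mem _)) (abs_zx_le (tensorOf_mem n)) h1 hnx hτs
  · exact abs_setIntegral_pattern_sub_le hε hiY (F := fun i => zy (tensorOf (u i)))
      (fun i => abs_zy_le (tensorOf_mem _)) (abs_zy_le (tensorOf_mem n)) h2 hny hτs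
  · have hE : ∀ k, ∫ x in site ε ⁻¹' block (2 * m) J,
        f (u (site ε x)) (u (site ε x + unitDir k)) ≤
        ε ^ 2 * (2 * m * ((2 * m : ℕ) * (g s + δ)) + 2 * m * (2 * C)) := by
      intro k
      rw [setIntegral_comp_site hε (block (2 * m) J) (fun i => f (u i) (u (i + unitDir k)))]
      refine mul_le_mul_of_nonneg_left ((h3 k).trans ?_) (by positivity)
      have : 2 * (m : ℝ) * profileCost h (2 * C) (2 * m) τ ≤
          2 * m * ((2 * m : ℕ) * (g s + δ)) :=
        mul_le_mul_of_nonneg_left hτc (by positivity)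
      linarith
    have e0 := hE 0
    have e1 := hE 1
    rw [Fin.sum_univ_two]
    have hmr : (0 : ℝ) < m := by exact_mod_cast hm
    have e2 : 4 * (ε ^ 2 * (2 * m * ((2 * m : ℕ) * (g s + δ)) + 2 * m * (2 * C))) =
        4 * (V * g s) + (4 * δ + 4 * C / m) * V := by
      rw [hV]
      push_cast
      field_simp
      ring
    linarith

/-- The spin field of a recovery sequence, with its estimates on every mesoscopic square. -/
theorem exists_field
    {f : Circ → Circ → ℝ} {h g : ℝ → ℝ} {C : ℝ}
    (hf : ∀ u v : Circ, f u v = h |inner ℝ (u : Plane) (v : Plane)|)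
    (hC : ∀ t ∈ Icc (0 : ℝ) 1, |h t| ≤ C) (hgc : Continuous g) (hgm : MonotoneOn g (Icc 0 1))
    (hgx : ConvexOn ℝ (Icc 0 1) g) {Ω : Set Plane} (hb : Bornology.IsBounded Ω)
    {ε : ℝ} (hε : 0 < ε) {m : ℕ} (hm : 0 < m) {δ : ℝ}
    (hreal : ∀ s ∈ Icc (0 : ℝ) 1, Realizes h (2 * C) (2 * m) δ s (g s)) {Q : LInf Ω}
    (hQ : ∀ᵐ x ∂(volume.restrict Ω), Q x ∈ tensorSet) :
    ∃ u : (Fin 2 → ℤ) → Circ, ∀ J, site ε ⁻¹' (block (2 * m) J : Set (Fin 2 → ℤ)) ⊆ Ω →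
      IsRecoveryOn f g Q ε δ (4 * δ + 4 * C / m) (((2 * m : ℕ) : ℝ) ^ 2 * ε ^ 2)
        (site ε ⁻¹' (block (2 * m) J : Set (Fin 2 → ℤ))) u := by
  have key : ∀ J, ∃ U : (Fin 2 → ℤ) → Circ,
      site ε ⁻¹' (block (2 * m) J : Set (Fin 2 → ℤ)) ⊆ Ω →
      ∀ u : (Fin 2 → ℤ) → Circ, (∀ i ∈ block (2 * m) J, u i = U i) →
      IsRecoveryOn f g Q ε δ (4 * δ + 4 * C / m) (((2 * m : ℕ) : ℝ) ^ 2 * ε ^ 2)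
        (site ε ⁻¹' (block (2 * m) J : Set (Fin 2 → ℤ))) u := by
    intro J
    by_cases hJ : site ε ⁻¹' (block (2 * m) J : Set (Fin 2 → ℤ)) ⊆ Ω
    · obtain ⟨U, hU⟩ := exists_isRecoveryOn_block hf hC hgc hgm hgx hb hε hm hreal hQ hJ
      exact ⟨U, fun _ => hU⟩
    · exact ⟨fun _ => mkCirc 1 0 (by norm_num), fun h => absurd h hJ⟩
  choose U hU using key
  have hN : 0 < 2 * m := by omega
  generalize 2 * m = N at hU hN ⊢
  refine ⟨fun i => U (fun k => i k / (N : ℤ)) i, fun J hJ => hU J hJ _ fun i hi => ?_⟩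
  have e : (fun k => i k / (N : ℤ)) = J := (mem_block hN).1 hi
  exact congrArg (fun K => U K i) e

theorem integralEnergy_le {f : Circ → Circ → ℝ} {g : ℝ → ℝ} {C : ℝ}
    (hfC : ∀ u v, |f u v| ≤ C) (hgc : Continuous g) (hgC : ∀ t ∈ Icc (0 : ℝ) 1, |g t| ≤ C)
    {Ω : Set Plane} (ho : IsOpen Ω) (hb : Bornology.IsBounded Ω)
    {ε : ℝ} (hε : 0 < ε) {N : ℕ} (hN : 0 < N) {κ : ℝ} (hκ : 0 ≤ κ) {Q : LInf Ω}
    (hQ : ∀ᵐ x ∂(volume.restrict Ω), Q x ∈ tensorSet) {u : (Fin 2 → ℤ) → Circ}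
    (hu : ∀ J, site ε ⁻¹' (block N J : Set (Fin 2 → ℤ)) ⊆ Ω →
      2 * ∑ k, ∫ x in site ε ⁻¹' block N J, f (u (site ε x)) (u (site ε x + unitDir k)) ≤
        4 * (∫ x in site ε ⁻¹' block N J, g √(zx (Q x) ^ 2 + zy (Q x) ^ 2)) +
          κ * ((N : ℝ) ^ 2 * ε ^ 2)) :
    integralEnergy f Ω ε u ≤ 4 * (∫ x in Ω, g √(zx (Q x) ^ 2 + zy (Q x) ^ 2)) +
      κ * volume.real Ω + 2 * (8 * C + κ) * tube Ω (4 * (N * ε)) := by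
  have hC0 : 0 ≤ C := (abs_nonneg _).trans (hfC (u 0) (u 0))
  have hF : IsFiniteMeasure (volume.restrict Ω) := ⟨by simpa using hb.measure_lt_top⟩
  have hmem : ∀ᵐ x ∂(volume.restrict Ω), √(zx (Q x) ^ 2 + zy (Q x) ^ 2) ∈ Icc (0 : ℝ) 1 := by
    filter_upwards [hQ] with x hx
    exact ⟨Real.sqrt_nonneg _, Real.sqrt_le_one.2 ((mem_tensorSet_iff _).1 hx).2⟩
  have hig : IntegrableOn (fun x => g √(zx (Q x) ^ 2 + zy (Q x) ^ 2)) Ω := Integrable.of_bound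
    (hgc.measurable.comp_aemeasurable (((aestronglyMeasurable_zx Q).aemeasurable.pow_const 2).add
      ((aestronglyMeasurable_zy Q).aemeasurable.pow_const 2)).sqrt).aestronglyMeasurable C (by
      filter_upwards [hmem] with x hx using hgC _ hx)
  set γ : Plane → ℝ := fun x => g √(zx (Q x) ^ 2 + zy (Q x) ^ 2)
  set e : Fin 2 → Plane → ℝ := fun k x => f (u (site ε x)) (u (site ε x + unitDir k)) with he
  have hie : ∀ k, IntegrableOn (e k) Ω := fun k =>
    integrableOn_comp_site (F := fun i => f (u i) (u (i + unitDir k)))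
      (fun i => hfC _ _) hb.measure_lt_top.ne
  have hint : ∀ D ⊆ Ω, ∫ x in D, (2 * (e 0 x + e 1 x) - 4 * γ x - κ) =
      2 * ((∫ x in D, e 0 x) + ∫ x in D, e 1 x) - 4 * (∫ x in D, γ x) - κ * volume.real D := by
    intro D hD
    have hDf : volume D ≠ ∞ := ((measure_mono hD).trans_lt hb.measure_lt_top).ne
    have i0 := (hie 0).mono_set hD
    have i1 := (hie 1).mono_set hD
    have ig := hig.mono_set hD
    have i01 : IntegrableOn (fun x => 2 * (e 0 x + e 1 x)) D := (i0.add i1).const_mul 2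
    have i2 : IntegrableOn (fun x => 2 * (e 0 x + e 1 x) - 4 * γ x) D :=
      i01.sub (ig.const_mul 4)
    rw [integral_sub i2 (integrableOn_const hDf), integral_sub i01 (ig.const_mul 4),
      integral_const_mul, integral_const_mul, integral_add i0 i1, setIntegral_const, smul_eq_mul]
    ring
  have hmain := setIntegral_le_of_block hε hN ho hb
    (w := fun x => 2 * (e 0 x + e 1 x) - 4 * γ x - κ) (C := 8 * C + κ)
    (((((hie 0).add (hie 1)).const_mul 2).sub (hig.const_mul 4)).sub
      (integrableOn_const hb.measure_lt_top.ne)) (by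
      filter_upwards [(ae_restrict_iff' ho.measurableSet).1 hmem] with x hx hxΩ
      have a0 := abs_le.1 (hfC (u (site ε x)) (u (site ε x + unitDir 0)))
      have a1 := abs_le.1 (hfC (u (site ε x)) (u (site ε x + unitDir 1)))
      have a2 := abs_le.1 (hgC _ (hx hxΩ))
      simp only [he, γ]
      rw [abs_le]
      constructor <;> linarith [a0.1, a0.2, a1.1, a1.2, a2.1, a2.2]) (by positivity) (by
      intro J hJ
      have h1 := hu J hJ
      rw [Fin.sum_univ_two] at h1
      rw [hint _ hJ, volumeReal_block hε]
      simp only [he, γ]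
      linarith)
  rw [hint _ subset_rfl] at hmain
  rw [integralEnergy, Fin.sum_univ_two]
  simp only [he] at hmain
  linarith

theorem setIntegral_mul_le_of_block {Ω : Set Plane} (ho : IsOpen Ω) (hb : Bornology.IsBounded Ω)
    {ε : ℝ} (hε : 0 < ε) {N : ℕ} (hN : 0 < N) {δ : ℝ} (hδ : 0 ≤ δ) {W : Plane → ℝ}
    (hW : IntegrableOn W Ω) (hW2 : ∀ᵐ x ∂(volume.restrict Ω), |W x| ≤ 2)
    (hu : ∀ J, site ε ⁻¹' (block N J : Set (Fin 2 → ℤ)) ⊆ Ω →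
      |∫ x in site ε ⁻¹' block N J, W x| ≤ δ * ((N : ℝ) ^ 2 * ε ^ 2))
    {ψ : Plane → ℝ} (hψ : Continuous ψ) {M ω : ℝ} (hM : ∀ x, |ψ x| ≤ M) (hω0 : 0 ≤ ω)
    (hω : ∀ x y, dist x y ≤ 4 * (N * ε) → |ψ x - ψ y| ≤ ω) :
    ∫ x in Ω, ψ x * W x ≤ (M * δ + 2 * ω) * volume.real Ω +
      2 * (2 * M + (M * δ + 2 * ω)) * tube Ω (4 * (N * ε)) := by
  have hM0 : 0 ≤ M := (abs_nonneg _).trans (hM 0)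
  set κ := M * δ + 2 * ω with hκ
  have hκ0 : 0 ≤ κ := by positivity
  have hi : IntegrableOn (fun x => ψ x * W x) Ω :=
    Integrable.bdd_mul (c := M) hW hψ.aestronglyMeasurable (Eventually.of_forall hM)
  have hint : ∀ D ⊆ Ω, ∫ x in D, (ψ x * W x - κ) =
      (∫ x in D, ψ x * W x) - κ * volume.real D := by
    intro D hD
    have hDf : volume D ≠ ∞ := ((measure_mono hD).trans_lt hb.measure_lt_top).ne
    rw [integral_sub (hi.mono_set hD) (integrableOn_const hDf), setIntegral_const, smul_eq_mul,
      mul_comm κ]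
  have hmain := setIntegral_le_of_block hε hN ho hb (w := fun x => ψ x * W x - κ)
    (C := 2 * M + κ) (hi.sub (integrableOn_const hb.measure_lt_top.ne)) (by
      filter_upwards [(ae_restrict_iff' ho.measurableSet).1 hW2] with x hx hxΩ
      have h1 : |ψ x * W x| ≤ M * 2 := by
        rw [abs_mul]
        exact mul_le_mul (hM x) (hx hxΩ) (abs_nonneg _) hM0
      have h2 := abs_le.1 h1
      rw [abs_le]
      constructor <;> linarith [h2.1, h2.2]) (by positivity) (by
      intro J hJ
      rw [hint _ hJ, volumeReal_block hε]
      set D : Set Plane := site ε ⁻¹' (block N J : Set (Fin 2 → ℤ)) with hD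
      have hDm : MeasurableSet D := measurableSet_site ε _
      have hDf : volume D ≠ ∞ := ((measure_mono hJ).trans_lt hb.measure_lt_top).ne
      have hDv : volume.real D = (N : ℝ) ^ 2 * ε ^ 2 := volumeReal_block hε N J
      have hne : D.Nonempty := by
        by_contra hcon
        rw [not_nonempty_iff_eq_empty] at hcon
        rw [hcon, measureReal_empty] at hDv
        have : (0 : ℝ) < (N : ℝ) ^ 2 * ε ^ 2 := by positivity
        linarith
      obtain ⟨x₀, hx₀⟩ := hne
      have hWD := hW.mono_set hJ
      have e1 : ∫ x in D, ψ x * W x = ψ x₀ * (∫ x in D, W x) +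
          ∫ x in D, (ψ x - ψ x₀) * W x := by
        rw [← integral_const_mul, ← integral_add (hWD.const_mul _)]
        · refine integral_congr_ae (Eventually.of_forall fun x => ?_)
          simp only
          ring
        · refine ((hi.mono_set hJ).sub (hWD.const_mul (ψ x₀))).congr
            (Eventually.of_forall fun x => ?_)
          simp only [Pi.sub_apply]
          ring
      have b1 : ψ x₀ * (∫ x in D, W x) ≤ M * (δ * ((N : ℝ) ^ 2 * ε ^ 2)) := by
        refine (le_abs_self _).trans ?_
        rw [abs_mul]
        exact mul_le_mul (hM x₀) (hu J hJ) (abs_nonneg _) hM0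
      have b2 : ∫ x in D, (ψ x - ψ x₀) * W x ≤ (ω * 2) * volume.real D := by
        refine (le_abs_self _).trans ?_
        rw [← Real.norm_eq_abs]
        refine norm_setIntegral_le_of_norm_le_const_ae' (f := fun x => (ψ x - ψ x₀) * W x)
          hDf.lt_top ?_
        filter_upwards [(ae_restrict_iff' ho.measurableSet).1 hW2] with x hx hxD
        rw [norm_mul]
        refine mul_le_mul (hω _ _ ?_) (hx (hJ hxD)) (abs_nonneg _) hω0
        exact abs_sub_le_of_mem_block hε hN (Finset.mem_coe.1 hxD) (Finset.mem_coe.1 hx₀)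
      rw [hDv] at b2
      have e3 : κ * ((N : ℝ) ^ 2 * ε ^ 2) =
          M * (δ * ((N : ℝ) ^ 2 * ε ^ 2)) + ω * 2 * ((N : ℝ) ^ 2 * ε ^ 2) := by rw [hκ]; ring
      linarith)
  rw [hint _ subset_rfl] at hmain
  linarith

/-- To test weak convergence to zero of bounded functions, continuous functions with compact support
suffice. -/
theorem tendsto_setIntegral_mul_zero_of_continuous {Ω : Set Plane} (ho : IsOpen Ω)
    {W : ℕ → Plane → ℝ} (hWm : ∀ n, AEStronglyMeasurable (W n) (volume.restrict Ω))
    (hW2 : ∀ n, ∀ᵐ x ∂(volume.restrict Ω), |W n x| ≤ 2)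
    (H : ∀ ψ : Plane → ℝ, Continuous ψ → HasCompactSupport ψ →
      Tendsto (fun n => ∫ x in Ω, ψ x * W n x) atTop (𝓝 0))
    {ψ : Plane → ℝ} (hψ : IntegrableOn ψ Ω) :
    Tendsto (fun n => ∫ x in Ω, ψ x * W n x) atTop (𝓝 0) := by
  refine Metric.tendsto_atTop'.2 fun η hη => ?_
  obtain ⟨φ, hφs, hφ, hφc, hφi⟩ := (hψ.integrable_indicator
    ho.measurableSet).exists_hasCompactSupport_integral_sub_le (show 0 < η / 4 by linarith)
  obtain ⟨n₀, hn₀⟩ := Metric.tendsto_atTop'.1 (H φ hφc hφs) (η / 2) (by linarith)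
  refine ⟨n₀, fun n hn => ?_⟩
  have h1 := hn₀ n hn
  rw [Real.dist_eq, sub_zero] at h1 ⊢
  have hmul : ∀ {χ : Plane → ℝ}, IntegrableOn χ Ω → IntegrableOn (fun x => χ x * W n x) Ω :=
    fun hχ => (Integrable.bdd_mul (c := 2) hχ (hWm n) (hW2 n)).congr
      (Eventually.of_forall fun x => mul_comm _ _)
  have hdiff : |(∫ x in Ω, ψ x * W n x) - ∫ x in Ω, φ x * W n x| ≤ 2 * (η / 4) := by
    rw [← integral_sub (hmul hψ) (hmul hφi.integrableOn), ← Real.norm_eq_abs]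
    have hsub : IntegrableOn (fun x => ‖ψ x - φ x‖) Ω := (hψ.sub hφi.integrableOn).norm
    refine (norm_integral_le_of_norm_le (hsub.const_mul 2) ?_).trans ?_
    · filter_upwards [hW2 n] with x hx
      rw [← sub_mul, norm_mul, mul_comm]
      exact mul_le_mul_of_nonneg_right hx (norm_nonneg _)
    · rw [integral_const_mul]
      refine mul_le_mul_of_nonneg_left (le_trans ?_ hφ) (by norm_num)
      rw [← integral_indicator ho.measurableSet]
      have hsub' : Integrable (fun x => ‖Ω.indicator ψ x - φ x‖) :=
        ((hψ.integrable_indicator ho.measurableSet).sub hφi).norm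
      refine integral_mono (hsub.integrable_indicator ho.measurableSet) hsub' fun x => ?_
      by_cases hx : x ∈ Ω <;> simp [hx]
  have := abs_sub_abs_le_abs_sub (∫ x in Ω, ψ x * W n x) (∫ x in Ω, φ x * W n x)
  linarith

theorem tendsto_setIntegral_mul_zero_of_block {Ω : Set Plane} (ho : IsOpen Ω)
    (hb : Bornology.IsBounded Ω) (hl : HasLipschitzBoundary Ω) {ε : ℕ → ℝ} (hε : ∀ n, 0 < ε n)
    {N : ℕ → ℕ} (hN : ∀ n, 0 < N n) (hNε : Tendsto (fun n => (N n : ℝ) * ε n) atTop (𝓝 0))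
    {δ : ℕ → ℝ} (hδ : ∀ n, 0 ≤ δ n) (hδ0 : Tendsto δ atTop (𝓝 0)) {W : ℕ → Plane → ℝ}
    (hW : ∀ n, IntegrableOn (W n) Ω) (hW2 : ∀ n, ∀ᵐ x ∂(volume.restrict Ω), |W n x| ≤ 2)
    (hu : ∀ n J, site (ε n) ⁻¹' (block (N n) J : Set (Fin 2 → ℤ)) ⊆ Ω →
      |∫ x in site (ε n) ⁻¹' block (N n) J, W n x| ≤ δ n * ((N n : ℝ) ^ 2 * ε n ^ 2))
    {ψ : Plane → ℝ} (hψ : IntegrableOn ψ Ω) :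
    Tendsto (fun n => ∫ x in Ω, ψ x * W n x) atTop (𝓝 0) := by
  refine tendsto_setIntegral_mul_zero_of_continuous ho (fun n => (hW n).aestronglyMeasurable) hW2
    (fun ψ hψc hψs => ?_) hψ
  have huc := hψc.uniformContinuous_of_tendsto_cocompact hψs.is_zero_at_infty
  obtain ⟨M, hM⟩ := hψs.exists_bound_of_continuous hψc
  have h4 : Tendsto (fun n => 4 * ((N n : ℝ) * ε n)) atTop (𝓝 0) := by
    simpa using hNε.const_mul 4
  refine Metric.tendsto_atTop.2 fun η hη => ?_
  have hV : 0 ≤ volume.real Ω := measureReal_nonneg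
  set ω := η / (8 * (volume.real Ω + 1)) with hω
  have hω0 : 0 < ω := by positivity
  obtain ⟨ρ, hρ, hρ'⟩ := Metric.uniformContinuous_iff.1 huc ω hω0
  have hlim : Tendsto (fun n => (M * δ n + 2 * ω) * volume.real Ω +
      2 * (2 * M + (M * δ n + 2 * ω)) * tube Ω (4 * (N n * ε n))) atTop
      (𝓝 ((M * 0 + 2 * ω) * volume.real Ω + 2 * (2 * M + (M * 0 + 2 * ω)) * 0)) := by
    have ht := (tendsto_tube hb hl).comp h4
    have hk := (hδ0.const_mul M).add_const (2 * ω)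
    exact (hk.mul_const _).add (((hk.const_add (2 * M)).const_mul 2).mul ht)
  have hlt : (M * 0 + 2 * ω) * volume.real Ω + 2 * (2 * M + (M * 0 + 2 * ω)) * 0 < η := by
    have : 2 * ω * volume.real Ω ≤ η / 4 := by
      rw [hω, ← mul_div_assoc, div_mul_eq_mul_div, div_le_div_iff₀ (by positivity) (by positivity)]
      nlinarith
    linarith
  obtain ⟨n₀, hn₀⟩ := eventually_atTop.1 ((hlim.eventually (gt_mem_nhds hlt)).and
    (h4.eventually (gt_mem_nhds hρ)))
  refine ⟨n₀, fun n hn => ?_⟩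
  obtain ⟨a1, a2⟩ := hn₀ n hn
  have hosc : ∀ x y, dist x y ≤ 4 * (N n * ε n) → |ψ x - ψ y| ≤ ω := fun x y hxy =>
    (hρ' (hxy.trans_lt a2)).le
  have b1 := setIntegral_mul_le_of_block ho hb (hε n) (hN n) (hδ n) (hW n) (hW2 n) (hu n) hψc hM
    hω0.le hosc
  have b2 := setIntegral_mul_le_of_block ho hb (hε n) (hN n) (hδ n) (hW n) (hW2 n) (hu n)
    hψc.neg (M := M) (by simpa using hM) hω0.le (fun x y hxy => by
      have := hosc y x (by rwa [dist_comm])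
      rwa [Pi.neg_apply, Pi.neg_apply, neg_sub_neg])
  simp only [Pi.neg_apply, neg_mul, integral_neg] at b2
  rw [Real.dist_eq, sub_zero, abs_lt]
  constructor <;> linarith

/-- Weak* convergence of `K`-valued maps can be tested on the two scalar coordinates. -/
theorem tendsto_weakStar_of_coordinates {Ω : Set Plane} {y : ℕ → LInf Ω} {Q : LInf Ω}
    (hy : ∀ n, ∀ᵐ x ∂(volume.restrict Ω), y n x ∈ tensorSet)
    (hQ : ∀ᵐ x ∂(volume.restrict Ω), Q x ∈ tensorSet)
    (hx : ∀ ψ : Plane → ℝ, IntegrableOn ψ Ω →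
      Tendsto (fun n => ∫ x in Ω, ψ x * (zx (y n x) - zx (Q x))) atTop (𝓝 0))
    (hz : ∀ ψ : Plane → ℝ, IntegrableOn ψ Ω →
      Tendsto (fun n => ∫ x in Ω, ψ x * (zy (y n x) - zy (Q x))) atTop (𝓝 0)) :
    Tendsto y atTop (@nhds _ (weakStarTopology Ω) Q) := by
  rw [tendsto_weakStar_iff]
  intro φ
  have i0 := integrable_entry φ 0 0
  have i1 := integrable_entry φ 0 1
  have i2 := integrable_entry φ 1 1
  have i02 : IntegrableOn (fun x => ((φ x).1 0 0 - (φ x).1 1 1) / 2) Ω := (i0.sub i2).div_const 2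
  have hmul : ∀ {P : LInf Ω}, (∀ᵐ x ∂(volume.restrict Ω), P x ∈ tensorSet) →
      ∀ {ψ : Plane → ℝ}, IntegrableOn ψ Ω → IntegrableOn (fun x => ψ x * zx (P x)) Ω ∧
        IntegrableOn (fun x => ψ x * zy (P x)) Ω := by
    intro P hP ψ hψ
    constructor
    · exact (Integrable.bdd_mul (c := 1) hψ (aestronglyMeasurable_zx P) (by
        filter_upwards [hP] with x hx using abs_zx_le hx)).congr
        (Eventually.of_forall fun x => mul_comm _ _)
    · exact (Integrable.bdd_mul (c := 1) hψ (aestronglyMeasurable_zy P) (by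
        filter_upwards [hP] with x hx using abs_zy_le hx)).congr
        (Eventually.of_forall fun x => mul_comm _ _)
  have hform : ∀ {P : LInf Ω}, (∀ᵐ x ∂(volume.restrict Ω), P x ∈ tensorSet) →
      ∫ x in Ω, frobInner (φ x) (P x) = (∫ x in Ω, ((φ x).1 0 0 + (φ x).1 1 1) / 2) +
        ((∫ x in Ω, ((φ x).1 0 0 - (φ x).1 1 1) / 2 * zx (P x)) +
          ∫ x in Ω, (φ x).1 0 1 * zy (P x)) := by
    intro P hP
    have j1 := (hmul hP i02).1
    have j2 := (hmul hP i1).2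
    have j12 : IntegrableOn (fun x => ((φ x).1 0 0 - (φ x).1 1 1) / 2 * zx (P x) +
        (φ x).1 0 1 * zy (P x)) Ω := j1.add j2
    have j0 : IntegrableOn (fun x => ((φ x).1 0 0 + (φ x).1 1 1) / 2) Ω := (i0.add i2).div_const 2
    rw [← integral_add j1 j2, ← integral_add j0 j12]
    refine integral_congr_ae ?_
    filter_upwards [hP] with x hx
    obtain ⟨e0, e1, -, e2⟩ := entry_eq hx
    rw [frobInner_eq, e0, e1, e2]
    ring
  rw [hform hQ]
  refine Tendsto.congr (fun n => (hform (hy n)).symm) (Tendsto.const_add _ ?_)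
  refine Tendsto.add ?_ ?_
  · refine tendsto_sub_nhds_zero_iff.1 ((hx _ i02).congr fun n => ?_)
    rw [← integral_sub (hmul (hy n) i02).1 (hmul hQ i02).1]
    simp only [mul_sub]
  · refine tendsto_sub_nhds_zero_iff.1 ((hz _ i1).congr fun n => ?_)
    rw [← integral_sub (hmul (hy n) i1).2 (hmul hQ i1).2]
    simp only [mul_sub]

/-- The upper bound: existence of recovery sequences. -/
theorem exists_recovery {f : Circ → Circ → ℝ} {h g : ℝ → ℝ} {C : ℝ}
    (hf : ∀ u v : Circ, f u v = h |inner ℝ (u : Plane) (v : Plane)|)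
    (hC : ∀ t ∈ Icc (0 : ℝ) 1, |h t| ≤ C) (hgc : Continuous g) (hgm : MonotoneOn g (Icc 0 1))
    (hgx : ConvexOn ℝ (Icc 0 1) g) (hgC : ∀ t ∈ Icc (0 : ℝ) 1, |g t| ≤ C)
    (hle : ∀ φ ∈ monotoneMinorants h, ∀ t ∈ Icc (0 : ℝ) 1, φ t ≤ g t)
    {Ω : Set Plane} (ho : IsOpen Ω) (hb : Bornology.IsBounded Ω) (hl : HasLipschitzBoundary Ω)
    {ε : ℕ → ℝ} (hε : ∀ n, 0 < ε n) (hε0 : Tendsto ε atTop (𝓝 0)) {Q : LInf Ω}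
    (hQ : ∀ᵐ x ∂(volume.restrict Ω), Q x ∈ tensorSet) :
    ∃ (y : ℕ → LInf Ω) (u : ℕ → (Fin 2 → ℤ) → Circ) (r : ℕ → ℝ),
      Tendsto y atTop (@nhds _ (weakStarTopology Ω) Q) ∧
      (∀ n, IsInterpolation Ω (ε n) (u n) (y n)) ∧ Tendsto r atTop (𝓝 0) ∧
      ∀ n, latticeEnergy f Ω (ε n) (u n) ≤ 4 * (∫ x in Ω, g (modulus (Q x))) + r n := by
  have hC0 : 0 ≤ C := (abs_nonneg _).trans (hC 0 ⟨le_rfl, zero_le_one⟩)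
  have hfC : ∀ u v, |f u v| ≤ C := fun u v => by
    rw [hf]; exact hC _ (abs_inner_mem_Icc u v)
  have hsymm : ∀ u v, f u v = f v u := fun u v => by rw [hf, hf, real_inner_comm]
  obtain ⟨δ, hδ0, hδ⟩ := exists_realizes (B := 2 * C) (by positivity) hC
    (g := g) (hgc.lowerSemicontinuous.lowerSemicontinuousOn _) hle hgC
  set m : ℕ → ℕ := fun n => ⌊(√(ε n))⁻¹⌋₊ + 1 with hm
  have hm0 : ∀ n, 0 < m n := fun n => Nat.succ_pos _
  have hsq0 : Tendsto (fun n => √(ε n)) atTop (𝓝 0) := by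
    have := (Real.continuous_sqrt.tendsto 0).comp hε0
    rw [Real.sqrt_zero] at this
    exact this
  have hmtop : Tendsto m atTop atTop := by
    refine tendsto_atTop_mono (fun n => Nat.le_succ _) (tendsto_nat_floor_atTop.comp ?_)
    refine tendsto_inv_nhdsGT_zero.comp (tendsto_nhdsWithin_iff.2 ⟨hsq0, ?_⟩)
    exact Eventually.of_forall fun n => Real.sqrt_pos.2 (hε n)
  have hmε : Tendsto (fun n => ((2 * m n : ℕ) : ℝ) * ε n) atTop (𝓝 0) := by
    have hlim : Tendsto (fun n => 2 * (√(ε n) + ε n)) atTop (𝓝 0) := by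
      simpa using (hsq0.add hε0).const_mul 2
    refine squeeze_zero (fun n => mul_nonneg (Nat.cast_nonneg _) (hε n).le) (fun n => ?_) hlim
    have hs := Real.sqrt_pos.2 (hε n)
    have h1 : (m n : ℝ) ≤ (√(ε n))⁻¹ + 1 := by
      simp only [hm]
      push_cast
      linarith [Nat.floor_le (inv_nonneg.2 hs.le)]
    have h2 := mul_le_mul_of_nonneg_right h1 (hε n).le
    have h3 : (√(ε n))⁻¹ * ε n = √(ε n) := by
      rw [inv_mul_eq_div, Real.div_sqrt]
    push_cast
    nlinarith
  have hδm : Tendsto (fun n => δ (2 * m n)) atTop (𝓝 0) :=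
    hδ0.comp (tendsto_atTop_mono (fun n => by omega) hmtop)
  have hfield := fun n => exists_field hf hC hgc hgm hgx hb (hε n) (hm0 n)
    (hδ (2 * m n)).2 hQ
  choose u hu using hfield
  have hinterp := fun n => exists_interpolation Ω (ε n) (u n)
  choose y hy using hinterp
  have hyK : ∀ n, ∀ᵐ x ∂(volume.restrict Ω), y n x ∈ tensorSet := fun n => by
    filter_upwards [hy n] with x hx
    rw [hx]
    exact tensorOf_mem _
  have hN : ∀ n, 0 < 2 * m n := fun n => by have := hm0 n; omega
  have hweak : ∀ z : SymMat → ℝ, (∀ P ∈ tensorSet, |z P| ≤ 1) →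
      (∀ P : LInf Ω, IntegrableOn (fun x => z (P x)) Ω) →
      (∀ n J, site (ε n) ⁻¹' (block (2 * m n) J : Set (Fin 2 → ℤ)) ⊆ Ω →
        |∫ x in site (ε n) ⁻¹' block (2 * m n) J,
          (z (tensorOf (u n (site (ε n) x))) - z (Q x))| ≤
          δ (2 * m n) * (((2 * m n : ℕ) : ℝ) ^ 2 * ε n ^ 2)) →
      ∀ ψ : Plane → ℝ, IntegrableOn ψ Ω →
        Tendsto (fun n => ∫ x in Ω, ψ x * (z (y n x) - z (Q x))) atTop (𝓝 0) := by
    intro z hz hzi hzJ ψ hψ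
    refine tendsto_setIntegral_mul_zero_of_block ho hb hl hε hN hmε (fun n => (hδ _).1) hδm
      (W := fun n x => z (y n x) - z (Q x)) (fun n => (hzi _).sub (hzi _)) (fun n => ?_)
      (fun n J hJ => ?_) hψ
    · filter_upwards [hyK n, hQ] with x h1 h2
      have := abs_sub (z (y n x)) (z (Q x))
      linarith [hz _ h1, hz _ h2]
    · have e : ∫ x in site (ε n) ⁻¹' block (2 * m n) J, (z (y n x) - z (Q x)) =
          ∫ x in site (ε n) ⁻¹' block (2 * m n) J,
            (z (tensorOf (u n (site (ε n) x))) - z (Q x)) := by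
        refine integral_congr_ae ?_
        filter_upwards [ae_restrict_of_ae_restrict_of_subset hJ (hy n)] with x hx
        rw [hx]
      rw [e]
      exact hzJ n J hJ
  have hIQ : ∫ x in Ω, g √(zx (Q x) ^ 2 + zy (Q x) ^ 2) = ∫ x in Ω, g (modulus (Q x)) := by
    refine integral_congr_ae ?_
    filter_upwards [hQ] with x hx
    rw [modulus_eq_sqrt ((mem_tensorSet_iff _).1 hx).1]
  set κ : ℕ → ℝ := fun n => 4 * δ (2 * m n) + 4 * C / m n with hκ
  have hκ0 : Tendsto κ atTop (𝓝 0) := by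
    have h1 : Tendsto (fun n => 4 * C / (m n : ℝ)) atTop (𝓝 0) :=
      Tendsto.div_atTop tendsto_const_nhds (tendsto_natCast_atTop_atTop.comp hmtop)
    simpa using (hδm.const_mul 4).add h1
  have hκn : ∀ n, 0 ≤ κ n := fun n => by
    have := (hδ (2 * m n)).1
    positivity
  refine ⟨y, u, fun n => κ n * volume.real Ω + 2 * (8 * C + κ n) *
    tube Ω (4 * (((2 * m n : ℕ) : ℝ) * ε n)) + 8 * C * tube Ω (4 * ε n), ?_, ?_, ?_, ?_⟩
  · exact tendsto_weakStar_of_coordinates hyK hQ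
      (hweak zx (fun P => abs_zx_le) (integrableOn_zx hb) fun n J hJ => (hu n J hJ).1)
      (hweak zy (fun P => abs_zy_le) (integrableOn_zy hb) fun n J hJ => (hu n J hJ).2.1)
  · intro n
    refine ⟨hyK n, fun i hi => ?_⟩
    filter_upwards [hy n] with x hx hxc
    rw [hx, (mem_cell_iff (hε n) i x).1 hxc]
  · have t1 : Tendsto (fun n => tube Ω (4 * (((2 * m n : ℕ) : ℝ) * ε n))) atTop (𝓝 0) :=
      (tendsto_tube hb hl).comp (by simpa using hmε.const_mul 4)
    have t2 : Tendsto (fun n => tube Ω (4 * ε n)) atTop (𝓝 0) :=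
      (tendsto_tube hb hl).comp (by simpa using hε0.const_mul 4)
    have := ((hκ0.mul_const (volume.real Ω)).add
      (((hκ0.const_add (8 * C)).const_mul 2).mul t1)).add (t2.const_mul (8 * C))
    simpa using this
  · intro n
    have e1 := (abs_le.1 (abs_latticeEnergy_sub_le hsymm hfC ho hb (hε n) (u n))).2
    have e2 := integralEnergy_le hfC hgc hgC ho hb (hε n) (hN n) (hκn n) hQ
      (fun J hJ => (hu n J hJ).2.2)
    rw [hIQ] at e2
    linarith

/-- `Γ`-convergence of the lattice energies. -/
theorem gammaConverges_discreteFunctional {Ω : Set Plane} (ho : IsOpen Ω)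
    (hb : Bornology.IsBounded Ω) (hl : HasLipschitzBoundary Ω) {h : ℝ → ℝ} {C : ℝ}
    (hC : ∀ t ∈ Icc (0 : ℝ) 1, |h t| ≤ C) {f : Circ → Circ → ℝ}
    (hf : ∀ u v : Circ, f u v = h |inner ℝ (u : Plane) (v : Plane)|) :
    GammaConverges (weakStarTopology Ω) (discreteFunctional f Ω) (limitFunctional h Ω) := by
  obtain ⟨⟨hm, hx, hlsc, hle⟩, hlargest⟩ := monotoneEnvelope_isLargest h
    ⟨-C, fun t ht => (abs_le.1 (hC t ht)).1⟩
  have hcont := continuousOn_of_monotone_convex hm hx hlsc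
  set g : ℝ → ℝ := IccExtend (zero_le_one (α := ℝ)) (domRestrict (Icc 0 1) (monotoneEnvelope h))
    with hg
  have hgeq : EqOn g (monotoneEnvelope h) (Icc 0 1) := fun t ht => by
    rw [hg, IccExtend_of_mem _ _ ht, domRestrict_apply]
  have hgc : Continuous g := (continuousOn_iff_continuous_domRestrict.1 hcont).Icc_extend'
  have hgm : MonotoneOn g (Icc 0 1) := hm.congr hgeq.symm
  have hgx : ConvexOn ℝ (Icc 0 1) g := hx.congr hgeq.symm
  have hgh : ∀ t ∈ Icc (0 : ℝ) 1, g t ≤ h t := fun t ht => (hgeq ht).le.trans (hle t ht)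
  have hglarge : ∀ φ ∈ monotoneMinorants h, ∀ t ∈ Icc (0 : ℝ) 1, φ t ≤ g t := fun φ hφ t ht =>
    (hlargest φ hφ t ht).trans (hgeq ht).ge
  have hgC : ∀ t ∈ Icc (0 : ℝ) 1, |g t| ≤ C := fun t ht => abs_le.2
    ⟨hglarge (fun _ => -C) ⟨monotoneOn_const, convexOn_const _ (convex_Icc 0 1),
      lowerSemicontinuousOn_const, fun s hs => (abs_le.1 (hC s hs)).1⟩ t ht,
      (hgh t ht).trans (abs_le.1 (hC t ht)).2⟩
  have hlimit : ∀ Q : LInf Ω, (∀ᵐ x ∂(volume.restrict Ω), Q x ∈ tensorSet) →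
      limitFunctional h Ω Q = ((4 * ∫ x in Ω, g (modulus (Q x)) : ℝ) : EReal) := by
    intro Q hQ
    rw [limitFunctional, if_pos hQ]
    congr 2
    refine integral_congr_ae ?_
    filter_upwards [hQ] with x hx
    exact (hgeq (modulus_mem_Icc hx)).symm
  intro ε hε hε0 Q
  refine ⟨fun y hy => ?_, ?_⟩
  · by_cases hfreq : ∃ᶠ n in atTop, ∀ᵐ x ∂(volume.restrict Ω), y n x ∈ tensorSet
    · have hQ := ae_mem_tensorSet_of_frequently hb hy hfreq
      rw [hlimit Q hQ]
      by_contra hcon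
      obtain ⟨r, hr1, hr2⟩ := EReal.lt_iff_exists_real_btwn.1 (not_le.1 hcon)
      have hr2' := EReal.coe_lt_coe_iff.1 hr2
      refine absurd hr1 (not_lt.2 (le_liminf_of_le (by isBoundedDefault) ?_))
      filter_upwards [eventually_le_latticeEnergy hf hC hgc hgm hgx hgh ho hb hl hε hε0
        hy hQ (sub_pos.2 hr2')] with n hn
      refine le_iInf₂ fun u hu => EReal.coe_le_coe_iff.2 ?_
      have := hn u hu
      linarith
    · have htop : ∀ᶠ n in atTop, discreteFunctional f Ω (ε n) (y n) = ⊤ := by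
        filter_upwards [not_frequently.1 hfreq] with n hn
        exact iInf₂_eq_top.2 fun u hu => absurd hu.1 hn
      rw [liminf_congr htop]
      simp
  · by_cases hQ : ∀ᵐ x ∂(volume.restrict Ω), Q x ∈ tensorSet
    · obtain ⟨y, u, r, hy, hu, hr, hE⟩ := exists_recovery hf hC hgc hgm hgx hgC hglarge ho
        hb hl hε hε0 hQ
      refine ⟨y, hy, ?_⟩
      rw [hlimit Q hQ]
      have ht : Tendsto (fun n => ((4 * (∫ x in Ω, g (modulus (Q x))) + r n : ℝ) : EReal)) atTop
          (𝓝 ((4 * ∫ x in Ω, g (modulus (Q x)) : ℝ) : EReal)) := by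
        refine (continuous_coe_real_ereal.tendsto _).comp ?_
        simpa using hr.const_add (4 * ∫ x in Ω, g (modulus (Q x)))
      rw [← ht.limsup_eq]
      refine limsup_le_limsup (Eventually.of_forall fun n => ?_)
      exact (iInf₂_le (u n) (hu n)).trans (EReal.coe_le_coe_iff.2 (hE n))
    · refine ⟨fun _ => Q, by let _ := weakStarTopology Ω; exact tendsto_const_nhds, ?_⟩
      rw [limitFunctional, if_neg hQ]
      exact le_top

end NematicLattice

end

theorem theorem3p11
    (Ω : Set NematicLattice.Plane) (hΩ_open : IsOpen Ω) (hΩ_bdd : Bornology.IsBounded Ω)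
    (hΩ_lip : NematicLattice.HasLipschitzBoundary Ω)
    (h : ℝ → ℝ) (h_borel : Measurable (fun t : Set.Icc (0 : ℝ) 1 => h t))
    (h_bdd : ∃ C : ℝ, ∀ t ∈ Set.Icc (0 : ℝ) 1, |h t| ≤ C)
    (f : NematicLattice.Circ → NematicLattice.Circ → ℝ)
    (hf : ∀ u v : NematicLattice.Circ,
      f u v = h |inner ℝ (u : NematicLattice.Plane) (v : NematicLattice.Plane)|) :
    NematicLattice.GammaConverges (NematicLattice.weakStarTopology Ω)
      (NematicLattice.discreteFunctional f Ω) (NematicLattice.limitFunctional h Ω) := by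
  obtain ⟨C, hC⟩ := h_bdd
  exact NematicLattice.gammaConverges_discreteFunctional hΩ_open hΩ_bdd hΩ_lip hC hf
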